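/- \textbf{Setting.} Let $d\ge 1$, let $\mathcal K^d$ be the set of compact convex subsets of $\mathbb R^d$ (including $\emptyset$) and $\mathcal R^d$ the convex ring, i.e. the set of all finite unions of elements of $\mathcal K^d$. Let $(\mathbb M,\mathcal F_{\mathbb M},\mathbb Q)$ be a probability space, $\gamma>0$, $\lambda_d$ the Lebesgue measure on $\mathbb R^d$, and let $\eta$ be a Poisson process on $\mathbb R^d\times\mathbb M$ with intensity measure $\lambda=\gamma\,\lambda_d\otimes\mathbb Q$, whose realisations are countable sums of Dirac measures. Let $g_m:\mathbb R^d\to[0,\infty)$, $m\in\mathbb M$, be integrable functions such that the closed support $K_m=\overline{\{g_m>0\}}$ is compact and convex with $\lambda_d(K_m)>0$, $g_m$ is continuous and concave on $K_m$, and $m\mapsto g_m$ is measurable with respect to the Borel $\sigma$-algebra of the $L^1$-norm. For $u>0$ let $$f_\mu(y)=\sum_{(x,m)\in\mu}g_m(y-x),\qquad Z_u(\mu)=\{y\in\mathbb R^d: f_\mu(y)\ge u\},\qquad Z_u=Z_u(\eta),$$ for counting measures $\mu$ on $\mathbb R^d\times\mathbb M$. For $\hat x=(x,m)$ put $K(\hat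 x)=K_m+x$. For a function $F$ of a counting measure put $D_{\hat x}F(\mu)=F(\mu+\delta_{\hat x})-F(\mu)$ and $D^n_{\hat x_1,\dots,\hat x_n}F=D_{\hat x_1}(D^{n-1}_{\hat x_2,\dots,\hat x_n}F)$. Let $\varphi:\mathcal R^d\to\mathbb R$ be a geometric functional, i.e. $\varphi$ is measurable (for the trace on $\mathcal R^d$ of the Borel $\sigma$-algebra of the Fell topology), translation invariant, additive ($\varphi(\emptyset)=0$ and $\varphi(A\cup B)=\varphi(A)+\varphi(B)-\varphi(A\cap B)$ for $A,B\in\mathcal R^d$), and bounded on $\{A\in\mathcal K^d:A\subseteq[0,1]^d\}$. Let $W\in\mathcal K^d$ with $\lambda_d(W)>0$ and $W_r=rW$ for $r\ge1$. Denote by $V_0,\dots,V_d$ the intrinsic volumes, so that $V_d$ is the volume. \textbf{Theorem.} Assume that $\int_{\mathbb M}V_i(K_m)^2\,\mathbb Q(\mathrm dm)<\infty$ for $i=1,\dots,d$. Then $\varphi(Z_u\cap W_r)$ is square-integrable for every $r\ge1$, and $$\lim_{r\to\infty}\frac{\operatorname{Var}[\varphi(Z_u\cap W_r)]}{V_d(W_r)}=\sigma_0$$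 exists, is finite and is given by the convergent series $$\sigma_0=\sum_{n=1}^\infty\frac{\gamma}{n!}\int_{\mathbb M}\int_{(\mathbb R^d\times\mathbb M)^{n-1}}\Big(\mathbb E\,D^n_{(\mathbf 0,m),\hat x_2,\dots,\hat x_n}\varphi(Z_u\cap K)\Big)^2\,\lambda^{n-1}(\mathrm d(\hat x_2,\dots,\hat x_n))\,\mathbb Q(\mathrm dm),$$ where $K=K_m\cap\bigcap_{j=2}^nK(\hat x_j)$ is kept fixed when the difference operator is applied to $\mu\mapsto\varphi(Z_u(\mu)\cap K)$. All expectations $\mathbb E\,D^n_{(\mathbf 0,m),\hat x_2,\dots,\hat x_n}\varphi(Z_u\cap K)$ exist, and their squares are $\mathbb Q\otimes\lambda^{n-1}$-integrable for every $n\ge 1$. -/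

import Mathlib

open MeasureTheory ProbabilityTheory Filter Topology Polynomial
open scoped NNReal ENNReal Pointwise

namespace ShotNoise

noncomputable section

/-- Euclidean space `ℝ^d`. -/
abbrev E (d : ℕ) := EuclideanSpace ℝ (Fin d)

/-! ### Compact convex sets, the convex ring, geometric functionals -/

/-- Compact convex sets; the empty set is included. -/
def IsCompactConvex {d : ℕ} (K : Set (E d)) : Prop := IsCompact K ∧ Convex ℝ K

/-- Finite unions of compact convex sets. -/
def IsPolyconvex {d : ℕ} (A : Set (E d)) : Prop :=
  ∃ S : Set (Set (E d)), S.Finite ∧ (∀ K ∈ S, IsCompactConvex K) ∧ A = ⋃₀ S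

/-- The convex ring, as a type. -/
def ConvexRing (d : ℕ) := {A : Set (E d) // IsPolyconvex A}

/-- The trace on the convex ring of the Borel `σ`-algebra of the Fell topology, which is generated
by the families of the sets that hit a given open set. -/
instance (d : ℕ) : MeasurableSpace (ConvexRing d) :=
  MeasurableSpace.generateFrom
    {𝒜 | ∃ U : Set (E d), IsOpen U ∧ 𝒜 = {A : ConvexRing d | (A.1 ∩ U).Nonempty}}

/-- Translate of a set. -/
def translate {d : ℕ} (x : E d) (A : Set (E d)) : Set (E d) := (fun y => y + x) '' A

/-- The closed unit cube `[0,1]^d`. -/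
def unitCube (d : ℕ) : Set (E d) := {y | ∀ i, y i ∈ Set.Icc (0 : ℝ) 1}

/-- Geometric functionals. Only the values of `φ` on polyconvex sets are restricted: `φ` stands for
a function on the convex ring, extended arbitrarily to all subsets. -/
structure IsGeometricFunctional {d : ℕ} (φ : Set (E d) → ℝ) : Prop where
  measurable : Measurable fun A : ConvexRing d => φ A.1
  translation_invariant : ∀ (A : Set (E d)) (x : E d), IsPolyconvex A → φ (translate x A) = φ A
  map_empty : φ ∅ = 0
  additive : ∀ A B : Set (E d), IsPolyconvex A → IsPolyconvex B →
    φ (A ∪ B) = φ A + φ B - φ (A ∩ B)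
  locally_bounded : ∃ C : ℝ, ∀ A : Set (E d), IsCompactConvex A → A ⊆ unitCube d → |φ A| ≤ C

/-! ### Intrinsic volumes -/

/-- The volume of the `n`-dimensional unit ball. -/
def ballVolume (n : ℕ) : ℝ := volume.real (Metric.closedBall (0 : E n) 1)

/-- The volume of the parallel body `{x | dist(K, x) ≤ r}`. -/
def parallelVolume {d : ℕ} (K : Set (E d)) (r : ℝ) : ℝ := volume.real (Metric.cthickening r K)

open Classical in
/-- The Euler characteristic of a compact convex set. -/
def convexEuler {d : ℕ} (K : Set (E d)) : ℝ := if K.Nonempty then 1 else 0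

/-- The Steiner polynomial of a compact convex set `K`: the polynomial of degree at most `d` with
leading coefficient `ballVolume d * convexEuler K` whose values at the radii `0, 1, …, d - 1` are
the volumes of the parallel bodies of `K`. By the Steiner formula it gives the volume of the
parallel body at every radius `r ≥ 0`. -/
def steinerPolynomial {d : ℕ} (K : Set (E d)) : ℝ[X] :=
  C (ballVolume d * convexEuler K) * X ^ d +
    Lagrange.interpolate (Finset.range d) (fun j : ℕ => (j : ℝ))
      (fun j : ℕ => parallelVolume K j - ballVolume d * convexEuler K * (j : ℝ) ^ d)

/-- The intrinsic volume `V_i(K)`, `0 ≤ i ≤ d`, of a compact convex set `K`: the coefficients in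
`parallelVolume K r = ∑ i ≤ d, r ^ (d - i) * ballVolume (d - i) * V_i(K)`. -/
def intrinsicVolume {d : ℕ} (i : ℕ) (K : Set (E d)) : ℝ :=
  (steinerPolynomial K).coeff (d - i) / ballVolume (d - i)

theorem ballVolume_pos (n : ℕ) : 0 < ballVolume n := by
  unfold ballVolume
  rw [measureReal_def]
  refine ENNReal.toReal_pos ?_ (isCompact_closedBall _ _).measure_lt_top.ne
  exact (Metric.measure_closedBall_pos _ _ one_pos).ne'

theorem volume_closedBall_eq {d : ℕ} (x : E d) {r : ℝ} (hr : 0 ≤ r) :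
    volume.real (Metric.closedBall x r) = ballVolume d * r ^ d := by
  unfold ballVolume
  rw [measureReal_def, Measure.addHaar_closedBall' _ _ hr, ENNReal.toReal_mul,
    ENNReal.toReal_ofReal (by positivity), finrank_euclideanSpace_fin, mul_comm]
  rfl

/-- The definition of the intrinsic volumes gives the coefficients in the Steiner formula: whenever
the volume of the parallel bodies has the Steiner expansion, its coefficients are the intrinsic
volumes. -/
theorem intrinsicVolume_eq_of_steiner {d : ℕ} {K : Set (E d)} (hK : IsCompactConvex K)
    (hne : K.Nonempty) (c : ℕ → ℝ)
    (h : ∀ r : ℝ, 0 ≤ r → parallelVolume K r =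
      ∑ k ∈ Finset.range (d + 1), r ^ (d - k) * ballVolume (d - k) * c k)
    {i : ℕ} (hi : i ≤ d) : intrinsicVolume i K = c i := by
  have hc0 : c 0 = 1 := by
    obtain ⟨x, hx⟩ := hne
    obtain ⟨R, hR0, hR⟩ : ∃ R : ℝ, 0 ≤ R ∧ K ⊆ Metric.closedBall x R := by
      obtain ⟨R, hR⟩ := hK.1.isBounded.subset_closedBall x
      exact ⟨max R 0, le_max_right _ _, hR.trans (Metric.closedBall_subset_closedBall
        (le_max_left _ _))⟩
    have hfin : ∀ r : ℝ, volume (Metric.cthickening r K) ≠ ⊤ := fun r =>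
      (hK.1.isBounded.cthickening.measure_lt_top).ne
    have hlow : ∀ r : ℝ, 0 ≤ r → ballVolume d * r ^ d ≤ parallelVolume K r := by
      intro r hr
      rw [← volume_closedBall_eq x hr]
      exact measureReal_mono (Metric.closedBall_subset_cthickening hx r) (hfin r)
    have hup : ∀ r : ℝ, 0 ≤ r → parallelVolume K r ≤ ballVolume d * (r + R) ^ d := by
      intro r hr
      rw [← volume_closedBall_eq x (add_nonneg hr hR0)]
      refine measureReal_mono ?_ (isCompact_closedBall _ _).measure_lt_top.ne
      refine (Metric.cthickening_subset_of_subset r hR).trans ?_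
      exact (cthickening_closedBall hr hR0 x).subset
    have hpos := ballVolume_pos d
    have hone : Tendsto (fun r : ℝ => (1 + R * r⁻¹) ^ d) atTop (𝓝 1) := by
      have := ((tendsto_inv_atTop_zero (𝕜 := ℝ)).const_mul R).const_add 1 |>.pow d
      simpa using this
    have h1 : Tendsto (fun r : ℝ => parallelVolume K r / r ^ d) atTop (𝓝 (ballVolume d)) := by
      refine tendsto_of_tendsto_of_tendsto_of_le_of_le' tendsto_const_nhds
        (h := fun r : ℝ => ballVolume d * (1 + R * r⁻¹) ^ d) ?_ ?_ ?_
      · simpa using hone.const_mul (ballVolume d)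
      · filter_upwards [eventually_gt_atTop (0 : ℝ)] with r hr
        rw [le_div_iff₀ (by positivity)]
        exact hlow r hr.le
      · filter_upwards [eventually_gt_atTop (0 : ℝ)] with r hr
        rw [div_le_iff₀ (by positivity), mul_assoc, ← mul_pow]
        have : (1 + R * r⁻¹) * r = r + R := by field_simp
        rw [this]
        exact hup r hr.le
    have h2 : Tendsto (fun r : ℝ => parallelVolume K r / r ^ d) atTop
        (𝓝 (ballVolume d * c 0)) := by
      have h3 : Tendsto (fun r : ℝ => ∑ k ∈ Finset.range (d + 1),
          (r⁻¹) ^ k * (ballVolume (d - k) * c k)) atTop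
          (𝓝 (∑ k ∈ Finset.range (d + 1), (0 : ℝ) ^ k * (ballVolume (d - k) * c k))) :=
        tendsto_finsetSum _ fun k _ => (tendsto_inv_atTop_zero.pow k).mul_const _
      have h4 : ∑ k ∈ Finset.range (d + 1), (0 : ℝ) ^ k * (ballVolume (d - k) * c k) =
          ballVolume d * c 0 := by
        rw [Finset.sum_eq_single 0]
        · simp
        · intro k _ hk
          simp [hk]
        · simp
      rw [h4] at h3
      refine h3.congr' ?_
      filter_upwards [eventually_gt_atTop (0 : ℝ)] with r hr
      rw [h r hr.le, Finset.sum_div]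
      refine Finset.sum_congr rfl fun k hk => ?_
      have hk' : k ≤ d := Nat.lt_succ_iff.mp (Finset.mem_range.mp hk)
      have : r ^ d = r ^ (d - k) * r ^ k := by rw [← pow_add, Nat.sub_add_cancel hk']
      rw [this, inv_pow]
      field_simp
    have := tendsto_nhds_unique h1 h2
    field_simp at this
    linarith
  have hpoly : steinerPolynomial K =
      ∑ k ∈ Finset.range (d + 1), C (ballVolume (d - k) * c k) * X ^ (d - k) := by
    have hχ : convexEuler K = 1 := by simp [convexEuler, hne]
    rw [Finset.sum_range_succ', steinerPolynomial, hχ, add_comm]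
    simp only [hc0, Nat.sub_zero, mul_one]
    congr 1
    symm
    refine Lagrange.eq_interpolate_of_eval_eq _ (fun a _ b _ hab => by exact_mod_cast hab) ?_ ?_
    · rw [Finset.card_range]
      refine (Polynomial.degree_sum_le _ _).trans_lt ?_
      refine (Finset.sup_lt_iff (WithBot.bot_lt_coe d)).mpr fun k hk => ?_
      refine (Polynomial.degree_C_mul_X_pow_le _ _).trans_lt ?_
      have := Finset.mem_range.mp hk
      exact Nat.cast_lt.mpr (by omega)
    · intro j _
      rw [h j (Nat.cast_nonneg j), Finset.sum_range_succ', Polynomial.eval_finsetSum]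
      simp only [hc0, Nat.sub_zero, mul_one, eval_mul, eval_C, eval_pow, eval_X]
      rw [mul_comm ((j : ℝ) ^ d), add_sub_cancel_right]
      exact Finset.sum_congr rfl fun k _ => by ring
  rw [intrinsicVolume, hpoly, Polynomial.finsetSum_coeff, Finset.sum_eq_single i]
  · rw [Polynomial.coeff_C_mul_X_pow, if_pos rfl]
    field_simp [(ballVolume_pos (d - i)).ne']
  · intro k hk hki
    have := Finset.mem_range.mp hk
    rw [Polynomial.coeff_C_mul_X_pow, if_neg (by omega)]
  · intro hi'
    exact absurd (Finset.mem_range.mpr (Nat.lt_succ_of_le hi)) hi'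

/-! ### Kernel functions -/

/-- Integrable functions whose closed support is compact and convex and whose restriction to the
closed support is continuous. -/
def KernelSpace (d : ℕ) :=
  {f : E d → ℝ // Integrable f ∧ IsCompactConvex (tsupport f) ∧ ContinuousOn f (tsupport f)}

/-- The closed support. -/
def KernelSpace.supp {d : ℕ} (f : KernelSpace d) : Set (E d) := tsupport f.1

/-- The class in `L¹`. -/
def KernelSpace.toL1 {d : ℕ} (f : KernelSpace d) : E d →₁[volume] ℝ := f.2.1.toL1 f.1

/-- The Borel `σ`-algebra of the `L¹`-norm. -/
instance (d : ℕ) : MeasurableSpace (KernelSpace d) :=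
  @borel (KernelSpace d) (TopologicalSpace.induced KernelSpace.toL1 inferInstance)

/-- The assumptions on the family of kernel functions. -/
structure IsKernelFamily {d : ℕ} {𝕄 : Type*} [MeasurableSpace 𝕄] (g : 𝕄 → KernelSpace d) :
    Prop where
  measurable : Measurable g
  nonneg : ∀ m y, 0 ≤ (g m).1 y
  concaveOn : ∀ m, ConcaveOn ℝ (g m).supp (g m).1
  volume_supp_pos : ∀ m, 0 < volume (g m).supp

/-! ### Poisson processes and difference operators -/

/-- Counting measures: countable sums of Dirac measures (points may be repeated). -/
def IsCountingMeasure {𝕏 : Type*} [MeasurableSpace 𝕏] (μ : Measure 𝕏) : Prop :=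
  ∃ (ι : Type) (_ : Countable ι) (x : ι → 𝕏), μ = Measure.sum fun i => Measure.dirac (x i)

open Classical in
/-- The Poisson distribution with parameter `t ∈ [0, ∞]`, on `[0, ∞]`; for `t = ∞` it is the point
mass at `∞`. -/
def poissonLaw (t : ℝ≥0∞) : Measure ℝ≥0∞ :=
  if t = ⊤ then Measure.dirac ⊤ else (poissonMeasure t.toNNReal).map (fun n : ℕ => (n : ℝ≥0∞))

/-- `η` is a Poisson process with intensity measure `Λ` on the probability space `(Ω, P)`.
The space of measures carries the `σ`-algebra generated by the evaluations at measurable sets. -/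
structure IsPoissonProcess {Ω 𝕏 : Type*} [MeasurableSpace Ω] [MeasurableSpace 𝕏]
    (Λ : Measure 𝕏) (η : Ω → Measure 𝕏) (P : Measure Ω) : Prop where
  measurable : Measurable η
  counting : ∀ ω, IsCountingMeasure (η ω)
  sigmaFinite : ∀ ω, SigmaFinite (η ω)
  law : ∀ B : Set 𝕏, MeasurableSet B → P.map (fun ω => η ω B) = poissonLaw (Λ B)
  indep : ∀ (n : ℕ) (B : Fin n → Set 𝕏), (∀ i, MeasurableSet (B i)) →
    Pairwise (fun i j => Disjoint (B i) (B j)) → iIndepFun (fun i ω => η ω (B i)) P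

/-- The iterated difference operator `D^n_{x_1, …, x_n} F = D_{x_1} (D^{n-1}_{x_2, …, x_n} F)` with
`D_x F = F(· + δ_x) - F`. -/
def diffOp {𝕏 : Type*} [MeasurableSpace 𝕏] (F : Measure 𝕏 → ℝ) :
    (n : ℕ) → (Fin n → 𝕏) → Measure 𝕏 → ℝ
  | 0, _, μ => F μ
  | n + 1, x, μ =>
      diffOp F n (Fin.tail x) (μ + Measure.dirac (x 0)) - diffOp F n (Fin.tail x) μ

/-! ### The shot noise process and its excursion sets -/

section Model

variable {d : ℕ} {𝕄 : Type*} [MeasurableSpace 𝕄]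

/-- The intensity measure of the marked Poisson process. -/
def intensity (d : ℕ) {𝕄 : Type*} [MeasurableSpace 𝕄] (γ : ℝ≥0) (Q : Measure 𝕄) :
    Measure (E d × 𝕄) :=
  γ • (volume : Measure (E d)).prod Q

/-- The shot noise field `y ↦ ∑ g_m(y - x)`, where the sum runs over the points `(x, m)` of `μ`. -/
def shotNoise (g : 𝕄 → KernelSpace d) (μ : Measure (E d × 𝕄)) (y : E d) : ℝ≥0∞ :=
  ∫⁻ p, ENNReal.ofReal ((g p.2).1 (y - p.1)) ∂μ

/-- The excursion set of the shot noise field at level `u`. -/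
def excursionSet (g : 𝕄 → KernelSpace d) (u : ℝ) (μ : Measure (E d × 𝕄)) : Set (E d) :=
  {y | ENNReal.ofReal u ≤ shotNoise g μ y}

/-- The translated support of a marked point. -/
def pointSupp (g : 𝕄 → KernelSpace d) (p : E d × 𝕄) : Set (E d) := translate p.1 (g p.2).supp

/-- The set `K_m ∩ ⋂ j, K(x_j)`. -/
def commonSupp (g : 𝕄 → KernelSpace d) (m : 𝕄) {k : ℕ} (x : Fin k → E d × 𝕄) : Set (E d) :=
  (g m).supp ∩ ⋂ j, pointSupp g (x j)

/-- The `(k+1)`-st difference operator of `φ(Z_u ∩ K)` with respect to the points `(0, m)` and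
`x_1, …, x_k`, where `K = K_m ∩ ⋂ j, K(x_j)` is kept fixed. -/
def originDiff (φ : Set (E d) → ℝ) (g : 𝕄 → KernelSpace d) (u : ℝ) (m : 𝕄) {k : ℕ}
    (x : Fin k → E d × 𝕄) (μ : Measure (E d × 𝕄)) : ℝ :=
  diffOp (fun ν => φ (excursionSet g u ν ∩ commonSupp g m x)) (k + 1)
    (Fin.cons ((0 : E d), m) x : Fin (k + 1) → E d × 𝕄) μ

end Model

end

end ShotNoise

namespace ShotNoise

noncomputable section

/-! ### Valuations on the convex ring -/

section Valuation

variable {d : ℕ}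

/-! The variance is expanded by the Fock space representation Var F = ∑ (1/n!) ∫ (E Dⁿ F)² dλⁿ over
n ≥ 1, and the limit is taken in every term.

Localisation: adding a point changes the excursion set only inside the support of that point.
Additivity of φ therefore turns Dⁿ φ(Z ∩ W) into Dⁿ φ(Z ∩ W ∩ K(x₁) ∩ … ∩ K(xₙ))
(`confDiff_windowFun_inter`). Stationarity moves the first point v to the origin, and the window
becomes rW - v (`meanDiff_cons_shift`). After the substitution v = r w and division by the volume of
rW, only bounded w contribute. For w inside W the translated window eventually contains the common
support, for w outside W it eventually misses it, and the boundary of W is null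
(`tendsto_sqDiff_smul`). So each normalised term tends to the corresponding term of the series for
σ₀.

Bounds: the excursion set is a signed combination of compact convex cells, the superlevel sets of
concave sums on intersections of supports (`ind_finExcursion_inter`). After cutting a window into
small cubes, φ is at most a constant times 3^N on each cube, where N counts the points whose
supports hit a neighbourhood of the cube (`abs_finExcursion_inter_le`). As N is Poisson with a
parameter bounded by some κ, E Dⁿ φ(Z ∩ A) is at most 4ⁿ times a constant times the number of cubes
near A (`exists_abs_meanDiff_le`). Squared and integrated, this gives a bound of order (16κ)ᵏ ∫
cubes(K_m)² dQ for n = k + 1 (`lintegral_cubesBound_le`). The integral is finite because the number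
of cubes is controlled by the volume of a parallel body, hence by the intrinsic volumes
(`exists_parallelVolume_one_le`). The factorials beat the geometric growth, so dominated convergence
applies to the integrals and then to the series.

Three foundations support this. The Fock representation `hasSum_sq_confDiff` comes from an identity
between exponentials of commuting averaged shift operators. The law of the process on a set of
finite intensity is found from its characteristic functional (`IsPoissonProcess.map_localConf`).
Measurability is extracted from the L¹ structure alone, because the kernels are upper semicontinuous
and their supports have dense interior (`measurable_kernel`, `measurable_windowFun`). -/

theorem isCompactConvex_empty : IsCompactConvex (∅ : Set (E d)) :=
  ⟨isCompact_empty, convex_empty⟩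

theorem IsCompactConvex.inter {A B : Set (E d)} (hA : IsCompactConvex A)
    (hB : IsCompactConvex B) : IsCompactConvex (A ∩ B) :=
  ⟨hA.1.inter hB.1, hA.2.inter hB.2⟩

theorem IsCompactConvex.isPolyconvex {A : Set (E d)} (hA : IsCompactConvex A) :
    IsPolyconvex A :=
  ⟨{A}, Set.finite_singleton A, by simpa using hA, by simp⟩

theorem isPolyconvex_empty : IsPolyconvex (∅ : Set (E d)) :=
  isCompactConvex_empty.isPolyconvex

theorem IsPolyconvex.union {A B : Set (E d)} (hA : IsPolyconvex A) (hB : IsPolyconvex B) :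
    IsPolyconvex (A ∪ B) := by
  obtain ⟨S, hS, hS', rfl⟩ := hA
  obtain ⟨T, hT, hT', rfl⟩ := hB
  refine ⟨S ∪ T, hS.union hT, ?_, by rw [Set.sUnion_union]⟩
  rintro K (hK | hK)
  exacts [hS' K hK, hT' K hK]

theorem IsPolyconvex.inter {A B : Set (E d)} (hA : IsPolyconvex A) (hB : IsPolyconvex B) :
    IsPolyconvex (A ∩ B) := by
  obtain ⟨S, hS, hS', rfl⟩ := hA
  obtain ⟨T, hT, hT', rfl⟩ := hB
  refine ⟨Set.image2 (· ∩ ·) S T, hS.image2 _ hT, ?_, ?_⟩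
  · rintro _ ⟨K, hK, L, hL, rfl⟩
    exact (hS' K hK).inter (hT' L hL)
  · ext y
    simp only [Set.mem_inter_iff, Set.mem_sUnion, Set.mem_image2]
    constructor
    · rintro ⟨⟨K, hK, hy⟩, L, hL, hy'⟩
      exact ⟨_, ⟨K, hK, L, hL, rfl⟩, hy, hy'⟩
    · rintro ⟨_, ⟨K, hK, L, hL, rfl⟩, hy, hy'⟩
      exact ⟨⟨K, hK, hy⟩, L, hL, hy'⟩

theorem isPolyconvex_biUnion {ι : Type*} (s : Finset ι) (A : ι → Set (E d))
    (hA : ∀ i ∈ s, IsPolyconvex (A i)) : IsPolyconvex (⋃ i ∈ s, A i) := by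
  classical
  induction s using Finset.induction_on with
  | empty => simpa using isPolyconvex_empty
  | insert a s _ ih =>
    rw [Finset.set_biUnion_insert]
    exact (hA a (Finset.mem_insert_self a s)).union
      (ih fun i hi => hA i (Finset.mem_insert_of_mem hi))

open Classical in
/-- The indicator function with values in `ℝ`. -/
def ind (A : Set (E d)) (y : E d) : ℝ := if y ∈ A then 1 else 0

theorem ind_of_mem {A : Set (E d)} {y : E d} (h : y ∈ A) : ind A y = 1 := if_pos h

theorem ind_of_notMem {A : Set (E d)} {y : E d} (h : y ∉ A) : ind A y = 0 := if_neg h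

theorem ind_congr {A B : Set (E d)} {y : E d} (h : y ∈ A ↔ y ∈ B) : ind A y = ind B y := by
  unfold ind
  split_ifs <;> simp_all

/-- The difference φ(B ∩ U) - φ(B ∩ U ∩ L) plays the role of φ on B ∩ (U \ L), which need not be
polyconvex. The induction splits U \ L along a set A j: inside it the coefficient c j is absorbed
into a, outside it A j is absorbed into L. -/
theorem IsGeometricFunctional.sum_eq_zero_on {φ : Set (E d) → ℝ} (hφ : IsGeometricFunctional φ)
    {ι : Type*} (s : Finset ι) (c : ι → ℝ) (A : ι → Set (E d)) (hA : ∀ i ∈ s, IsPolyconvex (A i)) :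
    ∀ (a : ℝ) (U L : Set (E d)), IsPolyconvex U → IsPolyconvex L →
      (∀ y ∈ U, y ∉ L → a + ∑ i ∈ s, c i * ind (A i) y = 0) →
      a * (φ U - φ (U ∩ L)) + ∑ i ∈ s, c i * (φ (A i ∩ U) - φ (A i ∩ U ∩ L)) = 0 := by
  classical
  induction s using Finset.induction_on with
  | empty =>
    intro a U L _ _ h
    simp only [Finset.sum_empty, add_zero] at h ⊢
    -- Either the region U \ L is empty, or the relation holds at one of its points and forces a =
    -- 0.
    by_cases hUL : U ⊆ L
    · rw [Set.inter_eq_left.mpr hUL]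
      simp
    · obtain ⟨y, hy, hy'⟩ := Set.not_subset.mp hUL
      rw [h y hy hy', zero_mul]
  | insert j s hj ih =>
    intro a U L hU hL h
    have hAj := hA j (Finset.mem_insert_self j s)
    have hAs : ∀ i ∈ s, IsPolyconvex (A i) := fun i hi => hA i (Finset.mem_insert_of_mem hi)
    have h1 := ih hAs (a + c j) (U ∩ A j) L (hU.inter hAj) hL fun y hy hy' => by
      have := h y hy.1 hy'
      rw [Finset.sum_insert hj, ind_of_mem hy.2] at this
      linarith
    have h2 := ih hAs a U (L ∪ A j) hU (hL.union hAj) fun y hy hy' => by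
      have := h y hy fun h => hy' (Or.inl h)
      rw [Finset.sum_insert hj, ind_of_notMem fun h => hy' (Or.inr h)] at this
      linarith
    have key : ∀ B : Set (E d), IsPolyconvex B → φ (B ∩ (L ∪ A j)) =
        φ (B ∩ L) + φ (B ∩ A j) - φ (B ∩ A j ∩ L) := fun B hB => by
      rw [Set.inter_union_distrib_left, hφ.additive _ _ (hB.inter hL) (hB.inter hAj)]
      congr 2
      ext y
      simp only [Set.mem_inter_iff]
      tauto
    rw [Finset.sum_insert hj, Set.inter_comm (A j) U]
    rw [key U hU] at h2
    have h3 : ∑ i ∈ s, c i * (φ (A i ∩ U) - φ (A i ∩ U ∩ L)) =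
        ∑ i ∈ s, c i * (φ (A i ∩ (U ∩ A j)) - φ (A i ∩ (U ∩ A j) ∩ L)) +
        ∑ i ∈ s, c i * (φ (A i ∩ U) - φ (A i ∩ U ∩ (L ∪ A j))) := by
      rw [← Finset.sum_add_distrib]
      refine Finset.sum_congr rfl fun i hi => ?_
      rw [key _ ((hAs i hi).inter hU), ← Set.inter_assoc]
      ring
    rw [h3]
    linarith

/-- An additive functional respects the linear relations between indicator functions. -/
theorem IsGeometricFunctional.sum_eq_zero {φ : Set (E d) → ℝ} (hφ : IsGeometricFunctional φ)
    {ι : Type*} (s : Finset ι) (c : ι → ℝ) (A : ι → Set (E d)) (hA : ∀ i ∈ s, IsPolyconvex (A i))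
    (h : ∀ y, ∑ i ∈ s, c i * ind (A i) y = 0) : ∑ i ∈ s, c i * φ (A i) = 0 := by
  have := hφ.sum_eq_zero_on s c A hA 0 (⋃ i ∈ s, A i) ∅ (isPolyconvex_biUnion s A hA)
    isPolyconvex_empty fun y _ _ => by rw [zero_add, h y]
  rw [zero_mul, zero_add] at this
  rw [← this]
  refine Finset.sum_congr rfl fun i hi => ?_
  rw [Set.inter_empty, hφ.map_empty, sub_zero,
    Set.inter_eq_left.mpr (Set.subset_iUnion₂ (s := fun i (_ : i ∈ s) => A i) i hi)]

theorem IsGeometricFunctional.eq_sum {φ : Set (E d) → ℝ} (hφ : IsGeometricFunctional φ)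
    {ι : Type*} (s : Finset ι) (c : ι → ℝ) (A : ι → Set (E d)) (hA : ∀ i ∈ s, IsPolyconvex (A i))
    (B : Set (E d)) (hB : IsPolyconvex B) (h : ∀ y, ind B y = ∑ i ∈ s, c i * ind (A i) y) :
    φ B = ∑ i ∈ s, c i * φ (A i) := by
  have := hφ.sum_eq_zero (Finset.insertNone s) (fun o => o.elim (-1) c)
    (fun o => o.elim B A) (by
      rintro (_ | i) hi
      · exact hB
      · exact hA i (by simpa using hi)) (fun y => by
        rw [Finset.sum_insertNone]
        simp [h y])
  rw [Finset.sum_insertNone] at this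
  simp only [Option.elim] at this
  linarith

theorem IsCompactConvex.translate {A : Set (E d)} (hA : IsCompactConvex A) (x : E d) :
    IsCompactConvex (translate x A) := by
  refine ⟨hA.1.image (continuous_id.add continuous_const), ?_⟩
  have := hA.2.translate x
  simp only [add_comm x] at this
  exact this

theorem mem_translate {A : Set (E d)} {x y : E d} : y ∈ translate x A ↔ y - x ∈ A := by
  constructor
  · rintro ⟨z, hz, rfl⟩
    simpa using hz
  · exact fun h => ⟨y - x, h, sub_add_cancel y x⟩

/-- A bound for the values on compact convex subsets of translates of the unit cube. -/
theorem IsGeometricFunctional.exists_bound {φ : Set (E d) → ℝ} (hφ : IsGeometricFunctional φ) :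
    ∃ C : ℝ, 0 ≤ C ∧ ∀ (A : Set (E d)) (x : E d), IsCompactConvex A →
      A ⊆ ShotNoise.translate x (unitCube d) → |φ A| ≤ C := by
  obtain ⟨C, hC⟩ := hφ.locally_bounded
  refine ⟨C, (abs_nonneg _).trans (hC ∅ isCompactConvex_empty (Set.empty_subset _)), ?_⟩
  intro A x hA hAx
  rw [← hφ.translation_invariant A (-x) hA.isPolyconvex]
  refine hC _ (hA.translate _) fun y hy => ?_
  have := hAx (mem_translate.mp hy)
  rw [mem_translate] at this
  simpa using this

end Valuation

/-! ### Excursion sets of finite configurations -/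

section FiniteConfiguration

set_option linter.unusedSectionVars false

variable {d : ℕ} {𝕄 : Type*} [MeasurableSpace 𝕄]

/-- The kernel function of a marked point, centred at the location of the point. -/
def kern (g : 𝕄 → KernelSpace d) (p : E d × 𝕄) (y : E d) : ℝ := (g p.2).1 (y - p.1)

variable {g : 𝕄 → KernelSpace d}

theorem kern_nonneg (hg : IsKernelFamily g) (p : E d × 𝕄) (y : E d) : 0 ≤ kern g p y :=
  hg.nonneg _ _

theorem mem_pointSupp {p : E d × 𝕄} {y : E d} :
    y ∈ pointSupp g p ↔ y - p.1 ∈ (g p.2).supp := mem_translate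

theorem kern_eq_zero {p : E d × 𝕄} {y : E d} (h : y ∉ pointSupp g p) : kern g p y = 0 := by
  rw [mem_pointSupp] at h
  exact image_eq_zero_of_notMem_tsupport (f := (g p.2).1) h

theorem isCompactConvex_pointSupp (g : 𝕄 → KernelSpace d) (p : E d × 𝕄) :
    IsCompactConvex (pointSupp g p) :=
  IsCompactConvex.translate (g p.2).2.2.1 p.1

theorem continuousOn_kern (g : 𝕄 → KernelSpace d) (p : E d × 𝕄) :
    ContinuousOn (kern g p) (pointSupp g p) := by
  refine ContinuousOn.comp (g p.2).2.2.2 (continuous_id.sub continuous_const).continuousOn ?_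
  exact fun y hy => mem_pointSupp.mp hy

theorem concaveOn_kern (hg : IsKernelFamily g) (p : E d × 𝕄) :
    ConcaveOn ℝ (pointSupp g p) (kern g p) := by
  have h := (hg.concaveOn p.2).translate_left (-p.1)
  have h1 : (fun z => -p.1 + z) ⁻¹' (g p.2).supp = pointSupp g p := by
    ext y
    rw [mem_pointSupp, Set.mem_preimage, neg_add_eq_sub]
  rw [h1] at h
  have h2 : (g p.2).1 ∘ (fun z => z + -p.1) = kern g p := by
    funext y
    simp [kern, sub_eq_add_neg]
  rwa [h2] at h

open Classical in
/-- The compact convex pieces into which an excursion set decomposes. -/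
def cell {ι : Type*} (g : 𝕄 → KernelSpace d) (u : ℝ) (W : Set (E d)) (p : ι → E d × 𝕄)
    (I J : Finset ι) : Set (E d) :=
  {y ∈ W ∩ ⋂ i ∈ I ∪ J, pointSupp g (p i) | u ≤ ∑ i ∈ I, kern g (p i) y}

theorem concaveOn_sum_kern {ι : Type*} (hg : IsKernelFamily g) (p : ι → E d × 𝕄) {T : Set (E d)}
    (hT : Convex ℝ T) (I : Finset ι) (h : ∀ i ∈ I, T ⊆ pointSupp g (p i)) :
    ConcaveOn ℝ T fun y => ∑ i ∈ I, kern g (p i) y := by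
  classical
  induction I using Finset.induction_on with
  | empty => simpa using concaveOn_const (𝕜 := ℝ) (0 : ℝ) hT
  | insert a s ha ih =>
    simp only [Finset.sum_insert ha]
    exact ((concaveOn_kern hg _).subset (h a (Finset.mem_insert_self a s)) hT).add
      (ih fun i hi => h i (Finset.mem_insert_of_mem hi))

/-- On the common support of the points of I and J all kernels are continuous and concave, so the
superlevel set of the sum over I is closed and convex there. This is where concavity of the kernels
enters. -/
theorem isCompactConvex_cell {ι : Type*} (hg : IsKernelFamily g) (u : ℝ) {W : Set (E d)}
    (hW : IsCompactConvex W) (p : ι → E d × 𝕄) (I J : Finset ι) :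
    IsCompactConvex (cell g u W p I J) := by
  classical
  set T := W ∩ ⋂ i ∈ I ∪ J, pointSupp g (p i) with hT
  have hTsub : ∀ i ∈ I, T ⊆ pointSupp g (p i) := fun i hi y hy =>
    Set.mem_iInter₂.mp hy.2 i (Finset.mem_union_left _ hi)
  have hTc : IsCompact T := by
    refine hW.1.inter_right ?_
    exact isClosed_biInter fun i _ => (isCompactConvex_pointSupp g (p i)).1.isClosed
  have hTv : Convex ℝ T :=
    hW.2.inter (convex_iInter₂ fun i _ => (isCompactConvex_pointSupp g (p i)).2)
  have hcell : cell g u W p I J = {y ∈ T | u ≤ ∑ i ∈ I, kern g (p i) y} := by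
    simp only [cell, hT]
  rw [hcell]
  refine ⟨?_, (concaveOn_sum_kern hg p hTv I hTsub).convex_ge u⟩
  have hcont : ContinuousOn (fun y => ∑ i ∈ I, kern g (p i) y) T :=
    continuousOn_finsetSum _ fun i hi => (continuousOn_kern g (p i)).mono (hTsub i hi)
  exact hTc.of_isClosed_subset (hcont.preimage_isClosed_of_isClosed hTc.isClosed isClosed_Ici)
    fun y hy => hy.1

/-- The excursion set of a finite sum of kernel functions. -/
def finExcursion {ι : Type*} (g : 𝕄 → KernelSpace d) (u : ℝ) (p : ι → E d × 𝕄) (s : Finset ι) :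
    Set (E d) := {y | u ≤ ∑ i ∈ s, kern g (p i) y}

open Classical in
-- At a fixed y let I₀ be the set of points whose supports contain y. Only I, J ⊆ I₀ contribute, and
-- the alternating sum over J ⊆ I₀ \ I vanishes unless I = I₀. What remains is the condition that
-- the full field at y is at least u.
theorem ind_finExcursion_inter {ι : Type*} {u : ℝ} (W : Set (E d))
    (p : ι → E d × 𝕄) (s : Finset ι) (y : E d) :
    ind (finExcursion g u p s ∩ W) y =
      ∑ I ∈ s.powerset, ∑ J ∈ (s \ I).powerset, (-1 : ℝ) ^ J.card * ind (cell g u W p I J) y := by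
  by_cases hy : y ∈ W
  swap
  · rw [ind_of_notMem fun h => hy h.2]
    refine (Finset.sum_eq_zero fun I _ => Finset.sum_eq_zero fun J _ => ?_).symm
    rw [ind_of_notMem fun h => hy h.1.1, mul_zero]
  set I₀ := s.filter fun i => y ∈ pointSupp g (p i) with hI₀
  have hI₀s : I₀ ⊆ s := Finset.filter_subset _ _
  have hsum : ∑ i ∈ s, kern g (p i) y = ∑ i ∈ I₀, kern g (p i) y := by
    symm
    refine Finset.sum_subset hI₀s fun i hi hi' => kern_eq_zero fun h => hi' ?_
    exact Finset.mem_filter.mpr ⟨hi, h⟩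
  have hmem : ∀ I J : Finset ι, I ⊆ s → J ⊆ s → (y ∈ cell g u W p I J ↔
      (I ⊆ I₀ ∧ J ⊆ I₀) ∧ u ≤ ∑ i ∈ I, kern g (p i) y) := by
    intro I J hI hJ
    simp only [cell, Set.mem_ofPred_eq, Set.mem_inter_iff, hy, true_and, Set.mem_iInter]
    refine and_congr_left fun _ => ?_
    constructor
    · intro h
      exact ⟨fun i hi => Finset.mem_filter.mpr ⟨hI hi, h i (Finset.mem_union_left _ hi)⟩,
        fun i hi => Finset.mem_filter.mpr ⟨hJ hi, h i (Finset.mem_union_right _ hi)⟩⟩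
    · rintro ⟨h1, h2⟩ i hi
      rcases Finset.mem_union.mp hi with h | h
      exacts [(Finset.mem_filter.mp (h1 h)).2, (Finset.mem_filter.mp (h2 h)).2]
  have hinner : ∀ I ∈ s.powerset, ∑ J ∈ (s \ I).powerset,
      (-1 : ℝ) ^ J.card * ind (cell g u W p I J) y =
      if I = I₀ then (if u ≤ ∑ i ∈ I₀, kern g (p i) y then 1 else 0) else 0 := by
    intro I hI
    have hIs := Finset.mem_powerset.mp hI
    have hJs : ∀ J ∈ (s \ I).powerset, J ⊆ s := fun J hJ =>
      (Finset.mem_powerset.mp hJ).trans Finset.sdiff_subset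
    by_cases h1 : I ⊆ I₀ ∧ u ≤ ∑ i ∈ I, kern g (p i) y
    swap
    · rw [Finset.sum_eq_zero]
      · split_ifs with h2 h3
        · exact absurd ⟨h2.subset, h2 ▸ h3⟩ h1
        · rfl
        · rfl
      · intro J hJ
        rw [ind_of_notMem, mul_zero]
        rw [hmem I J hIs (hJs J hJ)]
        tauto
    have h2 : ∑ J ∈ (s \ I).powerset, (-1 : ℝ) ^ J.card * ind (cell g u W p I J) y =
        ∑ J ∈ (I₀ \ I).powerset, (-1 : ℝ) ^ J.card := by
      symm
      rw [← Finset.sum_subset (Finset.powerset_mono.mpr (Finset.sdiff_subset_sdiff hI₀s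
        (Finset.Subset.refl I)))]
      · refine Finset.sum_congr rfl fun J hJ => ?_
        have hJ' := (Finset.mem_powerset.mp hJ).trans Finset.sdiff_subset
        rw [ind_of_mem, mul_one]
        rw [hmem I J hIs (hJ'.trans hI₀s)]
        exact ⟨⟨h1.1, hJ'⟩, h1.2⟩
      · intro J hJ hJ'
        rw [ind_of_notMem, mul_zero]
        rw [hmem I J hIs (hJs J hJ)]
        rintro ⟨⟨-, h⟩, -⟩
        refine hJ' (Finset.mem_powerset.mpr fun i hi => Finset.mem_sdiff.mpr ⟨h hi, ?_⟩)
        exact (Finset.mem_sdiff.mp (Finset.mem_powerset.mp hJ hi)).2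
    rw [h2]
    have h3 : ∑ J ∈ (I₀ \ I).powerset, (-1 : ℝ) ^ J.card = if I₀ \ I = ∅ then 1 else 0 := by
      have := Finset.sum_powerset_neg_one_pow_card (x := I₀ \ I)
      have h4 := congrArg (Int.cast : ℤ → ℝ) this
      push_cast at h4
      exact h4
    rw [h3]
    by_cases h5 : I = I₀
    · subst h5
      rw [if_pos (by simp), if_pos rfl, if_pos h1.2]
    · rw [if_neg h5, if_neg]
      rw [Finset.sdiff_eq_empty_iff_subset]
      exact fun h => h5 (Finset.Subset.antisymm h1.1 h)
  rw [Finset.sum_congr rfl hinner, Finset.sum_ite_eq', if_pos (Finset.mem_powerset.mpr hI₀s)]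
  unfold ind
  congr 1
  simp [finExcursion, hy, hsum]

/-- Only the points active at y contribute to the field there, and dropping nonnegative summands
cannot raise it. Hence the cells with J = ∅ cover the excursion set exactly. -/
theorem isPolyconvex_finExcursion_inter {ι : Type*} (hg : IsKernelFamily g) (u : ℝ)
    {W : Set (E d)} (hW : IsCompactConvex W) (p : ι → E d × 𝕄) (s : Finset ι) :
    IsPolyconvex (finExcursion g u p s ∩ W) := by
  classical
  have h : finExcursion g u p s ∩ W = ⋃ I ∈ s.powerset, cell g u W p I ∅ := by
    ext y
    simp only [Set.mem_inter_iff, Set.mem_iUnion, finExcursion, Set.mem_ofPred_eq, cell,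
      Finset.union_empty, Set.mem_iInter, Finset.mem_powerset]
    constructor
    · rintro ⟨h1, h2⟩
      refine ⟨s.filter fun i => y ∈ pointSupp g (p i), Finset.filter_subset _ _, ⟨h2, fun i hi =>
        (Finset.mem_filter.mp hi).2⟩, h1.trans (le_of_eq ?_)⟩
      symm
      refine Finset.sum_subset (Finset.filter_subset _ _) fun i hi hi' => kern_eq_zero fun h =>
        hi' (Finset.mem_filter.mpr ⟨hi, h⟩)
    · rintro ⟨I, hI, ⟨h1, -⟩, h2⟩
      exact ⟨h2.trans (Finset.sum_le_sum_of_subset_of_nonneg hI fun i _ _ => kern_nonneg hg _ _),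
        h1⟩
  rw [h]
  exact isPolyconvex_biUnion _ _ fun I _ => (isCompactConvex_cell hg u hW p I ∅).isPolyconvex

open Classical in
-- V is allowed to exceed W: it will be the open neighbourhood of a lattice cube, because hitting an
-- open set is a measurable condition on a marked point.
theorem finExcursion_inter_filter {ι : Type*} (u : ℝ) {W V : Set (E d)} (hWV : W ⊆ V)
    (p : ι → E d × 𝕄) (s : Finset ι) : finExcursion g u p s ∩ W =
      finExcursion g u p (s.filter fun i => (pointSupp g (p i) ∩ V).Nonempty) ∩ W := by
  ext y
  refine and_congr_left fun hy => ?_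
  simp only [finExcursion, Set.mem_ofPred_eq]
  rw [Finset.sum_subset (Finset.filter_subset _ s) fun i hi hi' => kern_eq_zero fun h =>
    hi' (Finset.mem_filter.mpr ⟨hi, ⟨y, h, hWV hy⟩⟩)]

open Classical in
/-- A bound for the value of a geometric functional on the part of an excursion set in a translate
of the unit cube, by the number of points whose supports hit the part. -/
theorem abs_finExcursion_inter_le {ι : Type*} (hg : IsKernelFamily g) (u : ℝ)
    {φ : Set (E d) → ℝ} (hφ : IsGeometricFunctional φ) {C : ℝ}
    (hC : ∀ (A : Set (E d)) (x : E d), IsCompactConvex A →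
      A ⊆ translate x (unitCube d) → |φ A| ≤ C)
    {W V : Set (E d)} (hW : IsCompactConvex W) {x : E d} (hWx : W ⊆ translate x (unitCube d))
    (hWV : W ⊆ V) (p : ι → E d × 𝕄) (s : Finset ι) :
    |φ (finExcursion g u p s ∩ W)| ≤
      C * 3 ^ (s.filter fun i => (pointSupp g (p i) ∩ V).Nonempty).card := by
  rw [finExcursion_inter_filter u hWV p s]
  set t := s.filter fun i => (pointSupp g (p i) ∩ V).Nonempty
  have h := hφ.eq_sum (t.powerset.sigma fun I => (t \ I).powerset)
    (fun q => (-1 : ℝ) ^ q.2.card) (fun q => cell g u W p q.1 q.2)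
    (fun q _ => (isCompactConvex_cell hg u hW p q.1 q.2).isPolyconvex)
    (finExcursion g u p t ∩ W) (isPolyconvex_finExcursion_inter hg u hW p t) fun y => by
      rw [ind_finExcursion_inter W p t y, Finset.sum_sigma]
  rw [h]
  refine (Finset.abs_sum_le_sum_abs _ _).trans ?_
  have h1 : ∀ q ∈ t.powerset.sigma fun I => (t \ I).powerset,
      |(-1 : ℝ) ^ q.2.card * φ (cell g u W p q.1 q.2)| ≤ C := by
    intro q _
    rw [abs_mul, abs_pow, abs_neg, abs_one, one_pow, one_mul]
    exact hC _ x (isCompactConvex_cell hg u hW p q.1 q.2) fun y hy => hWx hy.1.1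
  refine (Finset.sum_le_card_nsmul _ _ C h1).trans (le_of_eq ?_)
  rw [nsmul_eq_mul, mul_comm, Finset.card_sigma]
  congr 1
  -- The pairs of disjoint subsets of t number (1 + 2)^|t|: each point lies in I, in J or in
  -- neither.
  have h2 : ∑ I ∈ t.powerset, ((t \ I).powerset.card : ℕ) = 3 ^ t.card := by
    have := Finset.sum_pow_mul_eq_add_pow (1 : ℕ) 2 t
    rw [show (1 + 2 : ℕ) = 3 from rfl] at this
    rw [← this]
    refine Finset.sum_congr rfl fun I hI => ?_
    rw [Finset.card_powerset, one_pow, one_mul,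
      Finset.card_sdiff_of_subset (Finset.mem_powerset.mp hI)]
  rw [h2]
  push_cast
  rfl

/-! ### Lattice cubes -/

/-- The side length of the lattice cubes. -/
def side (d : ℕ) : ℝ := 1 / (3 * (d + 1))

theorem side_pos (d : ℕ) : 0 < side d := by
  unfold side
  positivity

/-- The neighbourhood of a lattice cube has edges of length 3 * side d. This bound makes its
diameter at most 1, so parallel bodies of radius 1 suffice later. -/
theorem three_mul_side_le (d : ℕ) : 3 * side d * d ≤ 1 := by
  unfold side
  rw [mul_one_div, div_mul_eq_mul_div, div_le_one (by positivity)]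
  nlinarith

theorem side_le_one (d : ℕ) : side d ≤ 1 := by
  unfold side
  rw [div_le_one (by positivity)]
  nlinarith [(Nat.cast_nonneg d : (0 : ℝ) ≤ d)]

/-- The half-open lattice cubes. -/
def latticeCube {d : ℕ} (z : Fin d → ℤ) : Set (E d) :=
  {y | ∀ i, (z i : ℝ) * side d ≤ y i ∧ y i < (z i + 1) * side d}

/-- The closed faces of the lattice cubes that lie on the excluded part of the boundary. -/
def cubeFace {d : ℕ} (z : Fin d → ℤ) (t : Finset (Fin d)) : Set (E d) :=
  {y | ∀ i, (if i ∈ t then (z i + 1 : ℝ) * side d else z i * side d) ≤ y i ∧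
    y i ≤ (z i + 1) * side d}

/-- Open neighbourhoods of the closed lattice cubes. -/
def nhdCube {d : ℕ} (z : Fin d → ℤ) : Set (E d) :=
  {y | ∀ i, (z i - 1 : ℝ) * side d < y i ∧ y i < (z i + 2) * side d}

theorem isOpen_nhdCube {d : ℕ} (z : Fin d → ℤ) : IsOpen (nhdCube z) := by
  have : nhdCube z = ⋂ i, {y : E d | (z i - 1 : ℝ) * side d < y i ∧ y i < (z i + 2) * side d} := by
    ext y
    simp [nhdCube]
  rw [this]
  refine isOpen_iInter_of_finite fun i => ?_
  have hc : Continuous fun y : E d => y i := by fun_prop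
  exact (isOpen_lt continuous_const hc).inter (isOpen_lt hc continuous_const)

theorem isCompactConvex_cubeFace {d : ℕ} (z : Fin d → ℤ) (t : Finset (Fin d)) (W : Set (E d))
    (hW : IsCompactConvex W) : IsCompactConvex (W ∩ cubeFace z t) := by
  have h : cubeFace z t = ⋂ i, {y : E d |
      (if i ∈ t then (z i + 1 : ℝ) * side d else z i * side d) ≤ y i ∧
      y i ≤ (z i + 1) * side d} := by
    ext y
    simp [cubeFace]
  have hlin : ∀ i, IsLinearMap ℝ fun y : E d => y i := fun i =>
    ⟨fun _ _ => rfl, fun _ _ => rfl⟩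
  have hc : ∀ i, Continuous fun y : E d => y i := fun i => by fun_prop
  refine ⟨hW.1.inter_right ?_, hW.2.inter ?_⟩
  · rw [h]
    exact isClosed_iInter fun i => (isClosed_le continuous_const (hc i)).inter
      (isClosed_le (hc i) continuous_const)
  · rw [h]
    exact convex_iInter fun i => (convex_halfSpace_ge (hlin i) _).inter
      (convex_halfSpace_le (hlin i) _)

theorem cubeFace_subset_nhdCube {d : ℕ} (z : Fin d → ℤ) (t : Finset (Fin d)) :
    cubeFace z t ⊆ nhdCube z := by
  intro y hy i
  have h := hy i
  have hs := side_pos d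
  have h1 : (z i : ℝ) * side d ≤ y i := by
    split_ifs at h <;> nlinarith [h.1]
  constructor <;> nlinarith [h.2]

theorem latticeCube_subset_nhdCube {d : ℕ} (z : Fin d → ℤ) : latticeCube z ⊆ nhdCube z := by
  intro y hy i
  have h := hy i
  have hs := side_pos d
  constructor <;> nlinarith [h.1, h.2]

theorem cubeFace_subset_translate {d : ℕ} (z : Fin d → ℤ) (t : Finset (Fin d)) :
    cubeFace z t ⊆ translate (WithLp.toLp 2 fun i => (z i : ℝ) * side d) (unitCube d) := by
  intro y hy
  rw [mem_translate]
  intro i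
  have h := hy i
  have hs := side_pos d
  have h1 : (z i : ℝ) * side d ≤ y i := by
    split_ifs at h <;> nlinarith [h.1]
  have := side_le_one d
  simp only [PiLp.sub_apply, Set.mem_Icc]
  constructor <;> nlinarith [h.2]

theorem dist_le_one_of_mem_nhdCube {d : ℕ} {z : Fin d → ℤ} {x y : E d} (hx : x ∈ nhdCube z)
    (hy : y ∈ nhdCube z) : dist x y ≤ 1 := by
  have hs := side_pos d
  rw [EuclideanSpace.dist_eq, Real.sqrt_le_one]
  have h1 : ∀ i, dist (x i) (y i) ^ 2 ≤ (3 * side d) ^ 2 := fun i => by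
    refine pow_le_pow_left₀ dist_nonneg ?_ 2
    rw [Real.dist_eq, abs_le]
    have h1 := hx i
    have h2 := hy i
    constructor <;> nlinarith [h1.1, h1.2, h2.1, h2.2]
  refine (Finset.sum_le_card_nsmul _ _ _ fun i _ => h1 i).trans ?_
  rw [Finset.card_univ, Fintype.card_fin, nsmul_eq_mul]
  have h3 := three_mul_side_le d
  rcases Nat.eq_zero_or_pos d with h0 | h0
  · simp [h0]
  · have : (1 : ℝ) ≤ d := by exact_mod_cast h0
    have h4 : 3 * side d ≤ 1 := by nlinarith
    nlinarith

/-- The index of the half-open lattice cube that contains a given point. -/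
def cubeIndex {d : ℕ} (y : E d) : Fin d → ℤ := fun i => ⌊y i / side d⌋

theorem mem_latticeCube_iff {d : ℕ} {z : Fin d → ℤ} {y : E d} :
    y ∈ latticeCube z ↔ cubeIndex y = z := by
  have hs := side_pos d
  rw [funext_iff]
  refine forall_congr' fun i => ?_
  rw [cubeIndex, Int.floor_eq_iff, le_div_iff₀ hs, div_lt_iff₀ hs]

theorem disjoint_latticeCube {d : ℕ} :
    Pairwise fun z z' : Fin d → ℤ => Disjoint (latticeCube z) (latticeCube z') := by
  intro z z' h
  rw [Set.disjoint_left]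
  intro y hy hy'
  rw [mem_latticeCube_iff] at hy hy'
  exact h (hy.symm.trans hy')

/-- In each coordinate the half-open interval is the closed interval minus its right endpoint, and
the product over the coordinates is expanded. Half-open cubes partition the space, while φ needs the
compact faces. -/
theorem ind_latticeCube {d : ℕ} (z : Fin d → ℤ) (y : E d) :
    ind (latticeCube z) y = ∑ t : Finset (Fin d), (-1 : ℝ) ^ t.card * ind (cubeFace z t) y := by
  classical
  have hs := side_pos d
  let a : Fin d → ℝ := fun i => if y i = (z i + 1) * side d then 1 else 0
  let b : Fin d → ℝ := fun i =>
    if (z i : ℝ) * side d ≤ y i ∧ y i ≤ (z i + 1) * side d then 1 else 0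
  have h1 : ind (latticeCube z) y = ∏ i, (-a i + b i) := by
    have : ∀ i, -a i + b i =
        if (z i : ℝ) * side d ≤ y i ∧ y i < (z i + 1) * side d then 1 else 0 := by
      intro i
      simp only [a, b]
      have h2 : (z i : ℝ) * side d ≤ (z i + 1) * side d := by nlinarith
      rcases lt_trichotomy (y i) ((z i + 1) * side d) with h | h | h
      · simp [h, h.ne, h.le]
      · rw [h]
        simp [h2]
      · simp [h.not_gt, h.not_ge, h.ne']
    rw [Finset.prod_congr rfl fun i _ => this i, Finset.prod_boole]
    simp only [ind, latticeCube, Set.mem_ofPred_eq, Finset.mem_univ, true_imp_iff]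
    congr
  rw [h1, Finset.prod_add, Finset.powerset_univ]
  refine Finset.sum_congr rfl fun t _ => ?_
  rw [Finset.prod_neg, mul_assoc]
  congr 1
  simp only [a, b]
  rw [Finset.prod_boole, Finset.prod_boole, ite_zero_mul_ite_zero]
  unfold ind
  simp only [mul_one]
  refine if_congr ?_ rfl rfl
  constructor
  · rintro ⟨h1, h2⟩ i
    by_cases hi : i ∈ t
    · rw [if_pos hi, h1 i hi]
      exact ⟨le_rfl, le_rfl⟩
    · rw [if_neg hi]
      exact h2 i (by simp [hi])
  · intro h
    refine ⟨fun i hi => ?_, fun i hi => ?_⟩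
    · have := h i
      rw [if_pos hi] at this
      exact le_antisymm this.2 this.1
    · have := h i
      rwa [if_neg (by simpa using hi)] at this

theorem finite_setOf_inter_nhdCube {d : ℕ} {A : Set (E d)} (hA : Bornology.IsBounded A) :
    {z : Fin d → ℤ | (A ∩ nhdCube z).Nonempty}.Finite := by
  obtain ⟨R, hR⟩ := hA.subset_closedBall 0
  have hs := side_pos d
  refine (Set.Finite.pi' fun _ : Fin d =>
    Set.finite_Icc (-(⌈R / side d⌉ + 2)) (⌈R / side d⌉ + 1)).subset ?_
  rintro z ⟨y, hy, hyz⟩ i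
  have h1 : ‖y‖ ≤ R := by simpa using hR hy
  have h2 : |y i| ≤ R := (PiLp.norm_apply_le y i).trans h1
  have h3 := abs_le.mp h2
  have h4 := hyz i
  have h5 : R ≤ ⌈R / side d⌉ * side d := (div_le_iff₀ hs).mp (Int.le_ceil _)
  constructor
  · have : (-(⌈R / side d⌉ + 2) : ℝ) < z i := by
      by_contra hcon
      push Not at hcon
      nlinarith [h4.2, h3.1]
    exact_mod_cast this.le
  · have : (z i : ℝ) < (⌈R / side d⌉ + 1 : ℝ) := by
      by_contra hcon
      push Not at hcon
      nlinarith [h4.1, h3.2]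
    exact_mod_cast this.le

open Classical in
/-- A bound for the value of a geometric functional on the part of an excursion set in a compact
convex set. -/
theorem abs_finExcursion_inter_le_sum {ι : Type*} (hg : IsKernelFamily g) (u : ℝ)
    {φ : Set (E d) → ℝ} (hφ : IsGeometricFunctional φ) {C : ℝ}
    (hC : ∀ (A : Set (E d)) (x : E d), IsCompactConvex A →
      A ⊆ translate x (unitCube d) → |φ A| ≤ C)
    {W : Set (E d)} (hW : IsCompactConvex W) (T : Finset (Fin d → ℤ))
    (hT : ∀ z, (W ∩ nhdCube z).Nonempty → z ∈ T) (p : ι → E d × 𝕄) (s : Finset ι) :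
    |φ (finExcursion g u p s ∩ W)| ≤ ∑ z ∈ T, 2 ^ d *
      (C * 3 ^ (s.filter fun i => (pointSupp g (p i) ∩ nhdCube z).Nonempty).card) := by
  -- The window is partitioned by half-open cubes, and each of them is a signed sum of its 2^d
  -- closed faces; this is the source of the factor 2^d.
  have h := hφ.eq_sum (T ×ˢ (Finset.univ : Finset (Finset (Fin d))))
    (fun q => (-1 : ℝ) ^ q.2.card) (fun q => finExcursion g u p s ∩ (W ∩ cubeFace q.1 q.2))
    (fun q _ => isPolyconvex_finExcursion_inter hg u (isCompactConvex_cubeFace _ _ W hW) p s)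
    (finExcursion g u p s ∩ W) (isPolyconvex_finExcursion_inter hg u hW p s) fun y => by
      rw [Finset.sum_product]
      by_cases hy : y ∈ finExcursion g u p s ∩ W
      swap
      · rw [ind_of_notMem hy]
        refine (Finset.sum_eq_zero fun z _ => Finset.sum_eq_zero fun t _ => ?_).symm
        rw [ind_of_notMem fun h => hy ⟨h.1, h.2.1⟩, mul_zero]
      have h1 : ∀ z ∈ T, ∑ t : Finset (Fin d), (-1 : ℝ) ^ t.card *
          ind (finExcursion g u p s ∩ (W ∩ cubeFace z t)) y = ind (latticeCube z) y := by
        intro z _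
        rw [ind_latticeCube]
        refine Finset.sum_congr rfl fun t _ => ?_
        congr 1
        exact ind_congr ⟨fun h => h.2.2, fun h => ⟨hy.1, hy.2, h⟩⟩
      rw [Finset.sum_congr rfl h1, ind_of_mem hy, Finset.sum_eq_single (cubeIndex y)]
      · rw [ind_of_mem (mem_latticeCube_iff.mpr rfl)]
      · intro z _ hz
        rw [ind_of_notMem fun h => hz (mem_latticeCube_iff.mp h).symm]
      · intro hz
        exact absurd (hT _ ⟨y, hy.2, latticeCube_subset_nhdCube _ (mem_latticeCube_iff.mpr rfl)⟩) hz
  rw [h]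
  refine (Finset.abs_sum_le_sum_abs _ _).trans ?_
  rw [Finset.sum_product]
  refine Finset.sum_le_sum fun z _ => ?_
  refine (Finset.sum_le_card_nsmul _ _
    (C * 3 ^ (s.filter fun i => (pointSupp g (p i) ∩ nhdCube z).Nonempty).card) ?_).trans ?_
  · intro t _
    rw [abs_mul, abs_pow, abs_neg, abs_one, one_pow, one_mul]
    exact abs_finExcursion_inter_le hg u hφ hC (isCompactConvex_cubeFace _ _ W hW)
      (Set.inter_subset_right.trans (cubeFace_subset_translate z t))
      (Set.inter_subset_right.trans (cubeFace_subset_nhdCube z t)) p s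
  · rw [Finset.card_univ, Fintype.card_finset, Fintype.card_fin, nsmul_eq_mul]
    push_cast
    rfl

end FiniteConfiguration

/-! ### Bounded measurable functions and averaged shift operators -/

section ShiftOperators

set_option linter.unusedSectionVars false

/-- The subspace of the measurable functions among the bounded functions. -/
def bddMeasSubmodule (M : Type*) [MeasurableSpace M] :
    Submodule ℝ (lp (fun _ : M => ℝ) ⊤) where
  carrier := {f | Measurable (f : M → ℝ)}
  add_mem' hf hg := Measurable.add hf hg
  zero_mem' := measurable_const
  smul_mem' c _ hf := Measurable.const_smul hf c

/-- The Banach space of bounded measurable functions. -/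
def BddMeas (M : Type*) [MeasurableSpace M] : Type _ := bddMeasSubmodule M

namespace BddMeas

variable {M : Type*} [MeasurableSpace M]

instance : NormedAddCommGroup (BddMeas M) :=
  inferInstanceAs (NormedAddCommGroup (bddMeasSubmodule M))

instance : NormedSpace ℝ (BddMeas M) :=
  inferInstanceAs (NormedSpace ℝ (bddMeasSubmodule M))

/-- The function of an element. -/
def fn (Φ : BddMeas M) : M → ℝ := (Φ.1 : M → ℝ)

theorem measurable_fn (Φ : BddMeas M) : Measurable Φ.fn := Φ.2

theorem abs_fn_le (Φ : BddMeas M) (μ : M) : |Φ.fn μ| ≤ ‖Φ‖ :=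
  lp.norm_apply_le_norm (by simp) Φ.1 μ

theorem ext_fn {Φ Ψ : BddMeas M} (h : ∀ μ, Φ.fn μ = Ψ.fn μ) : Φ = Ψ :=
  Subtype.ext (lp.ext (funext h))

/-- The element given by a bounded measurable function. -/
def mk (f : M → ℝ) (hf : Measurable f) (h : ∃ C, ∀ μ, |f μ| ≤ C) : BddMeas M :=
  ⟨⟨f, memℓp_infty (by
    obtain ⟨C, hC⟩ := h
    exact ⟨C, by rintro _ ⟨μ, rfl⟩; exact hC μ⟩)⟩, hf⟩

theorem norm_le {Φ : BddMeas M} {C : ℝ} (hC : 0 ≤ C) (h : ∀ μ, |Φ.fn μ| ≤ C) : ‖Φ‖ ≤ C :=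
  lp.norm_le_of_forall_le hC h

/-- Evaluation at a point. -/
def eval (μ : M) : BddMeas M →L[ℝ] ℝ :=
  LinearMap.mkContinuous
    { toFun := fun Φ => Φ.fn μ, map_add' := fun _ _ => rfl, map_smul' := fun _ _ => rfl } 1
    fun Φ => by rw [one_mul]; exact Φ.abs_fn_le μ

/-- Uniform limits are pointwise limits, so they stay measurable. The resulting completeness makes
the exponential series of bounded operators converge. -/
theorem isClosed : IsClosed (bddMeasSubmodule M : Set (lp (fun _ : M => ℝ) ⊤)) := by
  refine IsSeqClosed.isClosed fun f f₀ hf hlim => ?_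
  refine measurable_of_tendsto_metrizable (f := fun n => (f n : M → ℝ)) hf ?_
  rw [tendsto_pi_nhds]
  intro μ
  rw [tendsto_iff_norm_sub_tendsto_zero] at hlim ⊢
  refine squeeze_zero (fun _ => norm_nonneg _) (fun n => ?_) hlim
  exact lp.norm_apply_le_norm (by simp) (f n - f₀) μ

instance : CompleteSpace (BddMeas M) :=
  (isClosed (M := M)).completeSpace_coe

theorem integrable_comp (Φ : BddMeas M) {Y : Type*} [MeasurableSpace Y] (ρ : Measure Y)
    [IsFiniteMeasure ρ] {j : Y → M} (hj : Measurable j) : Integrable (fun y => Φ.fn (j y)) ρ :=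
  Integrable.of_bound (Φ.measurable_fn.comp hj).aestronglyMeasurable ‖Φ‖
    (ae_of_all _ fun _ => Φ.abs_fn_le _)

variable [AddCommMonoid M] [MeasurableAdd₂ M]
variable {X : Type*} [MeasurableSpace X] {κ : Type*} [Fintype κ]

/-- A linear combination of shifts. -/
def shift (c : κ → ℝ) (j : κ → X → M) (f : M → ℝ) (x : X) (μ : M) : ℝ :=
  ∑ k, c k * f (μ + j k x)

/-- Iterated linear combinations of shifts. -/
def iterShift (c : κ → ℝ) (j : κ → X → M) (f : M → ℝ) : (n : ℕ) → (Fin n → X) → M → ℝ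
  | 0, _, μ => f μ
  | n + 1, x, μ => shift c j (iterShift c j f n (Fin.tail x)) (x 0) μ

theorem measurable_iterShift (c : κ → ℝ) {j : κ → X → M} (hj : ∀ k, Measurable (j k))
    {f : M → ℝ} (hf : Measurable f) (n : ℕ) :
    Measurable fun p : (Fin n → X) × M => iterShift c j f n p.1 p.2 := by
  induction n with
  | zero => exact hf.comp measurable_snd
  | succ n ih =>
    refine Finset.measurable_sum _ fun k _ => Measurable.const_mul ?_ _
    have h1 : Measurable fun p : (Fin (n + 1) → X) × M => (Fin.tail p.1, p.2 + j k (p.1 0)) := by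
      refine Measurable.prodMk ?_ ?_
      · exact measurable_pi_lambda _ fun i => (measurable_pi_apply _).comp measurable_fst
      · exact measurable_snd.add ((hj k).comp ((measurable_pi_apply 0).comp measurable_fst))
    exact ih.comp h1

theorem abs_iterShift_le (c : κ → ℝ) (j : κ → X → M) {f : M → ℝ} {C : ℝ} (hf : ∀ μ, |f μ| ≤ C)
    (n : ℕ) (x : Fin n → X) (μ : M) : |iterShift c j f n x μ| ≤ (∑ k, |c k|) ^ n * C := by
  induction n generalizing μ with
  | zero => simpa [iterShift] using hf μ
  | succ n ih =>
    refine (Finset.abs_sum_le_sum_abs _ _).trans ?_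
    rw [pow_succ', mul_assoc, Finset.sum_mul]
    refine Finset.sum_le_sum fun k _ => ?_
    rw [abs_mul]
    exact mul_le_mul_of_nonneg_left (ih _ _) (abs_nonneg _)

variable (ρ : Measure X) [IsFiniteMeasure ρ]

theorem measurable_integral_shift (c : κ → ℝ) {j : κ → X → M} (hj : ∀ k, Measurable (j k))
    {f : M → ℝ} (hf : Measurable f) : Measurable fun μ => ∫ x, shift c j f x μ ∂ρ := by
  have h : Measurable fun p : M × X => shift c j f p.2 p.1 :=
    Finset.measurable_sum _ fun k _ => Measurable.const_mul
      (hf.comp (measurable_fst.add ((hj k).comp measurable_snd))) _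
  exact h.stronglyMeasurable.integral_prod_right.measurable

theorem integrable_shift (c : κ → ℝ) {j : κ → X → M} (hj : ∀ k, Measurable (j k))
    (Φ : BddMeas M) (μ : M) : Integrable (fun x => shift c j Φ.fn x μ) ρ :=
  integrable_finsetSum _ fun k _ => (Φ.integrable_comp ρ ((hj k).const_add μ)).const_mul _

theorem abs_integral_shift_le (c : κ → ℝ) (j : κ → X → M) (Φ : BddMeas M) (μ : M) :
    |∫ x, shift c j Φ.fn x μ ∂ρ| ≤ (∑ k, |c k|) * ρ.real Set.univ * ‖Φ‖ := by
  have h : ∀ x, ‖shift c j Φ.fn x μ‖ ≤ (∑ k, |c k|) * ‖Φ‖ := by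
    intro x
    refine (Finset.abs_sum_le_sum_abs _ _).trans ?_
    rw [Finset.sum_mul]
    refine Finset.sum_le_sum fun k _ => ?_
    rw [abs_mul]
    exact mul_le_mul_of_nonneg_left (Φ.abs_fn_le _) (abs_nonneg _)
  have := norm_integral_le_of_norm_le_const (μ := ρ) (ae_of_all _ h)
  rw [Real.norm_eq_abs] at this
  linarith

/-- The average of a linear combination of shifts. -/
def op (c : κ → ℝ) (j : κ → X → M) (hj : ∀ k, Measurable (j k)) : BddMeas M →L[ℝ] BddMeas M :=
  LinearMap.mkContinuous
    { toFun := fun Φ => mk (fun μ => ∫ x, shift c j Φ.fn x μ ∂ρ)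
        (measurable_integral_shift ρ c hj Φ.measurable_fn) ⟨_, abs_integral_shift_le ρ c j Φ⟩
      map_add' := fun Φ Ψ => ext_fn fun μ => by
        change ∫ x, shift c j (Φ + Ψ).fn x μ ∂ρ =
          ∫ x, shift c j Φ.fn x μ ∂ρ + ∫ x, shift c j Ψ.fn x μ ∂ρ
        rw [← integral_add (integrable_shift ρ c hj Φ μ) (integrable_shift ρ c hj Ψ μ)]
        congr 1
        ext x
        simp only [shift, ← Finset.sum_add_distrib, ← mul_add]
        rfl
      map_smul' := fun a Φ => ext_fn fun μ => by
        change ∫ x, shift c j (a • Φ).fn x μ ∂ρ = a * ∫ x, shift c j Φ.fn x μ ∂ρ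
        rw [← integral_const_mul]
        congr 1
        ext x
        simp only [shift, Finset.mul_sum]
        refine Finset.sum_congr rfl fun k _ => ?_
        change c k * (a * Φ.fn _) = a * (c k * Φ.fn _)
        ring } ((∑ k, |c k|) * ρ.real Set.univ)
    fun Φ => norm_le (by positivity) (abs_integral_shift_le ρ c j Φ)

theorem op_fn (c : κ → ℝ) {j : κ → X → M} (hj : ∀ k, Measurable (j k)) (Φ : BddMeas M) (μ : M) :
    (op ρ c j hj Φ).fn μ = ∫ x, shift c j Φ.fn x μ ∂ρ := rfl

theorem op_op_fn {κ' : Type*} [Fintype κ'] (c : κ → ℝ) {j : κ → X → M}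
    (hj : ∀ k, Measurable (j k)) (c' : κ' → ℝ) {j' : κ' → X → M} (hj' : ∀ k, Measurable (j' k))
    (Φ : BddMeas M) (μ : M) : (op ρ c j hj (op ρ c' j' hj' Φ)).fn μ =
      ∑ k, ∑ k', c k * c' k' * ∫ p : X × X, Φ.fn (μ + j k p.1 + j' k' p.2) ∂(ρ.prod ρ) := by
  have h2 : ∀ k k', Integrable (fun p : X × X => Φ.fn (μ + j k p.1 + j' k' p.2)) (ρ.prod ρ) :=
    fun k k' => Φ.integrable_comp _
      ((((hj k).comp measurable_fst).const_add μ).add ((hj' k').comp measurable_snd))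
  rw [op_fn]
  simp only [shift]
  rw [integral_finsetSum _ fun k _ =>
    ((op ρ c' j' hj' Φ).integrable_comp ρ ((hj k).const_add μ)).const_mul _]
  refine Finset.sum_congr rfl fun k _ => ?_
  rw [integral_const_mul]
  have h3 : ∀ x, (op ρ c' j' hj' Φ).fn (μ + j k x) =
      ∑ k', c' k' * ∫ y, Φ.fn (μ + j k x + j' k' y) ∂ρ := by
    intro x
    rw [op_fn]
    simp only [shift]
    rw [integral_finsetSum _ fun k' _ =>
      (Φ.integrable_comp ρ ((hj' k').const_add _)).const_mul _]
    simp_rw [integral_const_mul]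
  simp_rw [h3]
  rw [integral_finsetSum _ fun k' _ => ((h2 k k').integral_prod_left).const_mul _, Finset.mul_sum]
  refine Finset.sum_congr rfl fun k' _ => ?_
  rw [integral_const_mul, integral_prod _ (h2 k k'), mul_assoc]

/-- Both compositions are double integrals over shifts by sums, so Fubini and commutativity of
addition suffice. -/
theorem op_commute {κ' : Type*} [Fintype κ'] (c : κ → ℝ) {j : κ → X → M}
    (hj : ∀ k, Measurable (j k)) (c' : κ' → ℝ) {j' : κ' → X → M}
    (hj' : ∀ k, Measurable (j' k)) : Commute (op ρ c j hj) (op ρ c' j' hj') := by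
  ext1 Φ
  refine ext_fn fun μ => ?_
  change (op ρ c j hj (op ρ c' j' hj' Φ)).fn μ = (op ρ c' j' hj' (op ρ c j hj Φ)).fn μ
  rw [op_op_fn, op_op_fn, Finset.sum_comm]
  refine Finset.sum_congr rfl fun k' _ => Finset.sum_congr rfl fun k _ => ?_
  rw [mul_comm (c k), ← integral_prod_swap]
  congr 1
  refine integral_congr_ae (ae_of_all _ fun p => ?_)
  simp only [Prod.fst_swap, Prod.snd_swap]
  rw [add_right_comm]

theorem integral_pi_succ {n : ℕ} {f : (Fin (n + 1) → X) → ℝ}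
    (hf : Integrable f (Measure.pi fun _ => ρ)) :
    ∫ x, f x ∂(Measure.pi fun _ => ρ) =
      ∫ x₀, ∫ x, f (Fin.cons x₀ x) ∂(Measure.pi fun _ => ρ) ∂ρ := by
  have h := (measurePreserving_piFinSuccAbove (fun _ : Fin (n + 1) => ρ) 0).symm
  rw [← h.integral_comp' (g := f), integral_prod]
  · simp [MeasurableEquiv.piFinSuccAbove, Fin.insertNthEquiv]
  · exact (h.integrable_comp_emb (MeasurableEquiv.measurableEmbedding _)).mpr hf

/-- Powers become n-fold integrals over the product measure. This makes the exponential series of an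
averaged shift comparable with the series that defines the Poisson law. -/
theorem op_pow_fn (c : κ → ℝ) {j : κ → X → M} (hj : ∀ k, Measurable (j k)) (Φ : BddMeas M)
    (n : ℕ) (μ : M) : ((op ρ c j hj ^ n) Φ).fn μ =
      ∫ x, iterShift c j Φ.fn n x μ ∂(Measure.pi fun _ : Fin n => ρ) := by
  have hint : ∀ n μ, Integrable (fun x => iterShift c j Φ.fn n x μ)
      (Measure.pi fun _ : Fin n => ρ) := fun n μ =>
    Integrable.of_bound ((measurable_iterShift c hj Φ.measurable_fn n).comp
      (measurable_id.prodMk measurable_const)).aestronglyMeasurable _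
      (ae_of_all _ fun x => abs_iterShift_le c j Φ.abs_fn_le n x μ)
  induction n generalizing μ with
  | zero => simp [iterShift, measureReal_def]
  | succ n ih =>
    rw [pow_succ', mul_apply_eq_comp, op_fn, integral_pi_succ ρ (hint _ _)]
    refine integral_congr_ae (ae_of_all _ fun x₀ => ?_)
    simp only [iterShift, shift, Fin.tail_cons, Fin.cons_zero, ih]
    rw [integral_finsetSum _ fun k _ => (hint n _).const_mul _]
    simp_rw [integral_const_mul]

theorem hasSum_exp_fn (T : BddMeas M →L[ℝ] BddMeas M) (Φ : BddMeas M) (μ : M) :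
    HasSum (fun n : ℕ => (n.factorial : ℝ)⁻¹ * ((T ^ n) Φ).fn μ)
      ((NormedSpace.exp T Φ).fn μ) := by
  have h := NormedSpace.exp_series_hasSum_exp' (𝕂 := ℝ) T
  have h1 := h.mapL ((eval μ).comp (ContinuousLinearMap.apply ℝ (BddMeas M) Φ))
  exact h1

end BddMeas

end ShiftOperators

theorem hasSum_congr {V : Type*} [AddCommMonoid V] [TopologicalSpace V] {f h : ℕ → V} {s : V} (H : ∀ n, f n = h n) : HasSum f s ↔ HasSum h s := by
  rw [funext H]

/-! ### Finite configurations and their Poisson law -/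

section Configurations

set_option linter.unusedSectionVars false

variable {X : Type*} [MeasurableSpace X]

/-- The finite sums of Dirac measures. -/
def finConf (X : Type*) [MeasurableSpace X] : AddSubmonoid (Measure X) :=
  AddSubmonoid.closure (Set.range Measure.dirac)

/-- Finite configurations. -/
abbrev Conf (X : Type*) [MeasurableSpace X] := {μ : Measure X // μ ∈ finConf X}

instance {M N : Type*} [MeasurableSpace M] [MeasurableSpace N] [Add M] [Add N]
    [MeasurableAdd₂ M] [MeasurableAdd₂ N] : MeasurableAdd₂ (M × N) :=
  ⟨((measurable_fst.comp measurable_fst).add (measurable_fst.comp measurable_snd)).prodMk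
    ((measurable_snd.comp measurable_fst).add (measurable_snd.comp measurable_snd))⟩

/-- The configuration with a single point. -/
def pt (x : X) : Conf X := ⟨Measure.dirac x, AddSubmonoid.subset_closure ⟨x, rfl⟩⟩

theorem measurable_pt : Measurable (pt : X → Conf X) :=
  Measure.measurable_dirac.subtype_mk

instance : AddCommMonoid (Conf X) := inferInstanceAs (AddCommMonoid (finConf X))

theorem Conf.coe_add (μ ν : Conf X) : ((μ + ν : Conf X) : Measure X) = μ.1 + ν.1 := rfl

instance : MeasurableAdd₂ (Conf X) :=
  ⟨((measurable_subtype_coe.comp measurable_fst).add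
    (measurable_subtype_coe.comp measurable_snd)).subtype_mk⟩

theorem finConf_exists {μ : Measure X} (h : μ ∈ finConf X) :
    ∃ (n : ℕ) (x : Fin n → X), μ = ∑ i, Measure.dirac (x i) := by
  induction h using AddSubmonoid.closure_induction with
  | mem y hy =>
    obtain ⟨x, rfl⟩ := hy
    exact ⟨1, fun _ => x, by simp⟩
  | zero => exact ⟨0, Fin.elim0, by simp⟩
  | add y z _ _ hy hz =>
    obtain ⟨n, x, rfl⟩ := hy
    obtain ⟨m, x', rfl⟩ := hz
    exact ⟨n + m, Fin.append x x', by simp [Fin.sum_univ_add]⟩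

instance (μ : Conf X) : IsFiniteMeasure μ.1 := by
  obtain ⟨n, x, h⟩ := finConf_exists μ.2
  rw [h]
  infer_instance

/-- The number of points. -/
def mass (μ : Conf X) : ℝ := μ.1.real Set.univ

theorem mass_add (μ ν : Conf X) : mass (μ + ν) = mass μ + mass ν := by
  unfold mass
  rw [Conf.coe_add, measureReal_add_apply]

theorem mass_zero : mass (0 : Conf X) = 0 := by simp [mass]

theorem mass_pt (x : X) : mass (pt x) = 1 := by simp [mass, pt]

theorem measurable_mass : Measurable (mass : Conf X → ℝ) :=
  ((Measure.measurable_coe MeasurableSet.univ).comp measurable_subtype_coe).ennreal_toReal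

/-- The configuration of the entries of a tuple. -/
def ofTuple {n : ℕ} (x : Fin n → X) : Conf X := ∑ i, pt (x i)

theorem coe_ofTuple {n : ℕ} (x : Fin n → X) :
    (ofTuple x : Conf X).1 = ∑ i, Measure.dirac (x i) := by
  have : ∀ s : Finset (Fin n), (∑ i ∈ s, pt (x i) : Conf X).1 = ∑ i ∈ s, Measure.dirac (x i) := by
    intro s
    induction s using Finset.cons_induction with
    | empty => rfl
    | cons a s ha ih => rw [Finset.sum_cons, Finset.sum_cons, Conf.coe_add, ih]; rfl
  exact this _

theorem Conf.exists_eq_ofTuple (μ : Conf X) : ∃ (n : ℕ) (x : Fin n → X), μ = ofTuple x := by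
  obtain ⟨n, x, h⟩ := finConf_exists μ.2
  exact ⟨n, x, Subtype.ext (h.trans (coe_ofTuple x).symm)⟩

theorem measurable_ofTuple (n : ℕ) : Measurable (ofTuple : (Fin n → X) → Conf X) :=
  Finset.measurable_sum _ fun i _ => measurable_pt.comp (measurable_pi_apply i)

theorem ofTuple_succ {n : ℕ} (x : Fin (n + 1) → X) :
    ofTuple x = pt (x 0) + ofTuple (Fin.tail x) := Fin.sum_univ_succ _

theorem ofTuple_zero (x : Fin 0 → X) : ofTuple x = 0 := Fin.sum_univ_zero _

theorem mass_ofTuple {n : ℕ} (x : Fin n → X) : mass (ofTuple x) = n := by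
  simp [mass, coe_ofTuple, measureReal_def]

/-- The law of a Poisson process with finite intensity measure. -/
def poissonConf (ρ : Measure X) : Measure (Conf X) :=
  ENNReal.ofReal (Real.exp (-ρ.real Set.univ)) • Measure.sum fun n : ℕ =>
    ENNReal.ofReal ((n.factorial : ℝ)⁻¹) • (Measure.pi fun _ : Fin n => ρ).map ofTuple

variable (ρ : Measure X) [IsFiniteMeasure ρ]

theorem lintegral_poissonConf {f : Conf X → ℝ≥0∞} (hf : Measurable f) :
    ∫⁻ μ, f μ ∂poissonConf ρ = ENNReal.ofReal (Real.exp (-ρ.real Set.univ)) *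
      ∑' n : ℕ, ENNReal.ofReal ((n.factorial : ℝ)⁻¹) *
        ∫⁻ x, f (ofTuple x) ∂(Measure.pi fun _ : Fin n => ρ) := by
  rw [poissonConf, lintegral_smul_measure, lintegral_sum_measure]
  simp_rw [lintegral_smul_measure, lintegral_map hf (measurable_ofTuple _), smul_eq_mul]

/-- The generating function of the Poisson total mass. The case a = 1 shows that the law is a
probability measure, and general a gives integrability of functionals that grow exponentially in the
number of points. -/
theorem lintegral_poissonConf_rpow_mass {a : ℝ} (ha : 0 < a) :
    ∫⁻ μ, ENNReal.ofReal (a ^ mass μ) ∂poissonConf ρ =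
      ENNReal.ofReal (Real.exp ((a - 1) * ρ.real Set.univ)) := by
  rw [lintegral_poissonConf ρ (measurable_mass.const_pow a).ennreal_ofReal]
  have h : ∀ n : ℕ, ENNReal.ofReal ((n.factorial : ℝ)⁻¹) *
      ∫⁻ x : Fin n → X, ENNReal.ofReal (a ^ mass (ofTuple x)) ∂(Measure.pi fun _ => ρ) =
      ENNReal.ofReal ((n.factorial : ℝ)⁻¹ * (a * ρ.real Set.univ) ^ n) := by
    intro n
    simp_rw [mass_ofTuple, Real.rpow_natCast]
    rw [lintegral_const, Measure.pi_univ, Finset.prod_const, Finset.card_univ, Fintype.card_fin,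
      ← ofReal_measureReal (μ := ρ), ← ENNReal.ofReal_pow (by positivity),
      ← ENNReal.ofReal_mul (by positivity), ← ENNReal.ofReal_mul (by positivity), mul_pow]
  simp_rw [h]
  have hs := NormedSpace.expSeries_div_hasSum_exp (𝔸 := ℝ) (a * ρ.real Set.univ)
  rw [← ENNReal.ofReal_tsum_of_nonneg (fun n => by positivity)]
  · rw [← ENNReal.ofReal_mul (by positivity)]
    have h2 : ∑' n : ℕ, (n.factorial : ℝ)⁻¹ * (a * ρ.real Set.univ) ^ n =
        Real.exp (a * ρ.real Set.univ) := by
      rw [Real.exp_eq_exp_ℝ, ← hs.tsum_eq]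
      exact tsum_congr fun n => by rw [div_eq_inv_mul]
    rw [h2, ← Real.exp_add]
    congr 2
    ring
  · refine hs.summable.congr fun n => ?_
    rw [div_eq_inv_mul]

instance : IsProbabilityMeasure (poissonConf ρ) := by
  have h := lintegral_poissonConf_rpow_mass ρ one_pos
  simp only [Real.one_rpow, sub_self, zero_mul, Real.exp_zero, ENNReal.ofReal_one,
    lintegral_const, one_mul] at h
  exact ⟨h⟩

theorem integrable_poissonConf {F : Conf X → ℝ} (hF : Measurable F) {C a : ℝ} (ha : 0 < a)
    (hb : ∀ μ, |F μ| ≤ C * a ^ mass μ) : Integrable F (poissonConf ρ) := by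
  have h : Integrable (fun μ : Conf X => a ^ mass μ) (poissonConf ρ) := by
    refine ⟨(measurable_mass.const_pow a).aestronglyMeasurable, ?_⟩
    rw [hasFiniteIntegral_iff_ofReal (ae_of_all _ fun μ => by positivity),
      lintegral_poissonConf_rpow_mass ρ ha]
    exact ENNReal.ofReal_lt_top
  exact (h.const_mul C).mono' hF.aestronglyMeasurable (ae_of_all _ hb)

/-- Vector values are allowed because the characteristic functional is complex while the Fock
representation is real. The normalising factor stands on the right, so that the series can be
matched with operator exponentials. -/
theorem hasSum_integral_poissonConf' {V : Type*} [NormedAddCommGroup V] [NormedSpace ℝ V]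
    {F : Conf X → V} (hF : StronglyMeasurable F) (hint : Integrable F (poissonConf ρ)) :
    HasSum (fun n : ℕ => (n.factorial : ℝ)⁻¹ •
      ∫ x, F (ofTuple x) ∂(Measure.pi fun _ : Fin n => ρ))
      (Real.exp (ρ.real Set.univ) • ∫ μ, F μ ∂poissonConf ρ) := by
  have hne : ENNReal.ofReal (Real.exp (-ρ.real Set.univ)) ≠ 0 := by
    rw [Ne, ENNReal.ofReal_eq_zero, not_le]
    exact Real.exp_pos _
  have hint' : Integrable F (Measure.sum fun n : ℕ =>
      ENNReal.ofReal ((n.factorial : ℝ)⁻¹) • (Measure.pi fun _ : Fin n => ρ).map ofTuple) :=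
    (integrable_smul_measure hne ENNReal.ofReal_ne_top).mp hint
  have h := hasSum_integral_measure hint'
  have h2 : Real.exp (ρ.real Set.univ) • ∫ μ, F μ ∂poissonConf ρ = ∫ μ, F μ ∂(Measure.sum
      fun n : ℕ => ENNReal.ofReal ((n.factorial : ℝ)⁻¹) •
        (Measure.pi fun _ : Fin n => ρ).map ofTuple) := by
    rw [poissonConf, integral_smul_measure, ENNReal.toReal_ofReal (Real.exp_pos _).le, smul_smul,
      ← Real.exp_add, add_neg_cancel, Real.exp_zero, one_smul]
  rw [h2]
  refine (hasSum_congr fun n => ?_).mp h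
  rw [integral_smul_measure, ENNReal.toReal_ofReal (by positivity),
    integral_map (measurable_ofTuple n).aemeasurable hF.aestronglyMeasurable]

theorem hasSum_integral_poissonConf {F : Conf X → ℝ} (hF : Measurable F)
    (hint : Integrable F (poissonConf ρ)) :
    HasSum (fun n : ℕ => (n.factorial : ℝ)⁻¹ *
      ∫ x, F (ofTuple x) ∂(Measure.pi fun _ : Fin n => ρ))
      (Real.exp (ρ.real Set.univ) * ∫ μ, F μ ∂poissonConf ρ) :=
  hasSum_integral_poissonConf' ρ hF.stronglyMeasurable hint

/-! ### The Fock space representation of the second moment -/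

/-- The iterated difference operator for functions of configurations. -/
def confDiff (F : Conf X → ℝ) : (n : ℕ) → (Fin n → X) → Conf X → ℝ
  | 0, _, μ => F μ
  | n + 1, x, μ => confDiff F n (Fin.tail x) (μ + pt (x 0)) - confDiff F n (Fin.tail x) μ

theorem diffOp_coe (F : Measure X → ℝ) (n : ℕ) (x : Fin n → X) (μ : Conf X) :
    diffOp F n x μ = confDiff (fun ν => F ν.1) n x μ := by
  induction n generalizing μ with
  | zero => rfl
  | succ n ih =>
    simp only [diffOp, confDiff, ← ih]
    rfl

theorem measurable_confDiff {F : Conf X → ℝ} (hF : Measurable F) (n : ℕ) :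
    Measurable fun p : (Fin n → X) × Conf X => confDiff F n p.1 p.2 := by
  induction n with
  | zero => exact hF.comp measurable_snd
  | succ n ih =>
    have h1 : Measurable fun p : (Fin (n + 1) → X) × Conf X => Fin.tail p.1 :=
      measurable_pi_lambda _ fun i => (measurable_pi_apply _).comp measurable_fst
    have h2 : Measurable fun p : (Fin (n + 1) → X) × Conf X => p.2 + pt (p.1 0) :=
      measurable_snd.add (measurable_pt.comp ((measurable_pi_apply 0).comp measurable_fst))
    exact (ih.comp (h1.prodMk h2)).sub (ih.comp (h1.prodMk measurable_snd))

theorem abs_confDiff_le {F : Conf X → ℝ} {b : Conf X → ℝ} {c : ℝ}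
    (hb : ∀ μ, |F μ| ≤ b μ) (hc : ∀ μ x, b (μ + pt x) ≤ c * b μ) (hc0 : 0 ≤ c) (n : ℕ)
    (x : Fin n → X) (μ : Conf X) : |confDiff F n x μ| ≤ (c + 1) ^ n * b μ := by
  induction n generalizing μ with
  | zero => simpa [confDiff] using hb μ
  | succ n ih =>
    simp only [confDiff]
    refine (abs_sub _ _).trans ?_
    have h1 := ih (Fin.tail x) (μ + pt (x 0))
    have h2 := ih (Fin.tail x) μ
    have h3 : (c + 1) ^ n * b (μ + pt (x 0)) ≤ (c + 1) ^ n * (c * b μ) :=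
      mul_le_mul_of_nonneg_left (hc _ _) (by positivity)
    calc _ ≤ (c + 1) ^ n * (c * b μ) + (c + 1) ^ n * b μ := add_le_add (h1.trans h3) h2
      _ = (c + 1) ^ (n + 1) * b μ := by ring

end Configurations

/-! ### Operator exponentials behind the Fock space representation. -/

section Fock

variable {X : Type*} [MeasurableSpace X]

namespace BddMeas

theorem measurable_prodMk_pt :
    Measurable fun x : X => ((pt x, pt x) : Conf X × Conf X) :=
  measurable_pt.prodMk measurable_pt

theorem measurable_pt_zero : Measurable fun x : X => ((pt x, 0) : Conf X × Conf X) :=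
  measurable_pt.prodMk measurable_const

theorem measurable_zero_pt : Measurable fun x : X => ((0, pt x) : Conf X × Conf X) :=
  measurable_const.prodMk measurable_pt

/-- The shifts that enter the square of the difference operator. -/
def squareShift : Fin 4 → X → Conf X × Conf X :=
  ![fun x => (pt x, pt x), fun x => (pt x, 0), fun x => (0, pt x), fun _ => 0]

theorem measurable_squareShift (k : Fin 4) : Measurable (squareShift (X := X) k) := by
  fin_cases k
  exacts [measurable_prodMk_pt, measurable_pt_zero, measurable_zero_pt, measurable_const]

/-- The shifts that enter the difference operator. -/
def diffShift : Fin 2 → X → Conf X := ![pt, fun _ => 0]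

/-- The tensor product of two functions. -/
def tensor {M N : Type*} [MeasurableSpace M] [MeasurableSpace N] (f : BddMeas M)
    (h : BddMeas N) : BddMeas (M × N) :=
  mk (fun p => f.fn p.1 * h.fn p.2)
    ((f.measurable_fn.comp measurable_fst).mul (h.measurable_fn.comp measurable_snd))
    ⟨‖f‖ * ‖h‖, fun p => by
      rw [abs_mul]
      exact mul_le_mul (f.abs_fn_le _) (h.abs_fn_le _) (abs_nonneg _) (norm_nonneg _)⟩

theorem tensor_fn {M N : Type*} [MeasurableSpace M] [MeasurableSpace N] (f : BddMeas M)
    (h : BddMeas N) (p : M × N) : (tensor f h).fn p = f.fn p.1 * h.fn p.2 := rfl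

variable (ρ : Measure X) [IsFiniteMeasure ρ] (a : ℝ)

/-- The weighted average over the configurations with one additional point. -/
def opPt : BddMeas (Conf X) →L[ℝ] BddMeas (Conf X) :=
  op ρ (fun _ : Unit => a) (fun _ => pt) fun _ => measurable_pt

/-- Addition of a point to the first component. -/
def opFst : BddMeas (Conf X × Conf X) →L[ℝ] BddMeas (Conf X × Conf X) :=
  op ρ (fun _ : Unit => a) (fun _ x => (pt x, 0)) fun _ => measurable_pt_zero

/-- Addition of a point to the second component. -/
def opSnd : BddMeas (Conf X × Conf X) →L[ℝ] BddMeas (Conf X × Conf X) :=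
  op ρ (fun _ : Unit => a) (fun _ x => (0, pt x)) fun _ => measurable_zero_pt

/-- Addition of a point to both components. -/
def opBoth : BddMeas (Conf X × Conf X) →L[ℝ] BddMeas (Conf X × Conf X) :=
  op ρ (fun _ : Unit => a ^ 2) (fun _ x => (pt x, pt x)) fun _ => measurable_prodMk_pt

/-- The average of the tensor square of the weighted difference operator. -/
def opSquare : BddMeas (Conf X × Conf X) →L[ℝ] BddMeas (Conf X × Conf X) :=
  op ρ ![a ^ 2, -a, -a, 1] squareShift measurable_squareShift

theorem opSnd_tensor (f h : BddMeas (Conf X)) :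
    opSnd ρ a (tensor f h) = tensor f (opPt ρ a h) := by
  refine ext_fn fun p => ?_
  rw [tensor_fn, opSnd, opPt, op_fn, op_fn, ← integral_const_mul]
  refine integral_congr_ae (ae_of_all _ fun x => ?_)
  simp only [shift, tensor_fn, Finset.univ_unique, Finset.sum_singleton, Prod.fst_add,
    Prod.snd_add, add_zero]
  ring

theorem opFst_tensor (f h : BddMeas (Conf X)) :
    opFst ρ a (tensor f h) = tensor (opPt ρ a f) h := by
  refine ext_fn fun p => ?_
  rw [tensor_fn, opFst, opPt, op_fn, op_fn, ← integral_mul_const]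
  refine integral_congr_ae (ae_of_all _ fun x => ?_)
  simp only [shift, tensor_fn, Finset.univ_unique, Finset.sum_singleton, Prod.fst_add,
    Prod.snd_add, add_zero]
  ring

theorem exp_opSnd_tensor (f h : BddMeas (Conf X)) :
    NormedSpace.exp (opSnd ρ a) (tensor f h) = tensor f (NormedSpace.exp (opPt ρ a) h) := by
  have hp : ∀ n : ℕ, (opSnd ρ a ^ n) (tensor f h) = tensor f ((opPt ρ a ^ n) h) := by
    intro n
    induction n with
    | zero => rfl
    | succ n ih => rw [pow_succ', pow_succ', mul_apply_eq_comp, ih, opSnd_tensor]; rfl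
  refine ext_fn fun p => (hasSum_exp_fn (opSnd ρ a) _ p).unique ?_
  rw [tensor_fn]
  refine (hasSum_congr fun n => ?_).mp ((hasSum_exp_fn (opPt ρ a) h p.2).mul_left (f.fn p.1))
  rw [hp, tensor_fn]
  ring

theorem exp_opFst_tensor (f h : BddMeas (Conf X)) :
    NormedSpace.exp (opFst ρ a) (tensor f h) = tensor (NormedSpace.exp (opPt ρ a) f) h := by
  have hp : ∀ n : ℕ, (opFst ρ a ^ n) (tensor f h) = tensor ((opPt ρ a ^ n) f) h := by
    intro n
    induction n with
    | zero => rfl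
    | succ n ih => rw [pow_succ', pow_succ', mul_apply_eq_comp, ih, opFst_tensor]; rfl
  refine ext_fn fun p => (hasSum_exp_fn (opFst ρ a) _ p).unique ?_
  rw [tensor_fn]
  refine (hasSum_congr fun n => ?_).mp ((hasSum_exp_fn (opPt ρ a) f p.1).mul_right (h.fn p.2))
  rw [hp, tensor_fn]
  ring

/-- Let S be the shift by one point. The tensor square of a S - 1 expands to a² S ⊗ S - a S ⊗ 1 - a
1 ⊗ S + 1. Averaging over the point turns the last summand into the total mass of ρ. -/
theorem opSquare_add : opSquare ρ a + opFst ρ a + opSnd ρ a =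
    opBoth ρ a + ρ.real Set.univ • ContinuousLinearMap.id ℝ (BddMeas (Conf X × Conf X)) := by
  ext1 Φ
  refine ext_fn fun p => ?_
  change (opSquare ρ a Φ).fn p + (opFst ρ a Φ).fn p + (opSnd ρ a Φ).fn p =
    (opBoth ρ a Φ).fn p + ρ.real Set.univ * Φ.fn p
  have h1 : ρ.real Set.univ * Φ.fn p = ∫ _, Φ.fn p ∂ρ := by
    rw [integral_const, smul_eq_mul]
  have i1 := integrable_shift ρ ![a ^ 2, -a, -a, 1] measurable_squareShift Φ p
  have i2 := integrable_shift ρ (fun _ : Unit => a) (fun _ => measurable_pt_zero) Φ p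
  have i3 := integrable_shift ρ (fun _ : Unit => a) (fun _ => measurable_zero_pt) Φ p
  rw [h1, opSquare, opFst, opSnd, opBoth, op_fn, op_fn, op_fn, op_fn, ← integral_add i1 i2,
    ← integral_add (f := fun x => _ + _) (i1.add i2) i3,
    ← integral_add (integrable_shift ρ _ (fun _ => measurable_prodMk_pt) Φ p)
      (integrable_const _)]
  refine integral_congr_ae (ae_of_all _ fun x => ?_)
  simp [shift, squareShift, Fin.sum_univ_four]
  ring

/-- All operators commute, so exponentiating `opSquare_add` turns sums into products. Applied to a
tensor square f ⊗ f, this identity is the Fock representation in operator form. -/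
theorem exp_opSquare_mul : NormedSpace.exp (opSquare ρ a) * NormedSpace.exp (opFst ρ a) *
    NormedSpace.exp (opSnd ρ a) = Real.exp (ρ.real Set.univ) • NormedSpace.exp (opBoth ρ a) := by
  let +nondep : NormedAlgebra ℚ (BddMeas (Conf X × Conf X) →L[ℝ] BddMeas (Conf X × Conf X)) :=
    .restrictScalars ℚ ℝ _
  have c1 : Commute (opSquare ρ a) (opFst ρ a) := op_commute ρ _ _ _ _
  have c2 : Commute (opSquare ρ a) (opSnd ρ a) := op_commute ρ _ _ _ _
  have c3 : Commute (opFst ρ a) (opSnd ρ a) := op_commute ρ _ _ _ _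
  rw [← NormedSpace.exp_add_of_commute c1, ← NormedSpace.exp_add_of_commute (c2.add_left c3),
    opSquare_add]
  have h1 : ρ.real Set.univ • ContinuousLinearMap.id ℝ (BddMeas (Conf X × Conf X)) =
      algebraMap ℝ (BddMeas (Conf X × Conf X) →L[ℝ] BddMeas (Conf X × Conf X))
        (ρ.real Set.univ) := by
    rw [Algebra.algebraMap_eq_smul_one]
    rfl
  rw [h1, NormedSpace.exp_add_of_commute (Algebra.commute_algebraMap_right _ _),
    ← NormedSpace.algebraMap_exp_comm, Algebra.algebraMap_eq_smul_one, mul_smul_comm, mul_one,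
    Real.exp_eq_exp_ℝ]

theorem iterShift_square_tensor (f : BddMeas (Conf X)) (n : ℕ) (x : Fin n → X)
    (p : Conf X × Conf X) : iterShift ![a ^ 2, -a, -a, 1] squareShift (tensor f f).fn n x p =
      iterShift ![a, -1] diffShift f.fn n x p.1 * iterShift ![a, -1] diffShift f.fn n x p.2 := by
  induction n generalizing p with
  | zero => rfl
  | succ n ih =>
    simp only [iterShift, shift, Fin.sum_univ_four, Fin.sum_univ_two, ih]
    simp [squareShift, diffShift]
    ring

theorem iterShift_pt (f : BddMeas (Conf X)) (n : ℕ) (x : Fin n → X) (μ : Conf X) :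
    iterShift (fun _ : Unit => a) (fun _ => pt) f.fn n x μ = a ^ n * f.fn (μ + ofTuple x) := by
  induction n generalizing μ with
  | zero => simp [iterShift, ofTuple_zero]
  | succ n ih =>
    simp only [iterShift, shift, Finset.univ_unique, Finset.sum_singleton, ih]
    rw [ofTuple_succ, ← add_assoc, pow_succ', mul_assoc]

theorem iterShift_both (Φ : BddMeas (Conf X × Conf X)) (n : ℕ) (x : Fin n → X)
    (p : Conf X × Conf X) :
    iterShift (fun _ : Unit => a ^ 2) (fun _ x => (pt x, pt x)) Φ.fn n x p =
      (a ^ 2) ^ n * Φ.fn (p + (ofTuple x, ofTuple x)) := by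
  induction n generalizing p with
  | zero =>
    rw [ofTuple_zero, Prod.mk_zero_zero, add_zero, pow_zero, one_mul]
    rfl
  | succ n ih =>
    simp only [iterShift, shift, Finset.univ_unique, Finset.sum_singleton, ih]
    rw [ofTuple_succ, pow_succ' (a ^ 2), mul_assoc, add_assoc p, Prod.mk_add_mk (pt (x 0))]

/-- A functional F that grows like a^mass is unbounded, but f = F / a^mass need not be. Adding a
point multiplies the weight by a, so the difference operator on F acts on f as a times the shift
minus the identity. -/
theorem iterShift_diff {F : Conf X → ℝ} {a : ℝ} (ha : 0 < a) {f : Conf X → ℝ}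
    (hf : ∀ μ, F μ = a ^ mass μ * f μ) (n : ℕ) (x : Fin n → X) (μ : Conf X) :
    confDiff F n x μ = a ^ mass μ * iterShift ![a, -1] diffShift f n x μ := by
  induction n generalizing μ with
  | zero => exact hf μ
  | succ n ih =>
    simp only [confDiff, ih, iterShift, shift, Fin.sum_univ_two, diffShift, mass_add, mass_pt,
      Real.rpow_add ha, Real.rpow_one]
    simp
    ring

end BddMeas

open BddMeas in
/-- The Fock space representation of the second moment of a Poisson functional. -/
theorem hasSum_sq_confDiff (ρ : Measure X) [IsFiniteMeasure ρ] {F : Conf X → ℝ}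
    (hF : Measurable F) {C a : ℝ} (ha : 0 < a) (hb : ∀ μ, |F μ| ≤ C * a ^ mass μ) :
    HasSum (fun n : ℕ => (n.factorial : ℝ)⁻¹ *
      ∫ x, (∫ ξ, confDiff F n x ξ ∂poissonConf ρ) ^ 2 ∂(Measure.pi fun _ : Fin n => ρ))
      (∫ ξ, F ξ ^ 2 ∂poissonConf ρ) := by
  have hw : ∀ μ : Conf X, 0 < a ^ mass μ := fun μ => Real.rpow_pos_of_pos ha _
  set L := ρ.real Set.univ
  let f : BddMeas (Conf X) := mk (fun μ => F μ / a ^ mass μ)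
    (hF.div (measurable_mass.const_pow a)) ⟨C, fun μ => by
      rw [abs_div, abs_of_pos (hw μ), div_le_iff₀ (hw μ)]
      exact hb μ⟩
  have hf : ∀ μ, F μ = a ^ mass μ * f.fn μ := fun μ => (mul_div_cancel₀ _ (hw μ).ne').symm
  let f' := NormedSpace.exp (opPt ρ a) f
  let G : Conf X → ℝ := fun μ => a ^ mass μ * f'.fn μ
  have hshift : ∀ μ, Integrable (fun ξ => F (μ + ξ)) (poissonConf ρ) := fun μ =>
    integrable_poissonConf ρ (hF.comp (measurable_const_add μ)) ha (C := C * a ^ mass μ)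
      fun ξ => by
        refine (hb _).trans (le_of_eq ?_)
        rw [mass_add, Real.rpow_add ha, mul_assoc]
  -- The exponential series of `opPt` is, up to the factor e^L, the expectation over an added
  -- Poisson configuration.
  have hG : ∀ μ, G μ = Real.exp L * ∫ ξ, F (μ + ξ) ∂poissonConf ρ := by
    intro μ
    refine HasSum.unique ?_ (hasSum_integral_poissonConf ρ (hF.comp (measurable_const_add μ))
      (hshift μ))
    refine (hasSum_congr fun n => ?_).mp
      ((hasSum_exp_fn (opPt ρ a) f μ).mul_left (a ^ mass μ))
    rw [opPt, op_pow_fn, mul_left_comm, ← integral_const_mul]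
    congr 2
    ext x
    rw [iterShift_pt, hf, mass_add, mass_ofTuple, Real.rpow_add ha, Real.rpow_natCast]
    ring
  have hdiffInt : ∀ n (x : Fin n → X) μ,
      Integrable (fun ξ => confDiff F n x (μ + ξ)) (poissonConf ρ) := by
    intro n
    induction n with
    | zero => exact fun x μ => hshift μ
    | succ n ih =>
      intro x μ
      have h := (ih (Fin.tail x) (μ + pt (x 0))).sub (ih (Fin.tail x) μ)
      refine h.congr (ae_of_all _ fun ξ => ?_)
      simp only [confDiff, Pi.sub_apply]
      rw [add_right_comm]
  have hdiff : ∀ n (x : Fin n → X) μ, confDiff G n x μ =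
      Real.exp L * ∫ ξ, confDiff F n x (μ + ξ) ∂poissonConf ρ := by
    intro n
    induction n with
    | zero => exact fun x μ => hG μ
    | succ n ih =>
      intro x μ
      simp only [confDiff]
      rw [ih, ih, ← mul_sub, ← integral_sub (hdiffInt _ _ _) (hdiffInt _ _ _)]
      congr 2
      ext ξ
      rw [add_right_comm]
  -- At f ⊗ f and the empty configuration the operator identity reads ∑ (1/n!) ∫ (Dⁿ G(0))² = e^L ·
  -- e^L E F². Since Dⁿ G(0) = e^L E Dⁿ F, the factors e^(2L) cancel.
  have hop := congrArg (fun T => (T (tensor f f)).fn 0) (exp_opSquare_mul ρ a)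
  have hleft : (NormedSpace.exp (opSquare ρ a) * NormedSpace.exp (opFst ρ a) *
      NormedSpace.exp (opSnd ρ a)) (tensor f f) =
      NormedSpace.exp (opSquare ρ a) (tensor f' f') := by
    rw [mul_apply_eq_comp, mul_apply_eq_comp, exp_opSnd_tensor, exp_opFst_tensor]
  have h1 := hasSum_exp_fn (opSquare ρ a) (tensor f' f') 0
  rw [← hleft] at h1
  rw [hop] at h1
  have h2 : ((Real.exp L • NormedSpace.exp (opBoth ρ a)) (tensor f f)).fn 0 =
      Real.exp L * (Real.exp L * ∫ ξ, F ξ ^ 2 ∂poissonConf ρ) := by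
    change Real.exp L * (NormedSpace.exp (opBoth ρ a) (tensor f f)).fn 0 = _
    congr 1
    have hint : Integrable (fun ξ => F ξ ^ 2) (poissonConf ρ) :=
      integrable_poissonConf ρ (hF.pow_const 2) (pow_pos ha 2) (C := C ^ 2) fun μ => by
        rw [abs_pow]
        refine (pow_le_pow_left₀ (abs_nonneg _) (hb μ) 2).trans (le_of_eq ?_)
        rw [mul_pow, ← Real.rpow_natCast (a ^ mass μ), ← Real.rpow_mul ha.le, mul_comm (mass μ),
          Real.rpow_mul ha.le, Real.rpow_natCast]
    refine HasSum.unique ?_ (hasSum_integral_poissonConf ρ (hF.pow_const 2) hint)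
    refine (hasSum_congr fun n => ?_).mp (hasSum_exp_fn (opBoth ρ a) (tensor f f) 0)
    rw [opBoth, op_pow_fn]
    congr 2
    ext x
    rw [iterShift_both, zero_add, tensor_fn, hf, mass_ofTuple, Real.rpow_natCast]
    ring
  rw [h2] at h1
  have h3 := h1.mul_left ((Real.exp L)⁻¹ * (Real.exp L)⁻¹)
  have hexp : Real.exp L ≠ 0 := (Real.exp_pos _).ne'
  have h4 : (Real.exp L)⁻¹ * (Real.exp L)⁻¹ * (Real.exp L * (Real.exp L *
      ∫ ξ, F ξ ^ 2 ∂poissonConf ρ)) = ∫ ξ, F ξ ^ 2 ∂poissonConf ρ := by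
    field_simp
  rw [h4] at h3
  refine (hasSum_congr fun n => ?_).mp h3
  rw [opSquare, op_pow_fn, mul_left_comm, ← integral_const_mul]
  congr 2
  ext x
  have h5 := hdiff n x 0
  rw [iterShift_diff ha (f := f'.fn) (fun _ => rfl)] at h5
  simp only [mass_zero, Real.rpow_zero, one_mul, zero_add] at h5
  rw [iterShift_square_tensor]
  simp only [Prod.fst_zero, Prod.snd_zero]
  rw [h5]
  field_simp

end Fock

/-! ### The law of a Poisson process on a set of finite intensity -/

section Law

set_option linter.unusedSectionVars false

variable {X : Type*} [MeasurableSpace X]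

theorem integral_comp_simpleFunc {V : Type*} [NormedAddCommGroup V] [NormedSpace ℝ V]
    [CompleteSpace V] (μ : Measure X) [IsFiniteMeasure μ] (h : SimpleFunc X ℝ) (G : ℝ → V) :
    ∫ x, G (h x) ∂μ = ∑ v ∈ h.range, μ.real (h ⁻¹' {v}) • G v := by
  have h1 : ∀ x, G (h x) = ∑ v ∈ h.range, (h ⁻¹' {v}).indicator (fun _ => G v) x := by
    intro x
    rw [Finset.sum_eq_single (h x)]
    · rw [Set.indicator_of_mem (by simp)]
    · intro v _ hv
      rw [Set.indicator_of_notMem (by simpa using hv.symm)]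
    · intro hx
      exact absurd (SimpleFunc.mem_range_self h x) hx
  simp_rw [h1]
  rw [integral_finsetSum]
  · refine Finset.sum_congr rfl fun v _ => ?_
    rw [integral_indicator_const _ (h.measurableSet_fiber v)]
  · exact fun v _ => (integrable_const _).indicator (h.measurableSet_fiber v)

theorem integral_coe_simpleFunc (μ : Measure X) [IsFiniteMeasure μ] (h : SimpleFunc X ℝ) :
    ∫ x, h x ∂μ = ∑ v ∈ h.range, v * μ.real (h ⁻¹' {v}) := by
  have := integral_comp_simpleFunc μ h id
  simp only [id, smul_eq_mul] at this
  simp only [this, mul_comm]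

/-- The characteristic functional of the Poisson law. -/
theorem integral_exp_poissonConf (ρ : Measure X) [IsFiniteMeasure ρ] (h : SimpleFunc X ℝ) :
    ∫ μ, Complex.exp ((∫ x, h x ∂μ.1 : ℝ) * Complex.I) ∂poissonConf ρ =
      Complex.exp (∑ v ∈ h.range,
        (ρ.real (h ⁻¹' {v}) : ℂ) * (Complex.exp (v * Complex.I) - 1)) := by
  have hm : Measurable fun μ : Conf X => ∫ x, h x ∂μ.1 := by
    simp_rw [integral_coe_simpleFunc]
    refine Finset.measurable_sum _ fun v _ => Measurable.const_mul ?_ _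
    exact ((Measure.measurable_coe (h.measurableSet_fiber v)).comp
      measurable_subtype_coe).ennreal_toReal
  have hm' : Measurable fun μ : Conf X => Complex.exp ((∫ x, h x ∂μ.1 : ℝ) * Complex.I) := by
    fun_prop
  have hint : Integrable (fun μ : Conf X => Complex.exp ((∫ x, h x ∂μ.1 : ℝ) * Complex.I))
      (poissonConf ρ) := Integrable.of_bound hm'.aestronglyMeasurable 1
        (ae_of_all _ fun μ => by rw [Complex.norm_exp_ofReal_mul_I])
  have h1 := hasSum_integral_poissonConf' ρ hm'.stronglyMeasurable hint
  have h2 : ∀ n : ℕ, (n.factorial : ℝ)⁻¹ • ∫ x, Complex.exp ((∫ y, h y ∂(ofTuple x).1 : ℝ) *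
      Complex.I) ∂(Measure.pi fun _ : Fin n => ρ) =
      (∫ x, Complex.exp (h x * Complex.I) ∂ρ) ^ n / n.factorial := by
    intro n
    have h3 : ∀ x : Fin n → X, Complex.exp ((∫ y, h y ∂(ofTuple x).1 : ℝ) * Complex.I) =
        ∏ i, Complex.exp (h (x i) * Complex.I) := by
      intro x
      rw [coe_ofTuple, integral_finsetSum_measure fun i _ => ?_]
      · simp_rw [integral_dirac' _ _ h.stronglyMeasurable]
        rw [← Complex.exp_sum, ← Finset.sum_mul]
        push_cast
        rfl
      · exact h.integrable_of_isFiniteMeasure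
    simp_rw [h3]
    rw [integral_fintype_prod_eq_pow (fun y => Complex.exp (h y * Complex.I)), Fintype.card_fin,
      Complex.real_smul, div_eq_inv_mul]
    push_cast
    rfl
  have h4 := ((hasSum_congr h2).mp h1).unique
    (NormedSpace.expSeries_div_hasSum_exp (∫ x, Complex.exp (h x * Complex.I) ∂ρ))
  rw [← Complex.exp_eq_exp_ℂ, Complex.real_smul] at h4
  have h5 : ((Real.exp (ρ.real Set.univ) : ℝ) : ℂ) ≠ 0 := by
    exact_mod_cast (Real.exp_pos _).ne'
  have h6 : ∫ x, Complex.exp (h x * Complex.I) ∂ρ = ρ.real Set.univ + ∑ v ∈ h.range,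
      (ρ.real (h ⁻¹' {v}) : ℂ) * (Complex.exp (v * Complex.I) - 1) := by
    rw [integral_comp_simpleFunc ρ h fun v : ℝ => Complex.exp (v * Complex.I)]
    have h7 : ((ρ.real Set.univ : ℝ) : ℂ) = ∑ v ∈ h.range, (ρ.real (h ⁻¹' {v}) : ℂ) := by
      have := integral_comp_simpleFunc ρ h fun _ : ℝ => (1 : ℂ)
      simp only [integral_const, Complex.real_smul, mul_one] at this
      exact this
    rw [h7, ← Finset.sum_add_distrib]
    refine Finset.sum_congr rfl fun v _ => ?_
    rw [Complex.real_smul]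
    ring
  rw [h6, Complex.exp_add, ← Complex.ofReal_exp] at h4
  exact mul_left_cancel₀ h5 h4

variable {Ω : Type*} [MeasurableSpace Ω] {P : Measure Ω} [IsProbabilityMeasure P]
  {Λ : Measure X} {η : Ω → Measure X}

theorem poissonLaw_of_ne_top {t : ℝ≥0∞} (ht : t ≠ ⊤) :
    poissonLaw t = (poissonMeasure t.toNNReal).map (fun n : ℕ => (n : ℝ≥0∞)) := if_neg ht

theorem IsPoissonProcess.measurable_apply (hη : IsPoissonProcess Λ η P) {B : Set X}
    (hB : MeasurableSet B) : Measurable fun ω => η ω B :=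
  (Measure.measurable_coe hB).comp hη.measurable

theorem IsPoissonProcess.ae_lt_top (hη : IsPoissonProcess Λ η P) {B : Set X}
    (hB : MeasurableSet B) (hΛ : Λ B ≠ ⊤) : ∀ᵐ ω ∂P, η ω B < ⊤ := by
  have h := hη.law B hB
  rw [poissonLaw_of_ne_top hΛ] at h
  have h1 : (P.map fun ω => η ω B) {⊤} = 0 := by
    rw [h, Measure.map_apply .of_discrete (measurableSet_singleton _)]
    have : (fun n : ℕ => (n : ℝ≥0∞)) ⁻¹' {⊤} = ∅ := by
      ext n
      simp
    rw [this, measure_empty]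
  rw [Measure.map_apply (hη.measurable_apply hB) (measurableSet_singleton _)] at h1
  have h2 : ∀ᵐ ω ∂P, ω ∉ (fun ω => η ω B) ⁻¹' {⊤} := measure_eq_zero_iff_ae_notMem.mp h1
  filter_upwards [h2] with ω hω
  exact lt_top_iff_ne_top.mpr hω

theorem IsPoissonProcess.integral_exp_apply (hη : IsPoissonProcess Λ η P) {B : Set X}
    (hB : MeasurableSet B) (hΛ : Λ B ≠ ⊤) (v : ℝ) :
    ∫ ω, Complex.exp ((v * (η ω B).toReal : ℝ) * Complex.I) ∂P =
      Complex.exp (((Λ B).toReal : ℂ) * (Complex.exp (v * Complex.I) - 1)) := by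
  have h := hη.law B hB
  rw [poissonLaw_of_ne_top hΛ] at h
  have hmeas : Measurable fun t : ℝ≥0∞ => Complex.exp ((v * t.toReal : ℝ) * Complex.I) := by
    fun_prop
  have h1 := integral_map (μ := P) (hη.measurable_apply hB).aemeasurable
    (f := fun t : ℝ≥0∞ => Complex.exp ((v * t.toReal : ℝ) * Complex.I)) hmeas.aestronglyMeasurable
  rw [← h1, h, integral_map .of_discrete hmeas.aestronglyMeasurable]
  have h2 := charFun_map_cast_poissonMeasure (Λ B).toNNReal v
  rw [charFun_apply, integral_map .of_discrete (by fun_prop)] at h2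
  simp_rw [Real.inner_apply] at h2
  convert h2 using 2
  · ext n
    simp [mul_comm]
  · rfl

/-- Finite mass on B means that only finitely many indices have their atom in B; the remaining Dirac
measures restrict to zero. -/
theorem IsCountingMeasure.restrict_mem_finConf {μ : Measure X} (hμ : IsCountingMeasure μ)
    {B : Set X} (hB : MeasurableSet B) (hfin : μ B < ⊤) : μ.restrict B ∈ finConf X := by
  classical
  obtain ⟨ι, hι, x, rfl⟩ := hμ
  rw [Measure.sum_apply _ hB] at hfin
  have h1 : ∀ i, Measure.dirac (x i) B = if x i ∈ B then (1 : ℝ≥0∞) else 0 := fun i => by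
    rw [Measure.dirac_apply' _ hB]
    rfl
  simp_rw [h1] at hfin
  have hf : {i | x i ∈ B}.Finite := by
    have h2 := ENNReal.finite_const_le_of_tsum_ne_top hfin.ne one_ne_zero
    refine h2.subset fun i hi => ?_
    simp only [Set.mem_ofPred_eq] at hi ⊢
    rw [if_pos hi]
  rw [Measure.restrict_sum _ hB]
  have h3 : (Measure.sum fun i => (Measure.dirac (x i)).restrict B) =
      ∑ i ∈ hf.toFinset, Measure.dirac (x i) := by
    ext D hD
    rw [Measure.sum_apply _ hD, Measure.finsetSum_apply, tsum_eq_sum (s := hf.toFinset)]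
    · refine Finset.sum_congr rfl fun i hi => ?_
      have : x i ∈ B := by simpa using hi
      rw [restrict_dirac' hB, if_pos this]
    · intro i hi
      have : x i ∉ B := by simpa using hi
      rw [restrict_dirac' hB, if_neg this]
      rfl
  rw [h3]
  exact AddSubmonoid.sum_mem _ fun i _ => (pt (x i)).2

open Classical in
/-- The restriction of a Poisson process to a set, as a finite configuration. -/
def localConf (η : Ω → Measure X) (B : Set X) (ω : Ω) : Conf X :=
  -- For a Poisson process and measurable B, the default 0 is taken only where η ω B is infinite,
  -- which is a null event when Λ B is finite.
  if h : η ω B < ⊤ ∧ (η ω).restrict B ∈ finConf X then ⟨(η ω).restrict B, h.2⟩ else 0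

theorem IsPoissonProcess.localConf_coe (hη : IsPoissonProcess Λ η P) {B : Set X}
    (hB : MeasurableSet B) {ω : Ω} (h : η ω B < ⊤) : (localConf η B ω).1 = (η ω).restrict B := by
  rw [localConf, dif_pos ⟨h, (hη.counting ω).restrict_mem_finConf hB h⟩]

theorem IsPoissonProcess.measurable_localConf (hη : IsPoissonProcess Λ η P) {B : Set X}
    (hB : MeasurableSet B) : Measurable (localConf η B) := by
  classical
  have h1 : ∀ ω, (localConf η B ω).1 = if η ω B < ⊤ then (η ω).restrict B else 0 := by
    intro ω
    split_ifs with h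
    · exact hη.localConf_coe hB h
    · rw [localConf, dif_neg fun h' => h h'.1]
      rfl
  suffices h2 : Measurable fun ω => (localConf η B ω).1 from
    h2.subtype_mk (h := fun ω => (localConf η B ω).2)
  simp_rw [h1]
  refine Measurable.ite (measurableSet_lt (hη.measurable_apply hB) measurable_const) ?_
    measurable_const
  refine Measure.measurable_of_measurable_coe _ fun D hD => ?_
  simp_rw [Measure.restrict_apply hD]
  exact hη.measurable_apply (hD.inter hB)

/-- The level sets of h intersected with B are disjoint, so their counts are independent and the
exponential factorises into Poisson characteristic functions. -/
theorem IsPoissonProcess.integral_exp_localConf (hη : IsPoissonProcess Λ η P) {B : Set X}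
    (hB : MeasurableSet B) (hΛ : Λ B ≠ ⊤) (h : SimpleFunc X ℝ) :
    ∫ ω, Complex.exp ((∫ x, h x ∂(localConf η B ω).1 : ℝ) * Complex.I) ∂P =
      Complex.exp (∑ v ∈ h.range,
        ((Λ.restrict B).real (h ⁻¹' {v}) : ℂ) * (Complex.exp (v * Complex.I) - 1)) := by
  have hm : ∀ v, MeasurableSet (h ⁻¹' {v} ∩ B) := fun v => (h.measurableSet_fiber v).inter hB
  have hfin : ∀ v, Λ (h ⁻¹' {v} ∩ B) ≠ ⊤ := fun v =>
    ((measure_mono Set.inter_subset_right).trans_lt hΛ.lt_top).ne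
  have h1 : ∀ᵐ ω ∂P, Complex.exp ((∫ x, h x ∂(localConf η B ω).1 : ℝ) * Complex.I) =
      ∏ v : h.range, Complex.exp ((v.1 * (η ω (h ⁻¹' {v.1} ∩ B)).toReal : ℝ) * Complex.I) := by
    filter_upwards [hη.ae_lt_top hB hΛ] with ω hω
    rw [integral_coe_simpleFunc, hη.localConf_coe hB hω, ← Complex.exp_sum, ← Finset.sum_mul]
    congr 2
    push_cast
    rw [← Finset.sum_coe_sort h.range]
    refine Finset.sum_congr rfl fun v _ => ?_
    rw [measureReal_def, Measure.restrict_apply (h.measurableSet_fiber _)]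
  rw [integral_congr_ae h1]
  let e := Fintype.equivFin h.range
  have hind := hη.indep _ (fun k => h ⁻¹' {(e.symm k).1} ∩ B) (fun k => hm _) (by
    intro k l hkl
    refine Set.disjoint_left.mpr fun x hx hx' => hkl ?_
    have h2 : h x = (e.symm k).1 := hx.1
    have h3 : h x = (e.symm l).1 := hx'.1
    exact e.symm.injective (Subtype.ext (h2.symm.trans h3)))
  have h2 : ∀ ω, ∏ v : h.range,
      Complex.exp ((v.1 * (η ω (h ⁻¹' {v.1} ∩ B)).toReal : ℝ) * Complex.I) =
      ∏ k, Complex.exp (((e.symm k).1 * (η ω (h ⁻¹' {(e.symm k).1} ∩ B)).toReal : ℝ) *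
        Complex.I) := fun ω => (Equiv.prod_comp e.symm
          fun v : h.range => Complex.exp ((v.1 * (η ω (h ⁻¹' {v.1} ∩ B)).toReal : ℝ) *
            Complex.I)).symm
  simp_rw [h2]
  rw [hind.integral_fun_prod_comp
    (f := fun k (t : ℝ≥0∞) => Complex.exp (((e.symm k).1 * t.toReal : ℝ) * Complex.I))
    (fun k => (hη.measurable_apply (hm _)).aemeasurable) fun k => by
      have : Measurable fun t : ℝ≥0∞ =>
        Complex.exp (((e.symm k).1 * t.toReal : ℝ) * Complex.I) := by fun_prop
      exact this.aestronglyMeasurable]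
  simp_rw [hη.integral_exp_apply (hm _) (hfin _)]
  rw [← Complex.exp_sum, Equiv.sum_comp e.symm fun v : h.range =>
    ((Λ (h ⁻¹' {v.1} ∩ B)).toReal : ℂ) * (Complex.exp (v.1 * Complex.I) - 1),
    ← Finset.sum_coe_sort h.range]
  congr 1
  refine Finset.sum_congr rfl fun v _ => ?_
  rw [measureReal_def, Measure.restrict_apply (h.measurableSet_fiber _)]

/-- The numbers of points in all measurable sets. -/
def counts (μ : Conf X) (D : {D : Set X // MeasurableSet D}) : ℝ := μ.1.real D.1

theorem measurable_counts : Measurable (counts : Conf X → _) :=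
  measurable_pi_lambda _ fun D =>
    ((Measure.measurable_coe D.2).comp measurable_subtype_coe).ennreal_toReal

/-- Configurations are finite measures, so real-valued counts lose nothing, and the counts of all
measurable sets generate the σ-algebra. -/
theorem exists_preimage_counts {A : Set (Conf X)} (hA : MeasurableSet A) :
    ∃ A' : Set ({D : Set X // MeasurableSet D} → ℝ), MeasurableSet A' ∧ counts ⁻¹' A' = A := by
  have h : @Measurable (Conf X) (Conf X) (MeasurableSpace.comap counts inferInstance) _ id := by
    let : MeasurableSpace (Conf X) := MeasurableSpace.comap counts inferInstance
    refine Measurable.subtype_mk (p := fun μ => μ ∈ finConf X)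
      (f := fun μ : Conf X => μ.1) (h := fun μ => μ.2) ?_
    refine Measure.measurable_of_measurable_coe _ fun D hD => ?_
    have h1 : (fun μ : Conf X => μ.1 D) = fun μ => ENNReal.ofReal (counts μ ⟨D, hD⟩) := by
      ext μ
      rw [counts, ofReal_measureReal]
    rw [h1]
    exact ((measurable_pi_apply _).comp (comap_measurable counts)).ennreal_ofReal
  exact h hA

/-- Finitely many counts have their joint characteristic function among the values of the
characteristic functional at simple functions. So the finite-dimensional distributions agree, hence
the laws of all counts, and these generate the σ-algebra. -/
theorem ext_of_integral_exp {ν₁ ν₂ : Measure (Conf X)} [IsFiniteMeasure ν₁] [IsFiniteMeasure ν₂]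
    (H : ∀ h : SimpleFunc X ℝ, ∫ μ, Complex.exp ((∫ x, h x ∂μ.1 : ℝ) * Complex.I) ∂ν₁ =
      ∫ μ, Complex.exp ((∫ x, h x ∂μ.1 : ℝ) * Complex.I) ∂ν₂) : ν₁ = ν₂ := by
  classical
  have key : ν₁.map counts = ν₂.map counts := by
    refine IsProjectiveLimit.unique (P := fun I => (ν₂.map counts).map I.restrict) ?_
      fun _ => rfl
    intro I
    refine Measure.ext_of_charFunDual (funext fun L => ?_)
    have hf : Set.Finite (Set.range fun x : X => ∑ D : I,
        L (Pi.single D 1) * Set.indicator D.1.1 (fun _ => (1 : ℝ)) x) := by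
      refine (Set.finite_range fun b : I → Bool => ∑ D : I,
        L (Pi.single D 1) * if b D then (1 : ℝ) else 0).subset ?_
      rintro _ ⟨x, rfl⟩
      refine ⟨fun D => decide (x ∈ D.1.1), ?_⟩
      simp [Set.indicator_apply]
    have hmeas : Measurable fun x : X => ∑ D : I,
        L (Pi.single D 1) * Set.indicator D.1.1 (fun _ => (1 : ℝ)) x :=
      Finset.measurable_sum _ fun D _ => (measurable_const.indicator D.1.2).const_mul _
    -- The linear functional L of the counts is the integral of this combination of indicators. It
    -- has finite range because it depends only on which sets of I contain the point.
    let h : SimpleFunc X ℝ := ⟨fun x => ∑ D : I,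
      L (Pi.single D 1) * Set.indicator D.1.1 (fun _ => (1 : ℝ)) x,
      fun v => hmeas (measurableSet_singleton v), hf⟩
    have hL : ∀ μ : Conf X, L (I.restrict (counts μ)) = ∫ x, h x ∂μ.1 := by
      intro μ
      change _ = ∫ x, ∑ D : I, L (Pi.single D 1) * Set.indicator D.1.1 (fun _ => (1 : ℝ)) x ∂μ.1
      rw [integral_finsetSum _ fun D _ =>
        ((integrable_const _).indicator D.1.2).const_mul _]
      have h2 : I.restrict (counts μ) = ∑ D : I, counts μ D.1 • (Pi.single D 1 : I → ℝ) := by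
        rw [← pi_eq_sum_univ']
        rfl
      rw [h2, map_sum]
      refine Finset.sum_congr rfl fun D _ => ?_
      rw [map_smul, integral_const_mul, integral_indicator_const _ D.1.2, smul_eq_mul, smul_eq_mul,
        mul_one, mul_comm]
      rfl
    have hr : Measurable fun v : ({D : Set X // MeasurableSet D} → ℝ) =>
        (I.restrict v : I → ℝ) := Finset.measurable_restrict I
    rw [charFunDual_apply, charFunDual_apply, integral_map hr.aemeasurable (by fun_prop),
      integral_map hr.aemeasurable (by fun_prop),
      integral_map measurable_counts.aemeasurable ?_,
      integral_map measurable_counts.aemeasurable ?_]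
    · simp_rw [hL]
      exact H h
    · have : Measurable fun v : ({D : Set X // MeasurableSet D} → ℝ) =>
        Complex.exp (L (I.restrict v) * Complex.I) := by fun_prop
      exact this.aestronglyMeasurable
    · have : Measurable fun v : ({D : Set X // MeasurableSet D} → ℝ) =>
        Complex.exp (L (I.restrict v) * Complex.I) := by fun_prop
      exact this.aestronglyMeasurable
  ext A hA
  obtain ⟨A', hA', rfl⟩ := exists_preimage_counts hA
  rw [← Measure.map_apply measurable_counts hA', key, Measure.map_apply measurable_counts hA']

/-- The law of the restriction of a Poisson process to a set of finite intensity. -/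
theorem IsPoissonProcess.map_localConf (hη : IsPoissonProcess Λ η P) {B : Set X}
    (hB : MeasurableSet B) (hΛ : Λ B ≠ ⊤) :
    P.map (localConf η B) = poissonConf (Λ.restrict B) := by
  have hm := hη.measurable_localConf hB
  have : IsProbabilityMeasure (P.map (localConf η B)) := Measure.isProbabilityMeasure_map
    hm.aemeasurable
  have : IsFiniteMeasure (Λ.restrict B) := ⟨by simpa using hΛ.lt_top⟩
  refine ext_of_integral_exp fun h => ?_
  rw [integral_exp_poissonConf, integral_map hm.aemeasurable ?_,
    hη.integral_exp_localConf hB hΛ h]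
  have hm : Measurable fun μ : Conf X => ∫ x, h x ∂μ.1 := by
    simp_rw [integral_coe_simpleFunc]
    refine Finset.measurable_sum _ fun v _ => Measurable.const_mul ?_ _
    exact ((Measure.measurable_coe (h.measurableSet_fiber v)).comp
      measurable_subtype_coe).ennreal_toReal
  have hm' : Measurable fun μ : Conf X => Complex.exp ((∫ x, h x ∂μ.1 : ℝ) * Complex.I) := by
    fun_prop
  exact hm'.aestronglyMeasurable

end Law

/-! ### Measurability of the kernel functions and of the excursion sets -/

section Measurability

set_option linter.unusedSectionVars false

variable {d : ℕ} {𝕄 : Type*} [MeasurableSpace 𝕄] {g : 𝕄 → KernelSpace d}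

/-- The frontier of a convex set is null, so positive volume forces an interior point, and a convex
set with interior points lies in the closure of its interior. -/
theorem supp_subset_closure_interior (hg : IsKernelFamily g) (m : 𝕄) :
    (g m).supp ⊆ closure (interior (g m).supp) := by
  have hK : IsCompactConvex (g m).supp := (g m).2.2.1
  have hne : (interior (g m).supp).Nonempty := by
    by_contra hcon
    rw [Set.not_nonempty_iff_eq_empty] at hcon
    have h1 := hK.2.addHaar_frontier volume
    rw [frontier, hcon, Set.sdiff_empty, hK.1.isClosed.closure_eq] at h1
    exact (hg.volume_supp_pos m).ne' h1
  rw [hK.2.closure_interior_eq_closure_of_nonempty_interior hne]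
  exact subset_closure

theorem mem_supp_of_pos {f : KernelSpace d} {y : E d} (h : 0 < f.1 y) : y ∈ f.supp :=
  subset_tsupport _ h.ne'

/-- By continuity on the support and density of its interior, a superlevel set that meets U once
meets it in positive volume. Pointwise conditions on kernels thus become visible in L¹. -/
theorem volume_inter_superlevel_pos (hg : IsKernelFamily g) (m : 𝕄) {U : Set (E d)}
    (hU : IsOpen U) {t : ℝ} (ht : 0 ≤ t) {y : E d} (hy : y ∈ U) (hty : t < (g m).1 y) :
    0 < volume (U ∩ {y | t < (g m).1 y}) := by
  have hyK : y ∈ (g m).supp := mem_supp_of_pos (ht.trans_lt hty)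
  have h1 : {z | t < (g m).1 z} ∈ 𝓝[(g m).supp] y :=
    ((g m).2.2.2 y hyK).eventually (lt_mem_nhds hty)
  obtain ⟨O, hO, hyO, hOs⟩ := mem_nhdsWithin.mp h1
  have h2 : ((O ∩ U) ∩ interior (g m).supp).Nonempty :=
    mem_closure_iff.mp (supp_subset_closure_interior hg m hyK) _ (hO.inter hU) ⟨hyO, hy⟩
  refine (((hO.inter hU).inter isOpen_interior).measure_pos volume h2).trans_le
    (measure_mono ?_)
  rintro z ⟨⟨hz1, hz2⟩, hz3⟩
  exact ⟨hz2, hOs ⟨hz1, interior_subset hz3⟩⟩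

theorem integrableOn_posPart {f : E d → ℝ} (hf : Integrable f) (v : E d) (δ t : ℝ) :
    IntegrableOn (fun y => max (f y - t) 0) (Metric.ball v δ) := by
  have h1 : IntegrableOn (fun y => f y - t) (Metric.ball v δ) :=
    hf.integrableOn.sub (integrableOn_const measure_ball_lt_top.ne)
  exact h1.pos_part

/-- The functional is 1-Lipschitz in the L¹-norm, hence Borel. -/
theorem measurable_integral_posPart (v : E d) (δ t : ℝ) :
    Measurable fun f : KernelSpace d => ∫ y in Metric.ball v δ, max (f.1 y - t) 0 := by
  have h1 : LipschitzWith 1 fun f : E d →₁[volume] ℝ =>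
      ∫ y in Metric.ball v δ, max (f y - t) 0 := by
    refine LipschitzWith.of_dist_le_mul fun f h => ?_
    rw [NNReal.coe_one, one_mul, Real.dist_eq, dist_eq_norm, L1.norm_eq_integral_norm]
    have hf := L1.integrable_coeFn f
    have hh := L1.integrable_coeFn h
    rw [← integral_sub (integrableOn_posPart hf v δ t) (integrableOn_posPart hh v δ t)]
    refine (abs_integral_le_integral_abs).trans ?_
    have h2 : ∫ y in Metric.ball v δ, |max (f y - t) 0 - max (h y - t) 0| ≤
        ∫ y in Metric.ball v δ, |f y - h y| := by
      refine integral_mono ?_ (hf.sub hh).abs.integrableOn fun y => ?_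
      · exact ((integrableOn_posPart hf v δ t).sub (integrableOn_posPart hh v δ t)).abs
      · refine (abs_max_sub_max_le_abs _ _ _).trans (le_of_eq ?_)
        congr 1
        ring
    refine h2.trans ((setIntegral_le_integral (hf.sub hh).abs
      (ae_of_all _ fun y => abs_nonneg _)).trans (le_of_eq ?_))
    refine integral_congr_ae ?_
    filter_upwards [Lp.coeFn_sub f h] with y hy
    rw [hy, Real.norm_eq_abs, Pi.sub_apply]
  let _ : TopologicalSpace (KernelSpace d) :=
    TopologicalSpace.induced KernelSpace.toL1 inferInstance
  have _ : BorelSpace (KernelSpace d) := ⟨rfl⟩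
  have h3 : Continuous fun f : KernelSpace d =>
      ∫ y in Metric.ball v δ, max (f.toL1 y - t) 0 :=
    h1.continuous.comp continuous_induced_dom
  have h4 : ∀ f : KernelSpace d, ∫ y in Metric.ball v δ, max (f.1 y - t) 0 =
      ∫ y in Metric.ball v δ, max (f.toL1 y - t) 0 := by
    intro f
    refine integral_congr_ae (ae_restrict_of_ae ?_)
    filter_upwards [f.2.1.coeFn_toL1] with y hy
    rw [KernelSpace.toL1, hy]
  simp_rw [h4]
  exact h3.measurable

/-- The kernel exceeds t somewhere in the ball exactly if the integral of its excess over t is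
positive. A single value of the kernel is not determined by the L¹ class in this way, which is why
suprema over balls are used. -/
theorem measurableSet_exists_lt (hg : IsKernelFamily g) (v : E d) (δ : ℝ) {t : ℝ} (ht : 0 ≤ t) :
    MeasurableSet {m | ∃ y ∈ Metric.ball v δ, t < (g m).1 y} := by
  have h : {m | ∃ y ∈ Metric.ball v δ, t < (g m).1 y} =
      {m | 0 < ∫ y in Metric.ball v δ, max ((g m).1 y - t) 0} := by
    ext m
    simp only [Set.mem_ofPred_eq]
    have hpos := setIntegral_pos_iff_support_of_nonneg_ae
      (f := fun y => max ((g m).1 y - t) 0) (s := Metric.ball v δ) (μ := volume)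
      (ae_of_all _ fun y => le_max_right _ _) (integrableOn_posPart (g m).2.1 v δ t)
    rw [hpos]
    have hs : Function.support (fun y => max ((g m).1 y - t) 0) = {y | t < (g m).1 y} := by
      ext y
      simp only [Function.mem_support, ne_eq, max_eq_right_iff, not_le, sub_pos,
        Set.mem_ofPred_eq]
    rw [hs]
    constructor
    · rintro ⟨y, hy, hty⟩
      rw [Set.inter_comm]
      exact volume_inter_superlevel_pos hg m Metric.isOpen_ball ht hy hty
    · intro h
      obtain ⟨y, hy1, hy2⟩ := nonempty_of_measure_ne_zero h.ne'
      exact ⟨y, hy2, hy1⟩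
  rw [h]
  exact measurableSet_lt measurable_const ((measurable_integral_posPart v δ t).comp hg.measurable)

/-- The supremum of a kernel function over a ball. -/
def supKern (g : 𝕄 → KernelSpace d) (δ : ℝ) (m : 𝕄) (v : E d) : ℝ≥0∞ :=
  ⨆ y ∈ Metric.ball v δ, ENNReal.ofReal ((g m).1 y)

theorem lt_supKern_iff {δ : ℝ} {m : 𝕄} {v : E d} {t : ℝ≥0∞} :
    t < supKern g δ m v ↔ ∃ y ∈ Metric.ball v δ, t < ENNReal.ofReal ((g m).1 y) := by
  simp [supKern, lt_iSup_iff]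

theorem le_supKern {δ : ℝ} {m : 𝕄} {v y : E d} (hy : y ∈ Metric.ball v δ) :
    ENNReal.ofReal ((g m).1 y) ≤ supKern g δ m v :=
  le_iSup₂ (f := fun y _ => ENNReal.ofReal ((g m).1 y)) y hy

/-- A ball from a countable family contains y and lies within distance ε of y. This replaces
uncountable unions by countable ones. -/
theorem exists_denseSeq_ball (y : E d) {ε : ℝ} (hε : 0 < ε) : ∃ i k : ℕ,
    dist y (TopologicalSpace.denseSeq (E d) i) < 1 / (k + 1) ∧ 2 * (1 / ((k : ℝ) + 1)) < ε := by
  obtain ⟨k, hk⟩ := exists_nat_one_div_lt (half_pos hε)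
  obtain ⟨i, hi⟩ := (TopologicalSpace.denseRange_denseSeq (E d)).exists_dist_lt y
    (Nat.one_div_pos_of_nat (n := k) (α := ℝ))
  exact ⟨i, k, hi, by linarith⟩

theorem measurable_supKern (hg : IsKernelFamily g) (δ : ℝ) :
    Measurable fun p : 𝕄 × E d => supKern g δ p.1 p.2 := by
  refine measurable_of_Ioi fun t => ?_
  rcases eq_or_ne t ⊤ with rfl | ht
  · simp
  lift t to ℝ≥0 using ht
  have h : (fun p : 𝕄 × E d => supKern g δ p.1 p.2) ⁻¹' Set.Ioi (t : ℝ≥0∞) =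
      ⋃ (i : ℕ) (k : ℕ), {m | ∃ y ∈ Metric.ball (TopologicalSpace.denseSeq (E d) i)
        (1 / ((k : ℝ) + 1)), (t : ℝ) < (g m).1 y} ×ˢ
        {v | dist (TopologicalSpace.denseSeq (E d) i) v + 1 / ((k : ℝ) + 1) ≤ δ} := by
    ext ⟨m, v⟩
    simp only [Set.mem_preimage, Set.mem_Ioi, lt_supKern_iff, Set.mem_iUnion, Set.mem_prod,
      Set.mem_ofPred_eq, ENNReal.coe_lt_ofReal]
    constructor
    · rintro ⟨y, hy, hty⟩
      have hy' := Metric.mem_ball.mp hy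
      obtain ⟨i, k, hi, hk⟩ := exists_denseSeq_ball y (sub_pos.mpr hy')
      refine ⟨i, k, ⟨y, hi, hty⟩, ?_⟩
      have := dist_triangle_left (TopologicalSpace.denseSeq (E d) i) v y
      linarith
    · rintro ⟨i, k, ⟨y, hy, hty⟩, hv⟩
      refine ⟨y, ?_, hty⟩
      have h1 := Metric.mem_ball.mp hy
      have := dist_triangle y (TopologicalSpace.denseSeq (E d) i) v
      rw [Metric.mem_ball]
      linarith
  rw [h]
  refine MeasurableSet.iUnion fun i => MeasurableSet.iUnion fun k => ?_
  refine (measurableSet_exists_lt hg _ _ t.2).prod ?_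
  exact measurableSet_le (by fun_prop) measurable_const

/-- Upper semicontinuity: the kernel is continuous on its closed support and vanishes off it, where
a nonnegative function can only drop. -/
theorem exists_ball_lt (f : KernelSpace d) (hf : ∀ y, 0 ≤ f.1 y) {y : E d} {c : ℝ}
    (hc : f.1 y < c) : ∃ r > 0, ∀ z ∈ Metric.ball y r, f.1 z < c := by
  have h1 : ∀ᶠ z in 𝓝 y, z ∈ f.supp → f.1 z < c := by
    by_cases hy : y ∈ f.supp
    · exact eventually_nhdsWithin_iff.mp ((f.2.2.2 y hy).eventually (gt_mem_nhds hc))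
    · filter_upwards [(isClosed_tsupport f.1).isOpen_compl.mem_nhds hy] with z hz hz'
      exact absurd hz' hz
  obtain ⟨r, hr, h⟩ := Metric.eventually_nhds_iff_ball.mp h1
  refine ⟨r, hr, fun z hz => ?_⟩
  by_cases hzK : z ∈ f.supp
  · exact h z hz hzK
  · have : f.1 z = 0 := image_eq_zero_of_notMem_tsupport hzK
    rw [this]
    exact (hf y).trans_lt hc

/-- An upper semicontinuous function is the infimum of its suprema over shrinking balls. Joint
measurability of the kernel follows from that of `supKern`. -/
theorem ofReal_kernel_eq_iInf (hg : IsKernelFamily g) (m : 𝕄) (v : E d) :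
    ENNReal.ofReal ((g m).1 v) = ⨅ n : ℕ, supKern g (1 / ((n : ℝ) + 1)) m v := by
  refine le_antisymm (le_iInf fun n => le_supKern (Metric.mem_ball_self (by positivity))) ?_
  refine le_of_forall_gt fun c hc => ?_
  rcases eq_or_ne c ⊤ with rfl | hct
  · obtain ⟨r, hr, h⟩ := exists_ball_lt (g m) (hg.nonneg m) (lt_add_one ((g m).1 v))
    obtain ⟨n, hn⟩ := exists_nat_one_div_lt hr
    refine (iInf_le _ n).trans_lt (lt_of_le_of_lt (iSup₂_le fun z hz => ?_)
      (ENNReal.ofReal_lt_top (r := (g m).1 v + 1)))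
    exact ENNReal.ofReal_le_ofReal (h z (Metric.ball_subset_ball hn.le hz)).le
  · obtain ⟨c', hc1, hc2⟩ := exists_between hc
    have hc't : c' ≠ ⊤ := (hc2.trans_le le_top).ne
    lift c' to ℝ≥0 using hc't
    rw [ENNReal.ofReal_lt_coe_iff (hg.nonneg m v)] at hc1
    obtain ⟨r, hr, h⟩ := exists_ball_lt (g m) (hg.nonneg m) hc1
    obtain ⟨n, hn⟩ := exists_nat_one_div_lt hr
    refine (iInf_le _ n).trans_lt (lt_of_le_of_lt (iSup₂_le fun z hz => ?_) hc2)
    exact ENNReal.ofReal_le_of_le_toReal (h z (Metric.ball_subset_ball hn.le hz)).le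

theorem measurable_kernel (hg : IsKernelFamily g) :
    Measurable fun p : 𝕄 × E d => ENNReal.ofReal ((g p.1).1 p.2) := by
  simp_rw [ofReal_kernel_eq_iInf hg]
  exact Measurable.iInf fun n => measurable_supKern hg _

theorem measurable_ofReal_kern (hg : IsKernelFamily g) (y : E d) :
    Measurable fun p : E d × 𝕄 => ENNReal.ofReal ((g p.2).1 (y - p.1)) :=
  (measurable_kernel hg).comp (measurable_snd.prodMk (measurable_const.sub measurable_fst))

theorem measurable_supKern_sub (hg : IsKernelFamily g) (δ : ℝ) (y : E d) :
    Measurable fun p : E d × 𝕄 => supKern g δ p.2 (y - p.1) := by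
  have h : Measurable fun p : E d × 𝕄 => ((p.2, y - p.1) : 𝕄 × E d) :=
    measurable_snd.prodMk (measurable_const.sub measurable_fst)
  simpa [Function.comp_def] using (measurable_supKern hg δ).comp h

/-- An open set that meets the closure of {g > 0} meets {g > 0} itself. -/
theorem inter_nonempty_iff_exists_pos (hg : IsKernelFamily g) {p : E d × 𝕄} {U : Set (E d)}
    (hU : IsOpen U) : (pointSupp g p ∩ U).Nonempty ↔ ∃ y ∈ U, 0 < (g p.2).1 (y - p.1) := by
  constructor
  · rintro ⟨y, hy, hyU⟩
    rw [mem_pointSupp] at hy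
    have h1 : IsOpen {z | z + p.1 ∈ U} := hU.preimage (by fun_prop)
    obtain ⟨z, hz, hz'⟩ := mem_closure_iff.mp hy _ h1 (by simpa using hyU)
    refine ⟨z + p.1, hz, ?_⟩
    rw [add_sub_cancel_right]
    exact lt_of_le_of_ne (hg.nonneg _ _) (Ne.symm hz')
  · rintro ⟨y, hyU, hy⟩
    exact ⟨y, mem_pointSupp.mpr (mem_supp_of_pos hy), hyU⟩

theorem measurableSet_hits (hg : IsKernelFamily g) {U : Set (E d)} (hU : IsOpen U) :
    MeasurableSet {p : E d × 𝕄 | (pointSupp g p ∩ U).Nonempty} := by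
  have h : {p : E d × 𝕄 | (pointSupp g p ∩ U).Nonempty} =
      ⋃ (i : ℕ) (k : ℕ) (_ : Metric.ball (TopologicalSpace.denseSeq (E d) i)
        (1 / ((k : ℝ) + 1)) ⊆ U), {p | 0 < supKern g (1 / ((k : ℝ) + 1)) p.2
          (TopologicalSpace.denseSeq (E d) i - p.1)} := by
    ext p
    simp only [Set.mem_ofPred_eq, inter_nonempty_iff_exists_pos hg hU, Set.mem_iUnion,
      lt_supKern_iff, ENNReal.ofReal_pos, exists_prop]
    constructor
    · rintro ⟨y, hyU, hy⟩
      obtain ⟨ε, hε, hball⟩ := Metric.isOpen_iff.mp hU y hyU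
      obtain ⟨i, k, hi, hk⟩ := exists_denseSeq_ball y hε
      refine ⟨i, k, fun z hz => hball ?_, y - p.1, ?_, hy⟩
      · rw [Metric.mem_ball] at hz ⊢
        have := dist_triangle_right z y (TopologicalSpace.denseSeq (E d) i)
        linarith
      · rwa [Metric.mem_ball, dist_sub_right]
    · rintro ⟨i, k, hsub, y, hy, hpos⟩
      refine ⟨y + p.1, hsub ?_, by rwa [add_sub_cancel_right]⟩
      rw [Metric.mem_ball] at hy ⊢
      rwa [← dist_add_right _ _ p.1, sub_add_cancel] at hy
  rw [h]
  refine MeasurableSet.iUnion fun i => MeasurableSet.iUnion fun k => MeasurableSet.iUnion fun _ => ?_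
  exact measurableSet_lt measurable_const (measurable_supKern_sub hg _ _)

theorem lintegral_ofTuple {n : ℕ} (x : Fin n → E d × 𝕄) {f : E d × 𝕄 → ℝ≥0∞}
    (hf : Measurable f) : ∫⁻ p, f p ∂(ofTuple x).1 = ∑ i, f (x i) := by
  rw [coe_ofTuple, lintegral_finsetSum_measure]
  simp_rw [lintegral_dirac' _ hf]

theorem excursionSet_ofTuple (hg : IsKernelFamily g) (u : ℝ) {n : ℕ} (x : Fin n → E d × 𝕄) :
    excursionSet g u (ofTuple x).1 = finExcursion g u x Finset.univ := by
  ext y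
  simp only [excursionSet, finExcursion, Set.mem_ofPred_eq, shotNoise,
    lintegral_ofTuple x (measurable_ofReal_kern hg y)]
  rw [← ENNReal.ofReal_sum_of_nonneg fun i _ => hg.nonneg _ _,
    ENNReal.ofReal_le_ofReal_iff (Finset.sum_nonneg fun i _ => hg.nonneg _ _)]
  rfl

theorem isPolyconvex_excursionSet_inter (hg : IsKernelFamily g) (u : ℝ) {W : Set (E d)}
    (hW : IsCompactConvex W) (μ : Conf (E d × 𝕄)) :
    IsPolyconvex (excursionSet g u μ.1 ∩ W) := by
  obtain ⟨n, x, rfl⟩ := μ.exists_eq_ofTuple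
  rw [excursionSet_ofTuple hg]
  exact isPolyconvex_finExcursion_inter hg u hW x _

/-- Points where the smoothed fields reach u accumulate in C. Upper semicontinuity of the finitely
many kernels gives the field a value of at least u at the accumulation point. -/
theorem excursionSet_inter_nonempty_of_forall (hg : IsKernelFamily g) (u : ℝ) {C : Set (E d)}
    (hC : IsCompact C) (μ : Conf (E d × 𝕄))
    (h : ∀ n : ℕ, ∃ y ∈ C, ENNReal.ofReal u ≤
      ∫⁻ p, supKern g (1 / ((n : ℝ) + 1)) p.2 (y - p.1) ∂μ.1) :
    (excursionSet g u μ.1 ∩ C).Nonempty := by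
  obtain ⟨N, x, rfl⟩ := μ.exists_eq_ofTuple
  rw [excursionSet_ofTuple hg]
  choose y hyC hy using h
  obtain ⟨a, haC, ψ, hψ, hlim⟩ := hC.tendsto_subseq hyC
  refine ⟨a, ?_, haC⟩
  by_contra hcon
  simp only [finExcursion, Set.mem_ofPred_eq, not_le] at hcon
  -- The gap below u is shared among the N points; the denominator N + 1 also covers N = 0.
  obtain ⟨ε, hε, hε'⟩ : ∃ ε > 0, (∑ i, kern g (x i) a) + N * ε < u := by
    refine ⟨(u - ∑ i, kern g (x i) a) / (N + 1), div_pos (sub_pos.mpr hcon) (by positivity), ?_⟩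
    have h1 : (N : ℝ) * ((u - ∑ i, kern g (x i) a) / (N + 1)) < u - ∑ i, kern g (x i) a := by
      rw [← mul_div_assoc, div_lt_iff₀ (by positivity)]
      nlinarith [sub_pos.mpr hcon]
    linarith
  have h1 : ∀ i, ∀ᶠ n in atTop, supKern g (1 / ((ψ n : ℝ) + 1)) (x i).2 (y (ψ n) - (x i).1) ≤
      ENNReal.ofReal (kern g (x i) a + ε) := by
    intro i
    obtain ⟨r, hr, hball⟩ := exists_ball_lt (g (x i).2) (hg.nonneg _)
      (lt_add_of_pos_right ((g (x i).2).1 (a - (x i).1)) hε)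
    have h2 : ∀ᶠ n in atTop, dist (y (ψ n)) a < r / 2 :=
      (Metric.tendsto_nhds.mp hlim) _ (half_pos hr)
    have h3 : ∀ᶠ n in atTop, 1 / ((ψ n : ℝ) + 1) < r / 2 :=
      hψ.tendsto_atTop.eventually (tendsto_one_div_add_atTop_nhds_zero_nat.eventually
        (gt_mem_nhds (half_pos hr)))
    filter_upwards [h2, h3] with n hn2 hn3
    refine iSup₂_le fun z hz => ENNReal.ofReal_le_ofReal (hball z ?_).le
    rw [Metric.mem_ball] at hz ⊢
    have h4 := dist_triangle z (y (ψ n) - (x i).1) (a - (x i).1)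
    rw [dist_sub_right] at h4
    linarith
  obtain ⟨n, hn⟩ := (eventually_all.mpr h1).exists
  have h2 := hy (ψ n)
  rw [lintegral_ofTuple x (measurable_supKern_sub hg _ _)] at h2
  have h3 := h2.trans (Finset.sum_le_sum fun i _ => hn i)
  rw [← ENNReal.ofReal_sum_of_nonneg fun i _ => add_nonneg (kern_nonneg hg _ _) hε.le,
    Finset.sum_add_distrib, Finset.sum_const, Finset.card_univ, Fintype.card_fin, nsmul_eq_mul,
    ENNReal.ofReal_le_ofReal_iff (add_nonneg (Finset.sum_nonneg fun i _ => kern_nonneg hg _ _)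
      (by positivity))] at h3
  linarith

/-- A supremum over a ball survives a small change of its centre, so a countable dense subset of C
suffices at each scale. -/
theorem measurableSet_excursionSet_inter_nonempty (hg : IsKernelFamily g) (u : ℝ) {C : Set (E d)}
    (hC : IsCompact C) :
    MeasurableSet {μ : Conf (E d × 𝕄) | (excursionSet g u μ.1 ∩ C).Nonempty} := by
  obtain ⟨s, hs, hsd⟩ := TopologicalSpace.exists_countable_dense C
  have h : {μ : Conf (E d × 𝕄) | (excursionSet g u μ.1 ∩ C).Nonempty} =
      ⋂ n : ℕ, ⋃ y ∈ s, {μ | ENNReal.ofReal u ≤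
        ∫⁻ p, supKern g (1 / ((n : ℝ) + 1)) p.2 (y.1 - p.1) ∂μ.1} := by
    ext μ
    simp only [Set.mem_ofPred_eq, Set.mem_iInter, Set.mem_iUnion, exists_prop]
    constructor
    · rintro ⟨y, hy, hyC⟩ n
      obtain ⟨z, hz, hzs⟩ := hsd.exists_dist_lt ⟨y, hyC⟩
        (Nat.one_div_pos_of_nat (n := n) (α := ℝ))
      refine ⟨z, hz, le_trans hy (lintegral_mono fun p => le_supKern ?_)⟩
      rw [Metric.mem_ball, dist_sub_right]
      exact hzs
    · intro h
      refine excursionSet_inter_nonempty_of_forall hg u hC μ fun n => ?_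
      obtain ⟨y, -, hy⟩ := h n
      exact ⟨y.1, y.2, hy⟩
  rw [h]
  refine MeasurableSet.iInter fun n => MeasurableSet.biUnion hs fun y _ => ?_
  exact measurableSet_le measurable_const
    ((Measure.measurable_lintegral (measurable_supKern_sub hg _ _)).comp measurable_subtype_coe)

/-- The value of a functional on the part of the excursion set in a window. -/
def windowFun (φ : Set (E d) → ℝ) (g : 𝕄 → KernelSpace d) (u : ℝ) (W : Set (E d))
    (μ : Measure (E d × 𝕄)) : ℝ := φ (excursionSet g u μ ∩ W)

/-- The part of the excursion set in a window, as an element of the convex ring. -/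
def excursionRing (hg : IsKernelFamily g) (u : ℝ) {W : Set (E d)} (hW : IsCompactConvex W)
    (μ : Conf (E d × 𝕄)) : ConvexRing d :=
  ⟨excursionSet g u μ.1 ∩ W, isPolyconvex_excursionSet_inter hg u hW μ⟩

theorem measurable_windowFun (hg : IsKernelFamily g) (u : ℝ) {φ : Set (E d) → ℝ}
    (hφ : IsGeometricFunctional φ) {W : Set (E d)} (hW : IsCompactConvex W) :
    Measurable fun μ : Conf (E d × 𝕄) => windowFun φ g u W μ.1 := by
  have h : Measurable (excursionRing hg u hW) := by
    refine measurable_generateFrom ?_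
    rintro _ ⟨U, hU, rfl⟩
    -- An open set is a countable union of closed sets, so hitting U reduces to hitting the compact
    -- sets W ∩ F n.
    obtain ⟨F, hF, -, hFU, -⟩ := hU.exists_iUnion_isClosed
    have h1 : excursionRing hg u hW ⁻¹' {A | (A.1 ∩ U).Nonempty} =
        ⋃ n, {μ | (excursionSet g u μ.1 ∩ (W ∩ F n)).Nonempty} := by
      ext μ
      change (excursionSet g u μ.1 ∩ W ∩ U).Nonempty ↔ _
      rw [← hFU, Set.inter_iUnion, Set.nonempty_iUnion]
      simp_rw [Set.inter_assoc]
      simp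
    rw [h1]
    exact MeasurableSet.iUnion fun n =>
      measurableSet_excursionSet_inter_nonempty hg u (hW.1.inter_right (hF n))
  exact hφ.measurable.comp h

end Measurability

/-! ### Volumes of parallel bodies and numbers of lattice cubes -/

section Moments

set_option linter.unusedSectionVars false

variable {d : ℕ}

theorem volume_setOf_forall_Ico (a b : Fin d → ℝ) :
    volume {y : E d | ∀ i, a i ≤ y i ∧ y i < b i} = ∏ i, ENNReal.ofReal (b i - a i) := by
  rw [← Real.volume_pi_Ico, ← (PiLp.volume_preserving_ofLp (Fin d)).measure_preimage
    (MeasurableSet.univ_pi fun i => measurableSet_Ico).nullMeasurableSet]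
  congr 1
  ext y
  simp

theorem volume_setOf_forall_Icc (a b : Fin d → ℝ) :
    volume {y : E d | ∀ i, a i ≤ y i ∧ y i ≤ b i} = ∏ i, ENNReal.ofReal (b i - a i) := by
  rw [← Real.volume_Icc_pi, ← (PiLp.volume_preserving_ofLp (Fin d)).measure_preimage
    measurableSet_Icc.nullMeasurableSet]
  congr 1
  ext y
  simp [Pi.le_def, forall_and]

theorem volume_latticeCube (z : Fin d → ℤ) :
    volume (latticeCube z) = ENNReal.ofReal (side d) ^ d := by
  rw [latticeCube, volume_setOf_forall_Ico]
  have : ∀ i, ((z i : ℝ) + 1) * side d - z i * side d = side d := fun i => by ring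
  simp [this]

theorem measurableSet_latticeCube (z : Fin d → ℤ) : MeasurableSet (latticeCube z) := by
  have : latticeCube z = ⋂ i, {y : E d | (z i : ℝ) * side d ≤ y i ∧ y i < (z i + 1) * side d} := by
    ext y
    simp [latticeCube]
  rw [this]
  refine MeasurableSet.iInter fun i => ?_
  have hm : Measurable fun y : E d => y i := by fun_prop
  exact (measurableSet_le measurable_const hm).inter (measurableSet_lt hm measurable_const)

theorem latticeCube_nonempty (z : Fin d → ℤ) : (latticeCube z).Nonempty := by
  have hs := side_pos d
  refine ⟨WithLp.toLp 2 fun i => (z i : ℝ) * side d, fun i => ?_⟩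
  constructor
  · exact le_rfl
  · change (z i : ℝ) * side d < _
    nlinarith

open Classical in
/-- The indicator that a set hits the neighbourhood of a lattice cube. -/
def hit (A : Set (E d)) (z : Fin d → ℤ) : ℝ≥0∞ := if (A ∩ nhdCube z).Nonempty then 1 else 0

/-- The number of lattice cubes whose neighbourhoods hit a set. -/
def cubes (A : Set (E d)) : ℝ≥0∞ := ∑' z, hit A z

theorem hit_mono {A B : Set (E d)} (h : A ⊆ B) (z : Fin d → ℤ) : hit A z ≤ hit B z := by
  unfold hit
  split_ifs with h1 h2
  · exact le_rfl
  · exact absurd (h1.mono (Set.inter_subset_inter_left _ h)) h2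
  · exact zero_le
  · exact le_rfl

theorem cubes_mono {A B : Set (E d)} (h : A ⊆ B) : cubes A ≤ cubes B :=
  ENNReal.tsum_le_tsum fun z => hit_mono h z

theorem cubes_eq_card {A : Set (E d)} (hA : Bornology.IsBounded A) :
    cubes A = (finite_setOf_inter_nhdCube hA).toFinset.card := by
  rw [cubes, tsum_eq_sum (s := (finite_setOf_inter_nhdCube hA).toFinset)]
  · rw [Finset.sum_congr rfl (g := fun _ => 1), Finset.sum_const, nsmul_one]
    intro z hz
    rw [hit, if_pos (by simpa using hz)]
  · intro z hz
    rw [hit, if_neg (by simpa using hz)]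

theorem cubes_ne_top {A : Set (E d)} (hA : Bornology.IsBounded A) : cubes A ≠ ⊤ := by
  rw [cubes_eq_card hA]
  exact ENNReal.natCast_ne_top _

/-- The counted cubes are disjoint, and each lies within distance 1 of A since its neighbourhood has
diameter at most 1. -/
theorem cubes_mul_le (A : Set (E d)) :
    cubes A * ENNReal.ofReal (side d) ^ d ≤ volume (Metric.cthickening 1 A) := by
  classical
  set T := {z : Fin d → ℤ | (A ∩ nhdCube z).Nonempty} with hT
  have h1 : cubes A * ENNReal.ofReal (side d) ^ d = volume (⋃ z ∈ T, latticeCube z) := by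
    rw [measure_biUnion (Set.to_countable T) (fun z _ z' _ h => disjoint_latticeCube h)
      fun z _ => measurableSet_latticeCube z, cubes, ← ENNReal.tsum_mul_right,
      tsum_subtype T fun z => volume (latticeCube z)]
    refine tsum_congr fun z => ?_
    by_cases hz : z ∈ T
    · rw [Set.indicator_of_mem hz, volume_latticeCube, hit,
        if_pos (show (A ∩ nhdCube z).Nonempty from hz), one_mul]
    · rw [Set.indicator_of_notMem hz, hit,
        if_neg (show ¬ (A ∩ nhdCube z).Nonempty from hz), zero_mul]
  rw [h1]
  refine measure_mono (Set.iUnion₂_subset fun z hz y hy => ?_)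
  obtain ⟨a, ha, haz⟩ := hz
  exact Metric.mem_cthickening_of_dist_le y a 1 A ha
    (dist_le_one_of_mem_nhdCube (latticeCube_subset_nhdCube z hy) haz)

/-- For a fixed point c of the cube, a translate by x that hits the neighbourhood has c - x within
distance 1 of A. Reflection and translation preserve volume. -/
theorem volume_setOf_hits_le (A : Set (E d)) (z : Fin d → ℤ) :
    volume {x : E d | (translate x A ∩ nhdCube z).Nonempty} ≤
      volume (Metric.cthickening 1 A) := by
  obtain ⟨c, hc⟩ := latticeCube_nonempty z
  have hc' := latticeCube_subset_nhdCube z hc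
  have hmp : MeasurePreserving (fun x : E d => c - x) volume volume :=
    Measure.measurePreserving_sub_left volume c
  rw [← hmp.measure_preimage Metric.isClosed_cthickening.measurableSet.nullMeasurableSet]
  refine measure_mono fun x hx => ?_
  obtain ⟨y, hy, hyz⟩ := hx
  rw [mem_translate] at hy
  rw [Set.mem_preimage]
  refine Metric.mem_cthickening_of_dist_le _ _ 1 A hy ?_
  rw [dist_sub_right]
  exact dist_le_one_of_mem_nhdCube hc' hyz

theorem eval_steinerPolynomial (K : Set (E d)) {j : ℕ} (hj : j < d) :
    (steinerPolynomial K).eval (j : ℝ) = parallelVolume K j := by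
  rw [steinerPolynomial, eval_add, Lagrange.eval_interpolate_at_node]
  · simp
  · exact fun a _ b _ hab => Nat.cast_injective hab
  · exact Finset.mem_range.mpr hj

theorem eval_steinerPolynomial_eq_sum {K : Set (E d)} (hK : K.Nonempty) (t : ℝ) :
    (steinerPolynomial K).eval t = ballVolume d * t ^ d +
      ∑ k ∈ Finset.range d, ballVolume k * intrinsicVolume (d - k) K * t ^ k := by
  set L := Lagrange.interpolate (Finset.range d) (fun j : ℕ => (j : ℝ))
      (fun j : ℕ => parallelVolume K j - ballVolume d * convexEuler K * (j : ℝ) ^ d) with hL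
  have hdeg : L.degree < (d : WithBot ℕ) := by
    have := Lagrange.degree_interpolate_lt (s := Finset.range d) (v := fun j : ℕ => (j : ℝ))
      (fun j : ℕ => parallelVolume K j - ballVolume d * convexEuler K * (j : ℝ) ^ d)
      (fun a _ b _ hab => Nat.cast_injective hab)
    rwa [Finset.card_range] at this
  have hχ : convexEuler K = 1 := by simp [convexEuler, hK]
  have hS : steinerPolynomial K = C (ballVolume d) * X ^ d + L := by
    rw [steinerPolynomial, hL, hχ, mul_one]
  have hcoeff : ∀ k ∈ Finset.range d, ballVolume k * intrinsicVolume (d - k) K = L.coeff k := by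
    intro k hk
    have hk' := Finset.mem_range.mp hk
    rw [intrinsicVolume, Nat.sub_sub_self hk'.le, hS, coeff_add, coeff_C_mul_X_pow,
      if_neg hk'.ne, zero_add, mul_div_cancel₀ _ (ballVolume_pos k).ne']
  rw [Finset.sum_congr rfl fun k hk => by rw [hcoeff k hk], hS, eval_add, eval_mul, eval_C,
    eval_pow, eval_X]
  congr 1
  by_cases h0 : L = 0
  · simp [h0]
  · exact eval_eq_sum_range' ((natDegree_lt_iff_degree_lt h0).mpr hdeg) t

/-- In dimension one the radius 1 is not an interpolation node of the Steiner polynomial, so the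
parallel body is computed directly as an interval. -/
theorem parallelVolume_one_le_of_dim_one {K : Set (E 1)} (hK : IsCompactConvex K)
    (hne : K.Nonempty) : parallelVolume K 1 ≤ parallelVolume K 0 + 2 := by
  set I : Set ℝ := (fun y : E 1 => y 0) '' K with hI
  have hIc : IsCompact I := hK.1.image (by fun_prop)
  have hIconn : IsConnected I := (hK.2.isConnected hne).image _ (by fun_prop : Continuous _).continuousOn
  have hIeq := eq_Icc_of_connected_compact hIconn hIc
  set a := sInf I
  set b := sSup I
  have hab : a ≤ b := by
    rw [← Set.nonempty_Icc, ← hIeq]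
    exact hne.image _
  have hKeq : K = {y : E 1 | ∀ i : Fin 1, a ≤ y i ∧ y i ≤ b} := by
    ext y
    have h1 : y ∈ K ↔ y 0 ∈ I := by
      constructor
      · exact fun h => ⟨y, h, rfl⟩
      · rintro ⟨z, hz, hzy⟩
        have : z = y := by
          ext i
          rw [Subsingleton.elim i 0]
          exact hzy
        rwa [← this]
    rw [h1, hIeq]
    simp
  have h0 : volume (Metric.cthickening 0 K) = ENNReal.ofReal (b - a) := by
    rw [Metric.cthickening_zero, hK.1.isClosed.closure_eq, hKeq,
      volume_setOf_forall_Icc (fun _ => a) fun _ => b]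
    simp
  have h1 : volume (Metric.cthickening 1 K) ≤ ENNReal.ofReal (b + 1 - (a - 1)) := by
    have : Metric.cthickening 1 K ⊆ {y : E 1 | ∀ i : Fin 1, a - 1 ≤ y i ∧ y i ≤ b + 1} := by
      intro y hy i
      rw [hK.1.cthickening_eq_biUnion_closedBall zero_le_one, Set.mem_iUnion₂] at hy
      obtain ⟨k, hk, hyk⟩ := hy
      have h2 : |y i - k i| ≤ 1 := by
        have := PiLp.norm_apply_le (y - k) i
        rw [Metric.mem_closedBall, dist_eq_norm] at hyk
        exact this.trans hyk
      rw [hKeq] at hk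
      have h3 := hk i
      have h4 := abs_le.mp h2
      constructor <;> linarith [h3.1, h3.2, h4.1, h4.2]
    refine (measure_mono this).trans ?_
    rw [volume_setOf_forall_Icc (fun _ => a - 1) fun _ => b + 1]
    simp
  rw [parallelVolume, parallelVolume, measureReal_def, measureReal_def, h0,
    ENNReal.toReal_ofReal (by linarith)]
  refine (ENNReal.toReal_mono ENNReal.ofReal_ne_top h1).trans ?_
  rw [ENNReal.toReal_ofReal (by linarith)]
  linarith

/-- The volume of the parallel body is bounded by the intrinsic volumes. -/
theorem exists_parallelVolume_one_le (hd : 1 ≤ d) : ∃ c : ℝ, 0 ≤ c ∧ ∀ K : Set (E d),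
    IsCompactConvex K → K.Nonempty →
      parallelVolume K 1 ≤ c * (1 + ∑ i ∈ Finset.Icc 1 d, |intrinsicVolume i K|) := by
  set S := ∑ k ∈ Finset.range (d + 1), ballVolume k with hS
  have hS0 : 0 ≤ S := Finset.sum_nonneg fun k _ => (ballVolume_pos k).le
  have hle : ∀ k ≤ d, ballVolume k ≤ S := fun k hk =>
    Finset.single_le_sum (f := ballVolume) (fun k _ => (ballVolume_pos k).le)
      (Finset.mem_range.mpr (Nat.lt_succ_of_le hk))
  have key : ∀ (K : Set (E d)) (t : ℝ), K.Nonempty → 0 ≤ t → t ≤ 1 →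
      (steinerPolynomial K).eval t ≤ S * (1 + ∑ i ∈ Finset.Icc 1 d, |intrinsicVolume i K|) := by
    intro K t hK ht0 ht1
    rw [eval_steinerPolynomial_eq_sum hK, mul_add, mul_one, Finset.mul_sum]
    refine add_le_add ?_ ?_
    · calc ballVolume d * t ^ d ≤ S * 1 := mul_le_mul (hle d le_rfl) (pow_le_one₀ ht0 ht1)
            (by positivity) hS0
        _ = S := mul_one S
    · have h1 : ∑ i ∈ Finset.Icc 1 d, S * |intrinsicVolume i K| =
          ∑ k ∈ Finset.range d, S * |intrinsicVolume (d - k) K| := by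
        refine Finset.sum_nbij' (fun i => d - i) (fun k => d - k) ?_ ?_ ?_ ?_ ?_
        · intro i hi
          simp only [Finset.mem_Icc, Finset.mem_range] at hi ⊢
          omega
        · intro k hk
          simp only [Finset.mem_Icc, Finset.mem_range] at hk ⊢
          omega
        · intro i hi
          simp only [Finset.mem_Icc] at hi
          omega
        · intro k hk
          simp only [Finset.mem_range] at hk
          omega
        · intro i hi
          simp only [Finset.mem_Icc] at hi
          rw [Nat.sub_sub_self hi.2]
      rw [h1]
      refine Finset.sum_le_sum fun k hk => ?_
      have hk' := (Finset.mem_range.mp hk).le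
      calc ballVolume k * intrinsicVolume (d - k) K * t ^ k
          ≤ |ballVolume k * intrinsicVolume (d - k) K * t ^ k| := le_abs_self _
        _ = ballVolume k * |intrinsicVolume (d - k) K| * t ^ k := by
            rw [abs_mul, abs_mul, abs_of_pos (ballVolume_pos k), abs_of_nonneg (pow_nonneg ht0 k)]
        _ ≤ ballVolume k * |intrinsicVolume (d - k) K| * 1 :=
            mul_le_mul_of_nonneg_left (pow_le_one₀ ht0 ht1)
              (mul_nonneg (ballVolume_pos k).le (abs_nonneg _))
        _ ≤ S * |intrinsicVolume (d - k) K| := by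
            rw [mul_one]
            exact mul_le_mul_of_nonneg_right (hle k hk') (abs_nonneg _)
  -- The interpolation nodes are 0, …, d - 1. For d ≥ 2 the radius 1 is among them, so the Steiner
  -- formula itself is not needed; for d = 1 only the radius 0 is.
  rcases Nat.lt_or_ge 1 d with h | h
  · refine ⟨S, hS0, fun K _ hne => ?_⟩
    have := key K 1 hne zero_le_one le_rfl
    have h2 := eval_steinerPolynomial K h
    rw [Nat.cast_one] at h2
    rwa [h2] at this
  · obtain rfl : d = 1 := le_antisymm h hd
    refine ⟨S + 2, by linarith, fun K hK hne => ?_⟩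
    have h1 := key K 0 hne le_rfl zero_le_one
    have h2 := eval_steinerPolynomial K (j := 0) one_pos
    rw [Nat.cast_zero] at h2
    rw [h2] at h1
    have h3 := parallelVolume_one_le_of_dim_one hK hne
    have h4 : 0 ≤ ∑ i ∈ Finset.Icc 1 1, |intrinsicVolume i K| :=
      Finset.sum_nonneg fun i _ => abs_nonneg _
    nlinarith

variable {𝕄 : Type*} [MeasurableSpace 𝕄] {g : 𝕄 → KernelSpace d}

theorem supp_nonempty (hg : IsKernelFamily g) (m : 𝕄) : (g m).supp.Nonempty :=
  nonempty_of_measure_ne_zero (hg.volume_supp_pos m).ne'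

theorem lintegral_sq_volume_cthickening_lt_top (hd : 1 ≤ d) (hg : IsKernelFamily g)
    (Q : Measure 𝕄) [IsProbabilityMeasure Q]
    (hmoment : ∀ i : ℕ, 1 ≤ i → i ≤ d →
      Integrable (fun m => intrinsicVolume i (g m).supp ^ 2) Q) :
    ∫⁻ m, volume (Metric.cthickening 1 (g m).supp) ^ 2 ∂Q < ⊤ := by
  obtain ⟨c, hc0, hc⟩ := exists_parallelVolume_one_le hd
  -- The factor d + 1 comes from the Cauchy-Schwarz inequality for the d + 1 summands 1, V₁, …, V_d.
  set G : 𝕄 → ℝ := fun m => c ^ 2 * ((d + 1 : ℝ) *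
    (1 + ∑ i ∈ Finset.Icc 1 d, intrinsicVolume i (g m).supp ^ 2)) with hG
  have hGint : Integrable G Q := by
    refine (((integrable_const _).add (integrable_finsetSum _ fun i hi => ?_)).const_mul _).const_mul _
    exact hmoment i (Finset.mem_Icc.mp hi).1 (Finset.mem_Icc.mp hi).2
  have hle : ∀ m, volume (Metric.cthickening 1 (g m).supp) ^ 2 ≤ ENNReal.ofReal (G m) := by
    intro m
    have hK : IsCompactConvex (g m).supp := (g m).2.2.1
    have h1 := hc _ hK (supp_nonempty hg m)
    have hfin : volume (Metric.cthickening 1 (g m).supp) ≠ ⊤ :=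
      hK.1.isBounded.cthickening.measure_lt_top.ne
    rw [← ofReal_measureReal hfin, ← ENNReal.ofReal_pow measureReal_nonneg]
    refine ENNReal.ofReal_le_ofReal ?_
    refine (pow_le_pow_left₀ measureReal_nonneg h1 2).trans ?_
    rw [mul_pow]
    refine mul_le_mul_of_nonneg_left ?_ (by positivity)
    have h2 := sq_sum_le_card_mul_sum_sq (s := Finset.insertNone (Finset.Icc 1 d))
      (f := fun o : Option ℕ => o.elim (1 : ℝ) fun i => |intrinsicVolume i (g m).supp|)
    rw [Finset.sum_insertNone, Finset.sum_insertNone, Finset.card_insertNone, Nat.card_Icc] at h2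
    simp only [Option.elim, sq_abs, one_pow, Nat.add_sub_cancel] at h2
    push_cast at h2
    exact h2
  refine (lintegral_mono hle).trans_lt ?_
  have h3 := hGint.2
  rwa [hasFiniteIntegral_iff_ofReal (ae_of_all _ fun m => by positivity)] at h3

theorem lintegral_sq_cubes_lt_top (hd : 1 ≤ d) (hg : IsKernelFamily g)
    (Q : Measure 𝕄) [IsProbabilityMeasure Q]
    (hmoment : ∀ i : ℕ, 1 ≤ i → i ≤ d →
      Integrable (fun m => intrinsicVolume i (g m).supp ^ 2) Q) :
    ∫⁻ m, cubes (g m).supp ^ 2 ∂Q < ⊤ := by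
  have h := lintegral_sq_volume_cthickening_lt_top hd hg Q hmoment
  set s := ENNReal.ofReal (side d) ^ d with hs
  have hs0 : s ≠ 0 := pow_ne_zero _ (by simpa using side_pos d)
  have hst : s ≠ ⊤ := ENNReal.pow_ne_top ENNReal.ofReal_ne_top
  have hle : ∀ m, cubes (g m).supp ^ 2 ≤
      s⁻¹ ^ 2 * volume (Metric.cthickening 1 (g m).supp) ^ 2 := by
    intro m
    rw [← mul_pow]
    refine pow_le_pow_left' ?_ 2
    rw [mul_comm, ← div_eq_mul_inv, ENNReal.le_div_iff_mul_le (Or.inl hs0) (Or.inl hst)]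
    exact cubes_mul_le _
  refine (lintegral_mono hle).trans_lt ?_
  rw [lintegral_const_mul' _ _ (ENNReal.pow_ne_top (ENNReal.inv_ne_top.mpr hs0))]
  exact ENNReal.mul_lt_top (ENNReal.pow_lt_top (ENNReal.inv_lt_top.mpr hs0.bot_lt)) h

/-- The marked points whose supports hit the neighbourhood of a lattice cube. -/
def hitSet (g : 𝕄 → KernelSpace d) (z : Fin d → ℤ) : Set (E d × 𝕄) :=
  {p | (pointSupp g p ∩ nhdCube z).Nonempty}

theorem measurableSet_hitSet (hg : IsKernelFamily g) (z : Fin d → ℤ) :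
    MeasurableSet (hitSet g z) :=
  measurableSet_hits hg (isOpen_nhdCube z)

/-- For a fixed mark the admissible locations have volume at most that of the parallel body,
whatever the cube. The bound κ is therefore uniform in z and needs only a first moment. -/
theorem exists_intensity_hitSet_le (hd : 1 ≤ d) (hg : IsKernelFamily g)
    (Q : Measure 𝕄) [IsProbabilityMeasure Q] (γ : ℝ≥0)
    (hmoment : ∀ i : ℕ, 1 ≤ i → i ≤ d →
      Integrable (fun m => intrinsicVolume i (g m).supp ^ 2) Q) :
    ∃ κ : ℝ≥0, ∀ z, intensity d γ Q (hitSet g z) ≤ κ := by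
  have h := lintegral_sq_volume_cthickening_lt_top hd hg Q hmoment
  have h1 : ∫⁻ m, volume (Metric.cthickening 1 (g m).supp) ∂Q < ⊤ := by
    have hle : ∀ m, volume (Metric.cthickening 1 (g m).supp) ≤
        1 + volume (Metric.cthickening 1 (g m).supp) ^ 2 := by
      intro m
      rcases le_total (volume (Metric.cthickening 1 (g m).supp)) 1 with h1 | h1
      · exact h1.trans le_self_add
      · refine le_trans ?_ le_add_self
        exact le_self_pow h1 two_ne_zero
    refine (lintegral_mono hle).trans_lt ?_
    rw [lintegral_add_left measurable_const]
    simpa using h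
  refine ⟨γ * (∫⁻ m, volume (Metric.cthickening 1 (g m).supp) ∂Q).toNNReal, fun z => ?_⟩
  rw [ENNReal.coe_mul, ENNReal.coe_toNNReal h1.ne, intensity, Measure.smul_apply,
    Measure.prod_apply_symm (measurableSet_hitSet hg z)]
  refine mul_le_mul' le_rfl (lintegral_mono fun m => ?_)
  exact volume_setOf_hits_le (g m).supp z

end Moments

/-! ### Expectations of functionals of a Poisson process with bounded range of dependence -/

section Localization

variable {X : Type*} [MeasurableSpace X]

theorem real_ofTuple {n : ℕ} (x : Fin n → X) {B : Set X} (hB : MeasurableSet B) :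
    (ofTuple x).1.real B = ∑ i, B.indicator (fun _ => (1 : ℝ)) (x i) := by
  rw [coe_ofTuple, measureReal_def, Measure.finsetSum_apply,
    ENNReal.toReal_sum fun i _ => measure_ne_top _ _]
  refine Finset.sum_congr rfl fun i _ => ?_
  rw [Measure.dirac_apply' _ hB]
  by_cases h : x i ∈ B <;> simp [h]

theorem measurable_real_apply {B : Set X} (hB : MeasurableSet B) :
    Measurable fun ξ : Conf X => ξ.1.real B :=
  ((Measure.measurable_coe hB).comp measurable_subtype_coe).ennreal_toReal

theorem integrable_rpow_apply (ρ : Measure X) [IsFiniteMeasure ρ] {B : Set X}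
    (hB : MeasurableSet B) {a : ℝ} (ha : 1 ≤ a) :
    Integrable (fun ξ : Conf X => a ^ ξ.1.real B) (poissonConf ρ) := by
  refine integrable_poissonConf ρ ((measurable_real_apply hB).const_pow a) (C := 1) (a := a)
    (by linarith) fun ξ => ?_
  rw [abs_of_nonneg (by positivity), one_mul]
  exact Real.rpow_le_rpow_of_exponent_le ha (measureReal_mono (Set.subset_univ _))

/-- The bound depends on ρ B only, not on the total mass of ρ. This keeps the later moment estimates
independent of the size of the window. -/
theorem integral_rpow_apply (ρ : Measure X) [IsFiniteMeasure ρ] {B : Set X}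
    (hB : MeasurableSet B) {a : ℝ} (ha : 1 ≤ a) :
    ∫ ξ : Conf X, a ^ ξ.1.real B ∂poissonConf ρ = Real.exp ((a - 1) * ρ.real B) := by
  have h := hasSum_integral_poissonConf ρ ((measurable_real_apply hB).const_pow a)
    (integrable_rpow_apply ρ hB ha)
  set t := ρ.real Set.univ + (a - 1) * ρ.real B with ht
  have h1 : ∫ x, a ^ B.indicator (fun _ => (1 : ℝ)) x ∂ρ = t := by
    have h2 : ∀ x, a ^ B.indicator (fun _ => (1 : ℝ)) x =
        1 + B.indicator (fun _ => a - 1) x := by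
      intro x
      by_cases hx : x ∈ B <;> simp [hx]
    simp_rw [h2]
    rw [integral_add (integrable_const _) ((integrable_const _).indicator hB),
      integral_indicator_const _ hB, integral_const, smul_eq_mul, smul_eq_mul, mul_one, ht]
    ring
  have h2 : ∀ n : ℕ, (n.factorial : ℝ)⁻¹ * ∫ x : Fin n → X, a ^ (ofTuple x).1.real B
      ∂(Measure.pi fun _ => ρ) = t ^ n / n.factorial := by
    intro n
    have h3 : ∀ x : Fin n → X, a ^ (ofTuple x).1.real B =
        ∏ i, a ^ B.indicator (fun _ => (1 : ℝ)) (x i) := by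
      intro x
      rw [real_ofTuple x hB, Real.rpow_sum_of_pos (by linarith)]
    simp_rw [h3]
    rw [integral_fintype_prod_eq_pow (μ := ρ) (fun x => a ^ B.indicator (fun _ => (1 : ℝ)) x), h1, Fintype.card_fin, div_eq_inv_mul]
  have h3 := ((hasSum_congr h2).mp h).unique (NormedSpace.expSeries_div_hasSum_exp t)
  rw [← Real.exp_eq_exp_ℝ, ht, Real.exp_add] at h3
  exact mul_left_cancel₀ (Real.exp_pos _).ne' h3

theorem diffOp_eq_restrict {F : Measure X → ℝ} {B : Set X} (hB : MeasurableSet B)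
    (hF : ∀ μ, F μ = F (μ.restrict B)) (n : ℕ) (x : Fin n → X) (μ : Measure X) :
    diffOp F n x μ = diffOp F n x (μ.restrict B) := by
  induction n generalizing μ with
  | zero => exact hF μ
  | succ n ih =>
    simp only [diffOp]
    rw [ih _ (μ + _), ih _ μ, ih _ (μ.restrict B + _), Measure.restrict_add, Measure.restrict_add,
      Measure.restrict_restrict hB, Set.inter_self]

/-- A difference in a point outside B compares two measures with the same restriction to B. -/
theorem diffOp_eq_zero {F : Measure X → ℝ} {B : Set X} (hB : MeasurableSet B)
    (hF : ∀ μ, F μ = F (μ.restrict B)) (n : ℕ) (x : Fin n → X) (hx : ∃ i, x i ∉ B)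
    (μ : Measure X) : diffOp F n x μ = 0 := by
  classical
  induction n generalizing μ with
  | zero => exact hx.choose.elim0
  | succ n ih =>
    simp only [diffOp]
    by_cases h : ∃ i, Fin.tail x i ∉ B
    · rw [ih _ h, ih _ h, sub_zero]
    · obtain ⟨i, hi⟩ := hx
      have h0 : x 0 ∉ B := by
        refine Fin.cases (fun hi => hi) (fun j hj => ?_) i hi
        exact absurd ⟨j, hj⟩ h
      rw [diffOp_eq_restrict hB hF n _ (μ + _), diffOp_eq_restrict hB hF n _ μ,
        Measure.restrict_add, restrict_dirac' hB, if_neg h0, add_zero, sub_self]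

variable {Ω : Type*} [MeasurableSpace Ω] {Λ : Measure X} {η : Ω → Measure X} {P : Measure Ω}
  [IsProbabilityMeasure P]

theorem IsPoissonProcess.diffOp_ae_eq (hη : IsPoissonProcess Λ η P) {F : Measure X → ℝ} {B : Set X}
    (hB : MeasurableSet B) (hΛ : Λ B ≠ ⊤) (hF : ∀ μ, F μ = F (μ.restrict B)) {n : ℕ}
    (x : Fin n → X) : (fun ω => diffOp F n x (η ω)) =ᵐ[P]
      fun ω => confDiff (fun ν => F ν.1) n x (localConf η B ω) := by
  filter_upwards [hη.ae_lt_top hB hΛ] with ω hω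
  rw [diffOp_eq_restrict hB hF, ← hη.localConf_coe hB hω, diffOp_coe]

theorem IsPoissonProcess.integral_diffOp (hη : IsPoissonProcess Λ η P) {F : Measure X → ℝ}
    {B : Set X} (hB : MeasurableSet B) (hΛ : Λ B ≠ ⊤) (hF : ∀ μ, F μ = F (μ.restrict B))
    (hFm : Measurable fun ν : Conf X => F ν.1) {n : ℕ} (x : Fin n → X) :
    ∫ ω, diffOp F n x (η ω) ∂P =
      ∫ ξ, confDiff (fun ν => F ν.1) n x ξ ∂poissonConf (Λ.restrict B) := by
  rw [integral_congr_ae (hη.diffOp_ae_eq hB hΛ hF x), ← hη.map_localConf hB hΛ, integral_map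
    (hη.measurable_localConf hB).aemeasurable]
  exact ((measurable_confDiff hFm n).comp
    (measurable_const.prodMk measurable_id)).aestronglyMeasurable

theorem IsPoissonProcess.integrable_diffOp_iff (hη : IsPoissonProcess Λ η P) {F : Measure X → ℝ}
    {B : Set X} (hB : MeasurableSet B) (hΛ : Λ B ≠ ⊤) (hF : ∀ μ, F μ = F (μ.restrict B))
    (hFm : Measurable fun ν : Conf X => F ν.1) {n : ℕ} (x : Fin n → X) :
    Integrable (fun ω => diffOp F n x (η ω)) P ↔
      Integrable (confDiff (fun ν => F ν.1) n x) (poissonConf (Λ.restrict B)) := by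
  rw [integrable_congr (hη.diffOp_ae_eq hB hΛ hF x), ← hη.map_localConf hB hΛ,
    integrable_map_measure _ (hη.measurable_localConf hB).aemeasurable]
  · rfl
  · exact ((measurable_confDiff hFm n).comp
      (measurable_const.prodMk measurable_id)).aestronglyMeasurable

theorem measurable_integral_confDiff (ρ : Measure X) [IsFiniteMeasure ρ] {F : Conf X → ℝ}
    (hF : Measurable F) (n : ℕ) :
    Measurable fun x : Fin n → X => ∫ ξ, confDiff F n x ξ ∂poissonConf ρ :=
  (measurable_confDiff hF n).stronglyMeasurable.integral_prod_right'.measurable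

end Localization

/-! ### Dependence on a window and moment bounds. -/

section Windows

set_option linter.unusedSectionVars false

variable {d : ℕ} {𝕄 : Type*} [MeasurableSpace 𝕄] {g : 𝕄 → KernelSpace d}

theorem mem_hitSet {p : E d × 𝕄} {z : Fin d → ℤ} :
    p ∈ hitSet g z ↔ (pointSupp g p ∩ nhdCube z).Nonempty := Iff.rfl

/-- The marked points that may influence the field in a window. -/
def winSet (g : 𝕄 → KernelSpace d) (A : Set (E d)) : Set (E d × 𝕄) :=
  ⋃ z ∈ {z | (A ∩ nhdCube z).Nonempty}, hitSet g z

theorem measurableSet_winSet (hg : IsKernelFamily g) (A : Set (E d)) :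
    MeasurableSet (winSet g A) :=
  MeasurableSet.biUnion (Set.to_countable _) fun z _ => measurableSet_hitSet hg z

theorem mem_winSet {p : E d × 𝕄} {A : Set (E d)} {y : E d} (hy : y ∈ A)
    (hp : y ∈ pointSupp g p) : p ∈ winSet g A := by
  have h : y ∈ nhdCube (cubeIndex y) := latticeCube_subset_nhdCube _ (mem_latticeCube_iff.mpr rfl)
  exact Set.mem_biUnion (show cubeIndex y ∈ {z | (A ∩ nhdCube z).Nonempty} from ⟨y, hy, h⟩)
    ⟨y, hp, h⟩

theorem measure_winSet_ne_top {A : Set (E d)} (hA : Bornology.IsBounded A)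
    {Λ : Measure (E d × 𝕄)} {κ : ℝ≥0} (hκ : ∀ z, Λ (hitSet g z) ≤ κ) : Λ (winSet g A) ≠ ⊤ := by
  have h := finite_setOf_inter_nhdCube hA
  have : winSet g A = ⋃ z ∈ h.toFinset, hitSet g z := by simp [winSet]
  rw [this]
  refine ((measure_biUnion_finset_le _ _).trans_lt ?_).ne
  exact ENNReal.sum_lt_top.mpr fun z _ => (hκ z).trans_lt ENNReal.coe_lt_top

theorem shotNoise_restrict {A : Set (E d)} {B : Set (E d × 𝕄)} (hB : MeasurableSet B)
    (hAB : winSet g A ⊆ B) (μ : Measure (E d × 𝕄)) {y : E d} (hy : y ∈ A) :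
    shotNoise g (μ.restrict B) y = shotNoise g μ y := by
  unfold shotNoise
  rw [← lintegral_indicator hB]
  refine lintegral_congr fun p => ?_
  by_cases hp : p ∈ B
  · rw [Set.indicator_of_mem hp]
  · rw [Set.indicator_of_notMem hp]
    have h : y ∉ pointSupp g p := fun h => hp (hAB (mem_winSet hy h))
    have h1 : (g p.2).1 (y - p.1) = 0 := kern_eq_zero h
    rw [h1, ENNReal.ofReal_zero]

theorem excursionSet_restrict_inter (u : ℝ) {A : Set (E d)} {B : Set (E d × 𝕄)}
    (hB : MeasurableSet B) (hAB : winSet g A ⊆ B) (μ : Measure (E d × 𝕄)) :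
    excursionSet g u (μ.restrict B) ∩ A = excursionSet g u μ ∩ A := by
  ext y
  refine and_congr_left fun hy => ?_
  rw [excursionSet, excursionSet, Set.mem_ofPred_eq, Set.mem_ofPred_eq,
    shotNoise_restrict hB hAB μ hy]

theorem windowFun_restrict (φ : Set (E d) → ℝ) (u : ℝ) {A : Set (E d)} {B : Set (E d × 𝕄)}
    (hB : MeasurableSet B) (hAB : winSet g A ⊆ B) (μ : Measure (E d × 𝕄)) :
    windowFun φ g u A μ = windowFun φ g u A (μ.restrict B) := by
  rw [windowFun, windowFun, excursionSet_restrict_inter u hB hAB]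

variable {φ : Set (E d) → ℝ} {A : Set (E d)}

theorem abs_windowFun_le (hg : IsKernelFamily g) (u : ℝ) (hφ : IsGeometricFunctional φ) {C : ℝ}
    (hC : ∀ (A : Set (E d)) (x : E d), IsCompactConvex A →
      A ⊆ translate x (unitCube d) → |φ A| ≤ C) (hA : IsCompactConvex A) (μ : Conf (E d × 𝕄)) :
    |windowFun φ g u A μ.1| ≤ ∑ z ∈ (finite_setOf_inter_nhdCube hA.1.isBounded).toFinset,
      2 ^ d * (C * (3 : ℝ) ^ μ.1.real (hitSet g z)) := by
  classical
  obtain ⟨n, x, rfl⟩ := μ.exists_eq_ofTuple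
  rw [windowFun, excursionSet_ofTuple hg]
  refine (abs_finExcursion_inter_le_sum hg u hφ hC hA
    (finite_setOf_inter_nhdCube hA.1.isBounded).toFinset (fun z hz => by simpa using hz) x
    Finset.univ).trans_eq ?_
  refine Finset.sum_congr rfl fun z _ => ?_
  rw [real_ofTuple x (measurableSet_hitSet hg z), ← Real.rpow_natCast 3, Finset.card_filter,
    Nat.cast_sum]
  congr 3
  refine Finset.sum_congr rfl fun i _ => ?_
  rw [Nat.cast_ite, Nat.cast_one, Nat.cast_zero]
  by_cases h : x i ∈ hitSet g z
  · rw [Set.indicator_of_mem h, if_pos (mem_hitSet.mp h)]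
  · rw [Set.indicator_of_notMem h, if_neg (mt mem_hitSet.mpr h)]

/-- One more point multiplies each power of 3 by at most 3, so every difference costs a factor 3 + 1
= 4. -/
theorem abs_confDiff_windowFun_le (hg : IsKernelFamily g) (u : ℝ) (hφ : IsGeometricFunctional φ)
    {C : ℝ} (hC0 : 0 ≤ C) (hC : ∀ (A : Set (E d)) (x : E d), IsCompactConvex A →
      A ⊆ translate x (unitCube d) → |φ A| ≤ C) (hA : IsCompactConvex A) (n : ℕ)
    (x : Fin n → E d × 𝕄) (μ : Conf (E d × 𝕄)) :
    |confDiff (fun ν => windowFun φ g u A ν.1) n x μ| ≤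
      4 ^ n * ∑ z ∈ (finite_setOf_inter_nhdCube hA.1.isBounded).toFinset,
        2 ^ d * (C * (3 : ℝ) ^ μ.1.real (hitSet g z)) := by
  have h := abs_confDiff_le (F := fun ν : Conf (E d × 𝕄) => windowFun φ g u A ν.1)
    (b := fun μ => ∑ z ∈ (finite_setOf_inter_nhdCube hA.1.isBounded).toFinset,
      2 ^ d * (C * (3 : ℝ) ^ μ.1.real (hitSet g z))) (c := 3)
    (abs_windowFun_le hg u hφ hC hA) (fun μ p => ?_) (by norm_num) n x μ
  · norm_num at h ⊢
    exact h
  · rw [Finset.mul_sum]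
    refine Finset.sum_le_sum fun z _ => ?_
    rw [Conf.coe_add, measureReal_add_apply, Real.rpow_add (by norm_num)]
    have h1 : (pt p).1.real (hitSet g z) ≤ 1 := by
      refine (measureReal_mono (Set.subset_univ _)).trans_eq (mass_pt p)
    have h2 : (3 : ℝ) ^ (pt p).1.real (hitSet g z) ≤ 3 := by
      simpa using Real.rpow_le_rpow_of_exponent_le (x := 3) (by norm_num) h1
    calc 2 ^ d * (C * ((3 : ℝ) ^ μ.1.real (hitSet g z) * 3 ^ (pt p).1.real (hitSet g z)))
        ≤ 2 ^ d * (C * ((3 : ℝ) ^ μ.1.real (hitSet g z) * 3)) := by gcongr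
      _ = _ := by ring

theorem integrable_confDiff_windowFun (hg : IsKernelFamily g) (u : ℝ)
    (hφ : IsGeometricFunctional φ) (hA : IsCompactConvex A) (ρ : Measure (E d × 𝕄))
    [IsFiniteMeasure ρ] (n : ℕ) (x : Fin n → E d × 𝕄) :
    Integrable (confDiff (fun ν => windowFun φ g u A ν.1) n x) (poissonConf ρ) := by
  obtain ⟨C, hC0, hC⟩ := hφ.exists_bound
  refine Integrable.mono' (((integrable_finsetSum _ fun z _ =>
    ((integrable_rpow_apply ρ (measurableSet_hitSet hg z) (a := 3) (by norm_num)).const_mul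
      C).const_mul (2 ^ d))).const_mul _)
    ((measurable_confDiff (measurable_windowFun hg u hφ hA) n).comp
      (measurable_const.prodMk measurable_id)).aestronglyMeasurable
    (ae_of_all _ (abs_confDiff_windowFun_le hg u hφ hC0 hC hA n x))

/-- The generating function at 3 bounds each cube by exp(2κ), so the mean is linear in the number of
cubes that A meets. -/
theorem abs_integral_confDiff_windowFun_le (hg : IsKernelFamily g) (u : ℝ)
    (hφ : IsGeometricFunctional φ) {C : ℝ} (hC0 : 0 ≤ C) (hC : ∀ (A : Set (E d)) (x : E d),
      IsCompactConvex A → A ⊆ translate x (unitCube d) → |φ A| ≤ C) (hA : IsCompactConvex A)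
    (ρ : Measure (E d × 𝕄)) [IsFiniteMeasure ρ] {κ : ℝ≥0} (hκ : ∀ z, ρ (hitSet g z) ≤ κ) (n : ℕ)
    (x : Fin n → E d × 𝕄) :
    |∫ ξ, confDiff (fun ν => windowFun φ g u A ν.1) n x ξ ∂poissonConf ρ| ≤
      4 ^ n * ((cubes A).toReal * (2 ^ d * (C * Real.exp (2 * κ)))) := by
  have hint : ∀ z ∈ (finite_setOf_inter_nhdCube hA.1.isBounded).toFinset, Integrable
      (fun ξ : Conf (E d × 𝕄) => 2 ^ d * (C * (3 : ℝ) ^ ξ.1.real (hitSet g z)))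
      (poissonConf ρ) := fun z _ =>
    ((integrable_rpow_apply ρ (measurableSet_hitSet hg z) (a := 3) (by norm_num)).const_mul
      C).const_mul (2 ^ d)
  have hle := abs_confDiff_windowFun_le hg u hφ hC0 hC hA n x
  simp_rw [← Real.norm_eq_abs] at hle ⊢
  refine (norm_integral_le_of_norm_le ((integrable_finsetSum _ hint).const_mul _)
    (ae_of_all _ hle)).trans ?_
  rw [integral_const_mul, integral_finsetSum _ hint]
  refine mul_le_mul_of_nonneg_left ?_ (by positivity)
  rw [cubes_eq_card hA.1.isBounded, ENNReal.toReal_natCast, ← nsmul_eq_mul]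
  refine Finset.sum_le_card_nsmul _ _ _ fun z _ => ?_
  rw [integral_const_mul, integral_const_mul,
    integral_rpow_apply ρ (measurableSet_hitSet hg z) (by norm_num)]
  have h1 : ρ.real (hitSet g z) ≤ κ := ENNReal.toReal_le_coe_of_le_coe (hκ z)
  have h2 : ((3 : ℝ) - 1) * ρ.real (hitSet g z) ≤ 2 * κ := by linarith
  gcongr

end Windows

/-! ### Mean difference operators: restriction of the window and stationarity -/

section MeanDiff

set_option linter.unusedSectionVars false

/-- Difference operators commute, so the difference in the first point may act directly on F. This
allows an identity for one difference to be inserted before the others are taken. -/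
theorem confDiff_succ' {X : Type*} [MeasurableSpace X] (F : Conf X → ℝ) (n : ℕ)
    (x : Fin (n + 1) → X) (μ : Conf X) :
    confDiff F (n + 1) x μ = confDiff (fun ν => F (ν + pt (x 0)) - F ν) n (Fin.tail x) μ := by
  have h : ∀ (n : ℕ) (y : Fin n → X) (p : X) (μ : Conf X),
      confDiff (fun ν => F (ν + pt p) - F ν) n y μ =
        confDiff F n y (μ + pt p) - confDiff F n y μ := by
    intro n
    induction n with
    | zero => exact fun _ _ _ => rfl
    | succ n ih =>
      intro y p μ
      simp only [confDiff, ih, add_right_comm μ (pt (y 0)) (pt p)]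
      ring
  rw [h]
  rfl

variable {d : ℕ} {𝕄 : Type*} [MeasurableSpace 𝕄] {g : 𝕄 → KernelSpace d}
  {φ : Set (E d) → ℝ} {A : Set (E d)}

theorem shotNoise_add_pt (hg : IsKernelFamily g) (μ : Measure (E d × 𝕄)) (p : E d × 𝕄) (y : E d) :
    shotNoise g (μ + Measure.dirac p) y = shotNoise g μ y + ENNReal.ofReal (kern g p y) := by
  rw [shotNoise, lintegral_add_measure, lintegral_dirac' _ (measurable_ofReal_kern hg y)]
  rfl

theorem mem_excursionSet {u : ℝ} {μ : Measure (E d × 𝕄)} {y : E d} :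
    y ∈ excursionSet g u μ ↔ ENNReal.ofReal u ≤ shotNoise g μ y := Iff.rfl

/-- The excursion sets with and without p agree off the support of p. The larger one is the union of
the smaller one with its own part in that support, and additivity cancels everything outside. -/
theorem windowFun_add_pt_sub (hg : IsKernelFamily g) (u : ℝ) (hφ : IsGeometricFunctional φ)
    (hA : IsCompactConvex A) (μ : Conf (E d × 𝕄)) (p : E d × 𝕄) :
    windowFun φ g u A (μ + pt p).1 - windowFun φ g u A μ.1 =
      windowFun φ g u (A ∩ pointSupp g p) (μ + pt p).1 -
        windowFun φ g u (A ∩ pointSupp g p) μ.1 := by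
  have hK := hA.inter (isCompactConvex_pointSupp g p)
  have hsub : excursionSet g u μ.1 ⊆ excursionSet g u (μ + pt p).1 := fun y hy => by
    rw [mem_excursionSet] at hy ⊢
    refine hy.trans ?_
    rw [Conf.coe_add]
    exact (le_self_add.trans_eq (shotNoise_add_pt hg μ.1 p y).symm)
  have heq : ∀ y, y ∉ pointSupp g p → y ∈ excursionSet g u (μ + pt p).1 →
      y ∈ excursionSet g u μ.1 := fun y hy h => by
    have h1 : shotNoise g (μ + pt p).1 y = shotNoise g μ.1 y := by
      refine (shotNoise_add_pt hg μ.1 p y).trans ?_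
      rw [kern_eq_zero hy, ENNReal.ofReal_zero, add_zero]
    rwa [mem_excursionSet, h1] at h
  have h := hφ.additive _ _ (isPolyconvex_excursionSet_inter hg u hA μ)
    (isPolyconvex_excursionSet_inter hg u hK (μ + pt p))
  have h1 : excursionSet g u μ.1 ∩ A ∪ excursionSet g u (μ + pt p).1 ∩ (A ∩ pointSupp g p) =
      excursionSet g u (μ + pt p).1 ∩ A := by
    ext y
    have := @hsub y
    have := heq y
    simp only [Set.mem_union, Set.mem_inter_iff]
    tauto
  have h2 : excursionSet g u μ.1 ∩ A ∩ (excursionSet g u (μ + pt p).1 ∩ (A ∩ pointSupp g p)) =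
      excursionSet g u μ.1 ∩ (A ∩ pointSupp g p) := by
    ext y
    have := @hsub y
    simp only [Set.mem_inter_iff]
    tauto
  rw [h1, h2] at h
  simp only [windowFun]
  linarith

/-- The intersection of the translated supports of marked points. -/
def interSupp (g : 𝕄 → KernelSpace d) {n : ℕ} (x : Fin n → E d × 𝕄) : Set (E d) :=
  ⋂ j, pointSupp g (x j)

theorem interSupp_succ {n : ℕ} (x : Fin (n + 1) → E d × 𝕄) :
    interSupp g x = pointSupp g (x 0) ∩ interSupp g (Fin.tail x) := by
  ext y
  simp only [interSupp, Set.mem_inter_iff, Set.mem_iInter, Fin.forall_fin_succ]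
  rfl

theorem isCompactConvex_inter_interSupp (hA : IsCompactConvex A) {n : ℕ}
    (x : Fin n → E d × 𝕄) : IsCompactConvex (A ∩ interSupp g x) := by
  refine ⟨hA.1.inter_right ?_, hA.2.inter ?_⟩
  · exact isClosed_iInter fun j => (isCompactConvex_pointSupp g (x j)).1.isClosed
  · exact convex_iInter fun j => (isCompactConvex_pointSupp g (x j)).2

/-- Localisation to one support at a time leaves only the intersection of all supports; this is the
fixed set K in the asymptotic variance. -/
theorem confDiff_windowFun_inter (hg : IsKernelFamily g) (u : ℝ) (hφ : IsGeometricFunctional φ)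
    (hA : IsCompactConvex A) (n : ℕ) (x : Fin n → E d × 𝕄) (μ : Conf (E d × 𝕄)) :
    confDiff (fun ν => windowFun φ g u A ν.1) n x μ =
      confDiff (fun ν => windowFun φ g u (A ∩ interSupp g x) ν.1) n x μ := by
  induction n generalizing A μ with
  | zero =>
    have : A ∩ interSupp g x = A := by simp [interSupp]
    rw [this]
  | succ n ih =>
    have hK := hA.inter (isCompactConvex_pointSupp g (x 0))
    rw [confDiff_succ']
    simp_rw [windowFun_add_pt_sub hg u hφ hA]
    rw [← confDiff_succ' (fun ν => windowFun φ g u (A ∩ pointSupp g (x 0)) ν.1)]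
    simp only [confDiff]
    rw [ih hK, ih hK, Set.inter_assoc, ← interSupp_succ]

/-- The translation of the locations of marked points. -/
def shift (v : E d) : E d × 𝕄 ≃ᵐ E d × 𝕄 :=
  (MeasurableEquiv.addRight v).prodCongr (MeasurableEquiv.refl 𝕄)

theorem shift_apply (v : E d) (p : E d × 𝕄) : shift v p = (p.1 + v, p.2) := rfl

theorem map_shift_intensity (γ : ℝ≥0) (Q : Measure 𝕄) [IsProbabilityMeasure Q] (v : E d) :
    (intensity d γ Q).map (shift v) = intensity d γ Q := by
  rw [intensity, Measure.map_smul]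
  congr 1
  exact ((measurePreserving_add_right (volume : Measure (E d)) v).prod
    (MeasurePreserving.id Q)).map_eq

theorem shotNoise_map_shift (μ : Measure (E d × 𝕄)) (v y : E d) :
    shotNoise g (μ.map (shift v)) y = shotNoise g μ (y - v) := by
  rw [shotNoise, lintegral_map_equiv]
  refine lintegral_congr fun p => ?_
  rw [shift_apply]
  simp only
  rw [sub_add_eq_sub_sub_swap]

theorem translate_inter (v : E d) (A B : Set (E d)) :
    translate v (A ∩ B) = translate v A ∩ translate v B :=
  Set.image_inter (add_left_injective v)

theorem excursionSet_map_shift (u : ℝ) (μ : Measure (E d × 𝕄)) (v : E d) :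
    excursionSet g u (μ.map (shift v)) = translate v (excursionSet g u μ) := by
  ext y
  rw [mem_translate]
  exact (congrArg (ENNReal.ofReal u ≤ ·) (shotNoise_map_shift μ v y)).to_iff

/-- The finiteness hypothesis makes the excursion set in A polyconvex, as translation invariance of
φ requires; it persists when points are added. -/
theorem diffOp_windowFun_shift (hg : IsKernelFamily g) (u : ℝ) (hφ : IsGeometricFunctional φ)
    (hA : IsCompactConvex A) (v : E d) (n : ℕ) (x : Fin n → E d × 𝕄) {μ : Measure (E d × 𝕄)}
    (hμ : μ.restrict (winSet g A) ∈ finConf (E d × 𝕄)) :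
    diffOp (windowFun φ g u (translate v A)) n (shift v ∘ x) (μ.map (shift v)) =
      diffOp (windowFun φ g u A) n x μ := by
  classical
  have hB := measurableSet_winSet hg A
  induction n generalizing μ with
  | zero =>
    have hpoly := isPolyconvex_excursionSet_inter hg u hA ⟨_, hμ⟩
    rw [excursionSet_restrict_inter u hB subset_rfl] at hpoly
    simp only [diffOp, windowFun]
    rw [excursionSet_map_shift, ← translate_inter, hφ.translation_invariant _ _ hpoly]
  | succ n ih =>
    simp only [diffOp]
    have h1 : μ.map (shift v) + Measure.dirac ((shift v ∘ x) 0) =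
        (μ + Measure.dirac (x 0)).map (shift v) := by
      rw [Measure.map_add _ _ (shift v).measurable, Measure.map_dirac' (shift v).measurable]
      rfl
    have h2 : (μ + Measure.dirac (x 0)).restrict (winSet g A) ∈ finConf (E d × 𝕄) := by
      rw [Measure.restrict_add, restrict_dirac' hB]
      split_ifs
      · exact add_mem hμ (AddSubmonoid.subset_closure ⟨_, rfl⟩)
      · simpa using hμ
    have h3 : Fin.tail (shift v ∘ x) = shift v ∘ Fin.tail x := rfl
    rw [h1, h3, ih _ h2, ih _ hμ]

variable {Ω : Type*} [MeasurableSpace Ω]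

theorem IsPoissonProcess.map_equiv {X : Type*} [MeasurableSpace X] {Λ : Measure X}
    {η : Ω → Measure X} {P : Measure Ω} (hη : IsPoissonProcess Λ η P) (e : X ≃ᵐ X)
    (he : Λ.map e = Λ) : IsPoissonProcess Λ (fun ω => (η ω).map e) P where
  measurable := (Measure.measurable_map e e.measurable).comp hη.measurable
  counting ω := by
    obtain ⟨ι, hι, x, h⟩ := hη.counting ω
    refine ⟨ι, hι, fun i => e (x i), ?_⟩
    rw [h, Measure.map_sum e.measurable.aemeasurable]
    simp_rw [Measure.map_dirac' e.measurable]
  sigmaFinite ω := by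
    have := hη.sigmaFinite ω
    exact e.sigmaFinite_map
  law B hB := by
    simp_rw [e.map_apply]
    rw [hη.law _ (e.measurable hB), ← e.map_apply, he]
  indep n B hB hd := by
    simp_rw [e.map_apply]
    exact hη.indep n (fun i => e ⁻¹' B i) (fun i => e.measurable (hB i))
      fun i j hij => (hd hij).preimage e

/-- The mean of the iterated difference operator of a functional of the excursion set in a
window. -/
def meanDiff (P : Measure Ω) (η : Ω → Measure (E d × 𝕄)) (φ : Set (E d) → ℝ)
    (g : 𝕄 → KernelSpace d) (u : ℝ) (A : Set (E d)) (n : ℕ) (x : Fin n → E d × 𝕄) : ℝ :=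
  ∫ ω, diffOp (windowFun φ g u A) n x (η ω) ∂P

variable {P : Measure Ω} [IsProbabilityMeasure P] {η : Ω → Measure (E d × 𝕄)}
  {Λ : Measure (E d × 𝕄)}

/-- B may exceed `winSet g A`, so that functionals of two nested windows can be compared under one
Poisson law. -/
theorem meanDiff_eq (hg : IsKernelFamily g) (u : ℝ) (hφ : IsGeometricFunctional φ)
    (hη : IsPoissonProcess Λ η P) (hA : IsCompactConvex A) {B : Set (E d × 𝕄)}
    (hB : MeasurableSet B) (hAB : winSet g A ⊆ B) (hΛ : Λ B ≠ ⊤) (n : ℕ) (x : Fin n → E d × 𝕄) :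
    meanDiff P η φ g u A n x =
      ∫ ξ, confDiff (fun ν => windowFun φ g u A ν.1) n x ξ ∂poissonConf (Λ.restrict B) :=
  hη.integral_diffOp hB hΛ (windowFun_restrict φ u hB hAB) (measurable_windowFun hg u hφ hA) x

theorem meanDiff_eq_zero (u : ℝ) {B : Set (E d × 𝕄)}
    (hB : MeasurableSet B) (hAB : winSet g A ⊆ B) {n : ℕ} {x : Fin n → E d × 𝕄}
    (hx : ∃ i, x i ∉ B) : meanDiff P η φ g u A n x = 0 := by
  rw [meanDiff]
  simp_rw [diffOp_eq_zero hB (windowFun_restrict φ u hB hAB) n x hx]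
  exact integral_zero _ _

theorem meanDiff_empty (u : ℝ) (hφ : IsGeometricFunctional φ) (n : ℕ)
    (x : Fin n → E d × 𝕄) : meanDiff P η φ g u ∅ n x = 0 := by
  have h : ∀ (n : ℕ) (x : Fin n → E d × 𝕄) (μ : Measure (E d × 𝕄)),
      diffOp (windowFun φ g u ∅) n x μ = 0 := by
    intro n
    induction n with
    | zero =>
      intro x μ
      simp [diffOp, windowFun, hφ.map_empty]
    | succ n ih =>
      intro x μ
      simp [diffOp, ih]
  simp [meanDiff, h]

theorem winSet_mono {A B : Set (E d)} (h : A ⊆ B) : winSet g A ⊆ winSet g B :=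
  Set.biUnion_subset_biUnion_left fun _ hz => hz.mono (Set.inter_subset_inter_left _ h)

theorem meanDiff_inter (hg : IsKernelFamily g) (u : ℝ) (hφ : IsGeometricFunctional φ)
    (hη : IsPoissonProcess Λ η P) {κ : ℝ≥0} (hκ : ∀ z, Λ (hitSet g z) ≤ κ)
    (hA : IsCompactConvex A) (n : ℕ) (x : Fin n → E d × 𝕄) :
    meanDiff P η φ g u A n x = meanDiff P η φ g u (A ∩ interSupp g x) n x := by
  have hB := measurableSet_winSet hg A
  have hΛ := measure_winSet_ne_top hA.1.isBounded hκ
  rw [meanDiff_eq hg u hφ hη hA hB subset_rfl hΛ, meanDiff_eq hg u hφ hη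
    (isCompactConvex_inter_interSupp hA x) hB (winSet_mono Set.inter_subset_left) hΛ]
  exact integral_congr_ae (ae_of_all _ fun μ => confDiff_windowFun_inter hg u hφ hA n x μ)

theorem meanDiff_shift (hg : IsKernelFamily g) (u : ℝ) (hφ : IsGeometricFunctional φ)
    (hη : IsPoissonProcess Λ η P) {κ : ℝ≥0} (hκ : ∀ z, Λ (hitSet g z) ≤ κ)
    (hA : IsCompactConvex A) (v : E d) (hv : Λ.map (shift v) = Λ) (n : ℕ)
    (x : Fin n → E d × 𝕄) :
    meanDiff P η φ g u (translate v A) n (shift v ∘ x) = meanDiff P η φ g u A n x := by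
  have hA' := hA.translate v
  have hB := measurableSet_winSet hg (translate v A)
  have hΛ := measure_winSet_ne_top hA'.1.isBounded hκ
  rw [meanDiff_eq hg u hφ hη hA' hB subset_rfl hΛ,
    -- The mean depends only on the law on finite-intensity sets, so η may be replaced by its
    -- shifted copy, again a Poisson process with intensity Λ.
    ← meanDiff_eq hg u hφ (hη.map_equiv (shift v) hv) hA' hB subset_rfl hΛ]
  refine integral_congr_ae ?_
  have hB' := measurableSet_winSet hg A
  filter_upwards [hη.ae_lt_top hB' (measure_winSet_ne_top hA.1.isBounded hκ)] with ω hω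
  exact diffOp_windowFun_shift hg u hφ hA v n x ((hη.counting ω).restrict_mem_finConf hB' hω)

theorem exists_abs_meanDiff_le (hg : IsKernelFamily g) (u : ℝ) (hφ : IsGeometricFunctional φ)
    (hη : IsPoissonProcess Λ η P) {κ : ℝ≥0} (hκ : ∀ z, Λ (hitSet g z) ≤ κ) :
    ∃ c : ℝ, 0 ≤ c ∧ ∀ (A : Set (E d)), IsCompactConvex A → ∀ (n : ℕ) (x : Fin n → E d × 𝕄),
      |meanDiff P η φ g u A n x| ≤ 4 ^ n * ((cubes A).toReal * c) := by
  obtain ⟨C, hC0, hC⟩ := hφ.exists_bound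
  refine ⟨2 ^ d * (C * Real.exp (2 * κ)), by positivity, fun A hA n x => ?_⟩
  have hΛ := measure_winSet_ne_top hA.1.isBounded hκ
  have : IsFiniteMeasure (Λ.restrict (winSet g A)) := ⟨by simpa using hΛ.lt_top⟩
  rw [meanDiff_eq hg u hφ hη hA (measurableSet_winSet hg A) subset_rfl hΛ]
  exact abs_integral_confDiff_windowFun_le hg u hφ hC0 hC hA _
    (fun z => (Measure.restrict_apply_le _ _).trans (hκ z)) n x

theorem measurable_meanDiff (hg : IsKernelFamily g) (u : ℝ) (hφ : IsGeometricFunctional φ)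
    (hη : IsPoissonProcess Λ η P) {κ : ℝ≥0} (hκ : ∀ z, Λ (hitSet g z) ≤ κ)
    (hA : IsCompactConvex A) (n : ℕ) : Measurable (meanDiff P η φ g u A n) := by
  have hΛ := measure_winSet_ne_top hA.1.isBounded hκ
  have : IsFiniteMeasure (Λ.restrict (winSet g A)) := ⟨by simpa using hΛ.lt_top⟩
  have h : meanDiff P η φ g u A n = fun x => ∫ ξ, confDiff (fun ν => windowFun φ g u A ν.1) n x ξ
      ∂poissonConf (Λ.restrict (winSet g A)) :=
    funext fun x => meanDiff_eq hg u hφ hη hA (measurableSet_winSet hg A) subset_rfl hΛ n x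
  rw [h]
  exact measurable_integral_confDiff _ (measurable_windowFun hg u hφ hA) n

end MeanDiff

/-! ### The variance in a window and the second moments of the numbers of cubes -/

section Variance

set_option linter.unusedSectionVars false

variable {d : ℕ} {𝕄 : Type*} [MeasurableSpace 𝕄] {g : 𝕄 → KernelSpace d}
  {φ : Set (E d) → ℝ} {A : Set (E d)} {Ω : Type*} [MeasurableSpace Ω]
  {P : Measure Ω} [IsProbabilityMeasure P] {η : Ω → Measure (E d × 𝕄)} {Λ : Measure (E d × 𝕄)}

theorem exists_abs_windowFun_le (hg : IsKernelFamily g) (u : ℝ) (hφ : IsGeometricFunctional φ)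
    (hA : IsCompactConvex A) :
    ∃ C : ℝ, ∀ μ : Conf (E d × 𝕄), |windowFun φ g u A μ.1| ≤ C * 3 ^ mass μ := by
  obtain ⟨C, hC0, hC⟩ := hφ.exists_bound
  refine ⟨∑ z ∈ (finite_setOf_inter_nhdCube hA.1.isBounded).toFinset, 2 ^ d * C, fun μ => ?_⟩
  refine (abs_windowFun_le hg u hφ hC hA μ).trans ?_
  rw [Finset.sum_mul]
  refine Finset.sum_le_sum fun z _ => ?_
  rw [mul_assoc]
  have h : (3 : ℝ) ^ μ.1.real (hitSet g z) ≤ 3 ^ mass μ :=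
    Real.rpow_le_rpow_of_exponent_le (by norm_num) (measureReal_mono (Set.subset_univ _))
  gcongr

theorem memLp_windowFun (hg : IsKernelFamily g) (u : ℝ) (hφ : IsGeometricFunctional φ)
    (hη : IsPoissonProcess Λ η P) {κ : ℝ≥0} (hκ : ∀ z, Λ (hitSet g z) ≤ κ)
    (hA : IsCompactConvex A) : MemLp (fun ω => windowFun φ g u A (η ω)) 2 P := by
  have hB := measurableSet_winSet hg A
  have hΛ := measure_winSet_ne_top hA.1.isBounded hκ
  have : IsFiniteMeasure (Λ.restrict (winSet g A)) := ⟨by simpa using hΛ.lt_top⟩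
  have hF := measurable_windowFun hg u hφ hA
  have hae : (fun ω => windowFun φ g u A (η ω)) =ᵐ[P]
      fun ω => windowFun φ g u A (localConf η (winSet g A) ω).1 :=
    hη.diffOp_ae_eq hB hΛ (windowFun_restrict φ u hB subset_rfl) (n := 0) Fin.elim0
  have hmeas : Measurable fun ω => windowFun φ g u A (localConf η (winSet g A) ω).1 :=
    hF.comp (hη.measurable_localConf hB)
  rw [memLp_congr_ae hae, memLp_two_iff_integrable_sq hmeas.aestronglyMeasurable]
  obtain ⟨C, hC⟩ := exists_abs_windowFun_le hg u hφ hA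
  have hint : Integrable (fun ξ : Conf (E d × 𝕄) => windowFun φ g u A ξ.1 ^ 2)
      (poissonConf (Λ.restrict (winSet g A))) := by
    refine integrable_poissonConf _ (hF.pow_const 2) (C := C ^ 2) (a := 9) (by norm_num)
      fun ξ => ?_
    rw [abs_pow]
    refine (pow_le_pow_left₀ (abs_nonneg _) (hC ξ) 2).trans_eq ?_
    rw [mul_pow, ← Real.rpow_natCast (3 ^ mass ξ) 2, ← Real.rpow_mul (by norm_num), mul_comm (mass ξ),
      Real.rpow_mul (by norm_num)]
    norm_num
  rw [← hη.map_localConf hB hΛ] at hint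
  exact hint.comp_measurable (hη.measurable_localConf hB)

theorem hasSum_variance_windowFun [SigmaFinite Λ] (hg : IsKernelFamily g) (u : ℝ)
    (hφ : IsGeometricFunctional φ) (hη : IsPoissonProcess Λ η P) {κ : ℝ≥0}
    (hκ : ∀ z, Λ (hitSet g z) ≤ κ) (hA : IsCompactConvex A) :
    HasSum (fun k : ℕ => ((k + 1).factorial : ℝ)⁻¹ *
      ∫ x, meanDiff P η φ g u A (k + 1) x ^ 2 ∂(Measure.pi fun _ => Λ))
      (variance (fun ω => windowFun φ g u A (η ω)) P) := by
  have hB := measurableSet_winSet hg A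
  have hΛ := measure_winSet_ne_top hA.1.isBounded hκ
  have : IsFiniteMeasure (Λ.restrict (winSet g A)) := ⟨by simpa using hΛ.lt_top⟩
  have hF := measurable_windowFun hg u hφ hA
  obtain ⟨C, hC⟩ := exists_abs_windowFun_le hg u hφ hA
  have h := hasSum_sq_confDiff (Λ.restrict (winSet g A)) hF (by norm_num) hC
  have h1 : ∀ n : ℕ, (n.factorial : ℝ)⁻¹ * ∫ x : Fin n → E d × 𝕄,
      (∫ ξ, confDiff (fun ν => windowFun φ g u A ν.1) n x ξ
        ∂poissonConf (Λ.restrict (winSet g A))) ^ 2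
        ∂(Measure.pi fun _ => Λ.restrict (winSet g A)) =
      (n.factorial : ℝ)⁻¹ * ∫ x, meanDiff P η φ g u A n x ^ 2 ∂(Measure.pi fun _ => Λ) := by
    intro n
    congr 1
    simp_rw [← meanDiff_eq hg u hφ hη hA hB subset_rfl hΛ]
    rw [← Measure.restrict_pi_pi]
    -- Points that cannot influence the window contribute nothing, so restricting the product
    -- measure does not change the integral.
    refine setIntegral_eq_integral_of_forall_compl_eq_zero fun x hx => ?_
    have hx' : ∃ i, x i ∉ winSet g A := by simpa using hx
    rw [meanDiff_eq_zero u hB subset_rfl hx', zero_pow two_ne_zero]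
  have h2 : ∫ ξ : Conf (E d × 𝕄), windowFun φ g u A ξ.1 ^ 2 ∂poissonConf (Λ.restrict (winSet g A)) =
      ∫ ω, windowFun φ g u A (η ω) ^ 2 ∂P := by
    have hae : (fun ω => windowFun φ g u A (η ω) ^ 2) =ᵐ[P]
        fun ω => windowFun φ g u A (localConf η (winSet g A) ω).1 ^ 2 :=
      (hη.diffOp_ae_eq hB hΛ (windowFun_restrict φ u hB subset_rfl) (n := 0)
        Fin.elim0).pow_const 2
    rw [integral_congr_ae hae, ← hη.map_localConf hB hΛ, integral_map
      (hη.measurable_localConf hB).aemeasurable (hF.pow_const 2).aestronglyMeasurable]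
  rw [h2] at h
  -- The term n = 0 is the squared mean; removing it turns the second moment into the variance.
  have h3 := (hasSum_nat_add_iff' 1).mpr ((hasSum_congr h1).mp h)
  have h4 : variance (fun ω => windowFun φ g u A (η ω)) P =
      ∫ ω, windowFun φ g u A (η ω) ^ 2 ∂P - (∫ ω, windowFun φ g u A (η ω) ∂P) ^ 2 :=
    variance_eq_sub (memLp_windowFun hg u hφ hη hκ hA)
  have h5 : ∀ x : Fin 0 → E d × 𝕄, meanDiff P η φ g u A 0 x = ∫ ω, windowFun φ g u A (η ω) ∂P :=
    fun x => rfl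
  rw [Finset.sum_range_one, Nat.factorial_zero, Nat.cast_one, inv_one, one_mul] at h3
  simp_rw [h5] at h3
  rw [integral_const, measureReal_def, Measure.pi_univ, Finset.univ_eq_empty, Finset.prod_empty,
    ENNReal.toReal_one, one_smul] at h3
  rwa [h4]

/-- A measurable majorant of the square of the number of cubes that hit a common support. -/
def cubesBound (g : 𝕄 → KernelSpace d) {k : ℕ} (q : 𝕄 × (Fin k → E d × 𝕄)) : ℝ≥0∞ :=
  (∑' z, (hitSet g z).indicator 1 ((0 : E d), q.1)) *
    ∑' z, (hitSet g z).indicator 1 ((0 : E d), q.1) * ∏ j, (hitSet g z).indicator 1 (q.2 j)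

theorem measurable_indicator_hitSet (hg : IsKernelFamily g) (z : Fin d → ℤ) :
    Measurable ((hitSet g z).indicator (1 : E d × 𝕄 → ℝ≥0∞)) :=
  measurable_one.indicator (measurableSet_hitSet hg z)

theorem measurable_cubesBound (hg : IsKernelFamily g) (k : ℕ) :
    Measurable (cubesBound g : 𝕄 × (Fin k → E d × 𝕄) → ℝ≥0∞) := by
  have h : ∀ z, Measurable fun q : 𝕄 × (Fin k → E d × 𝕄) =>
      (hitSet g z).indicator (1 : E d × 𝕄 → ℝ≥0∞) ((0 : E d), q.1) := fun z =>
    (measurable_indicator_hitSet hg z).comp (measurable_const.prodMk measurable_fst)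
  have h' : ∀ z, ∀ j, Measurable fun q : 𝕄 × (Fin k → E d × 𝕄) =>
      (hitSet g z).indicator (1 : E d × 𝕄 → ℝ≥0∞) (q.2 j) := fun z j =>
    (measurable_indicator_hitSet hg z).comp ((measurable_pi_apply j).comp measurable_snd)
  refine (Measurable.tsum fun z => h z).mul (Measurable.tsum fun z => (h z).mul ?_)
  exact Finset.measurable_prod _ fun j _ => h' z j

theorem translate_zero (A : Set (E d)) : translate 0 A = A := by simp [translate]

theorem hit_pointSupp (p : E d × 𝕄) (z : Fin d → ℤ) :
    hit (pointSupp g p) z = (hitSet g z).indicator 1 p := by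
  by_cases h : p ∈ hitSet g z
  · rw [Set.indicator_of_mem h, hit, if_pos (mem_hitSet.mp h), Pi.one_apply]
  · rw [Set.indicator_of_notMem h, hit, if_neg (mt mem_hitSet.mpr h)]

theorem hit_supp (m : 𝕄) (z : Fin d → ℤ) :
    hit (g m).supp z = (hitSet g z).indicator 1 ((0 : E d), m) := by
  rw [← hit_pointSupp, pointSupp, translate_zero]

theorem hit_commonSupp_le {k : ℕ} (m : 𝕄) (x : Fin k → E d × 𝕄) (z : Fin d → ℤ) :
    hit (commonSupp g m x) z ≤
      (hitSet g z).indicator 1 ((0 : E d), m) * ∏ j, (hitSet g z).indicator 1 (x j) := by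
  by_cases h : (commonSupp g m x ∩ nhdCube z).Nonempty
  · have h1 : hit (commonSupp g m x) z ≤ hit (g m).supp z := hit_mono Set.inter_subset_left z
    obtain ⟨y, hy, hyz⟩ := h
    have h2 : ∀ j, (hitSet g z).indicator (1 : E d × 𝕄 → ℝ≥0∞) (x j) = 1 := fun j =>
      Set.indicator_of_mem (mem_hitSet.mpr ⟨y, Set.mem_iInter.mp hy.2 j, hyz⟩) _
    simpa [h2, ← hit_supp] using h1
  · rw [hit, if_neg h]
    exact zero_le

/-- One factor is enlarged to the number of cubes near K_m. The other keeps the dependence on every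
point, which makes the integral over the points finite. -/
theorem cubes_commonSupp_sq_le {k : ℕ} (q : 𝕄 × (Fin k → E d × 𝕄)) :
    cubes (commonSupp g q.1 q.2) ^ 2 ≤ cubesBound g q := by
  rw [sq, cubesBound]
  refine mul_le_mul' ?_ (ENNReal.tsum_le_tsum fun z => hit_commonSupp_le _ _ z)
  refine (cubes_mono Set.inter_subset_left).trans_eq ?_
  exact tsum_congr fun z => hit_supp q.1 z

/-- For each cube every point contributes at most κ. Summing over the cubes near K_m restores the
second factor and leaves the second moment of their number. -/
theorem lintegral_cubesBound_le [SigmaFinite Λ] (hg : IsKernelFamily g) {κ : ℝ≥0}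
    (hκ : ∀ z, Λ (hitSet g z) ≤ κ) (Q : Measure 𝕄) [IsProbabilityMeasure Q] (k : ℕ) :
    ∫⁻ q, cubesBound g q ∂(Q.prod (Measure.pi fun _ : Fin k => Λ)) ≤
      κ ^ k * ∫⁻ m, cubes (g m).supp ^ 2 ∂Q := by
  rw [lintegral_prod _ (measurable_cubesBound hg k).aemeasurable, ← lintegral_const_mul' _ _
    (ENNReal.pow_ne_top ENNReal.coe_ne_top)]
  refine lintegral_mono fun m => ?_
  have hm : ∀ z, Measurable fun x : Fin k → E d × 𝕄 =>
      ∏ j, (hitSet g z).indicator (1 : E d × 𝕄 → ℝ≥0∞) (x j) := fun z =>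
    Finset.measurable_prod _ fun j _ =>
      (measurable_indicator_hitSet hg z).comp (measurable_pi_apply j)
  simp only [cubesBound]
  rw [lintegral_const_mul _ (Measurable.tsum fun z => (hm z).const_mul _),
    lintegral_tsum fun z => ((hm z).const_mul _).aemeasurable]
  have h1 : ∀ z, ∫⁻ x : Fin k → E d × 𝕄, (hitSet g z).indicator 1 ((0 : E d), m) *
      ∏ j, (hitSet g z).indicator 1 (x j) ∂(Measure.pi fun _ => Λ) ≤
        hit (g m).supp z * κ ^ k := by
    intro z
    rw [lintegral_const_mul _ (hm z), hit_supp]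
    refine mul_le_mul' le_rfl ?_
    have h2 : ∀ x : Fin k → E d × 𝕄, ∏ j, (hitSet g z).indicator (1 : E d × 𝕄 → ℝ≥0∞) (x j) =
        (Set.univ.pi fun _ => hitSet g z).indicator 1 x := by
      intro x
      by_cases hx : x ∈ Set.univ.pi fun _ : Fin k => hitSet g z
      · rw [Set.indicator_of_mem hx, Pi.one_apply]
        exact Finset.prod_eq_one fun j _ => Set.indicator_of_mem (hx j (Set.mem_univ j)) _
      · rw [Set.indicator_of_notMem hx]
        obtain ⟨j, hj⟩ : ∃ j, x j ∉ hitSet g z := by simpa using hx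
        exact Finset.prod_eq_zero (Finset.mem_univ j) (Set.indicator_of_notMem hj _)
    simp_rw [h2]
    rw [lintegral_indicator_one (MeasurableSet.univ_pi fun _ => measurableSet_hitSet hg z),
      Measure.pi_pi, Finset.prod_const, Finset.card_univ, Fintype.card_fin]
    exact pow_le_pow_left' (hκ z) k
  refine (mul_le_mul' le_rfl (ENNReal.tsum_le_tsum h1)).trans_eq ?_
  rw [ENNReal.tsum_mul_right]
  have h3 : ∑' z, (hitSet g z).indicator 1 ((0 : E d), m) = cubes (g m).supp :=
    tsum_congr fun z => (hit_supp m z).symm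
  rw [h3, cubes, sq]
  ring

end Variance

/-! ### Normalized second moments of the mean difference operators in growing windows -/

section Growing

set_option linter.unusedSectionVars false

variable {d : ℕ}

theorem volume_smul {r : ℝ} (hr : 0 ≤ r) (A : Set (E d)) :
    volume (r • A) = ENNReal.ofReal (r ^ d) * volume A := by
  rw [Measure.addHaar_smul_of_nonneg _ hr, finrank_euclideanSpace_fin]

theorem IsCompactConvex.smul {A : Set (E d)} (hA : IsCompactConvex A) (r : ℝ) :
    IsCompactConvex (r • A) := ⟨hA.1.smul r, hA.2.smul r⟩

/-- Rescaling by 1/r ≤ 1 shrinks distances, so the parallel body of r • A lies in r times that of A.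
-/
theorem volume_cthickening_smul_le {A : Set (E d)} (hA : IsCompact A) {r : ℝ} (hr : 1 ≤ r) :
    volume (Metric.cthickening 1 (r • A)) ≤
      ENNReal.ofReal (r ^ d) * volume (Metric.cthickening 1 A) := by
  have hr0 : 0 < r := by linarith
  rw [← volume_smul hr0.le]
  refine measure_mono fun y hy => ?_
  rw [(hA.smul r).cthickening_eq_biUnion_closedBall zero_le_one, Set.mem_iUnion₂] at hy
  obtain ⟨x, ⟨a, ha, rfl⟩, hy⟩ := hy
  refine ⟨r⁻¹ • y, ?_, smul_inv_smul₀ hr0.ne' y⟩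
  refine Metric.mem_cthickening_of_dist_le _ a 1 A ha ?_
  have h1 : dist (r⁻¹ • y) a = r⁻¹ * dist y (r • a) := by
    have h2 : a = r⁻¹ • r • a := (inv_smul_smul₀ hr0.ne' a).symm
    conv_lhs => rw [h2]
    rw [dist_smul₀, Real.norm_of_nonneg (inv_nonneg.mpr hr0.le)]
  rw [h1]
  exact mul_le_one₀ (inv_le_one_of_one_le₀ hr) dist_nonneg (Metric.mem_closedBall.mp hy)

theorem lintegral_comp_smul {f : E d → ℝ≥0∞} (hf : Measurable f) {r : ℝ} (hr : 0 < r) :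
    ∫⁻ v, f v = ENNReal.ofReal (r ^ d) * ∫⁻ w, f (r • w) := by
  have h := lintegral_map (μ := (volume : Measure (E d))) hf (measurable_const_smul r)
  rw [← h, Measure.map_addHaar_smul _ hr.ne', lintegral_smul_measure, finrank_euclideanSpace_fin,
    smul_eq_mul, ← mul_assoc, ← ENNReal.ofReal_mul (by positivity), abs_of_pos (by positivity),
    mul_inv_cancel₀ (by positivity), ENNReal.ofReal_one, one_mul]

variable {𝕄 : Type*} [MeasurableSpace 𝕄]

instance (γ : ℝ≥0) (Q : Measure 𝕄) [IsProbabilityMeasure Q] : SigmaFinite (intensity d γ Q) := by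
  unfold intensity
  infer_instance

theorem lintegral_intensity (γ : ℝ≥0) (Q : Measure 𝕄) [IsProbabilityMeasure Q]
    {f : E d × 𝕄 → ℝ≥0∞} (hf : Measurable f) :
    ∫⁻ p, f p ∂intensity d γ Q = γ * ∫⁻ m, ∫⁻ v, f (v, m) ∂volume ∂Q := by
  rw [intensity, lintegral_smul_measure, lintegral_prod_symm _ hf.aemeasurable, ENNReal.smul_def,
    smul_eq_mul]

theorem lintegral_pi_succ {X : Type*} [MeasurableSpace X] (ρ : Measure X) [SigmaFinite ρ] {n : ℕ}
    {f : (Fin (n + 1) → X) → ℝ≥0∞} (hf : Measurable f) :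
    ∫⁻ x, f x ∂(Measure.pi fun _ => ρ) =
      ∫⁻ x₀, ∫⁻ x, f (Fin.cons x₀ x) ∂(Measure.pi fun _ => ρ) ∂ρ := by
  have h := (measurePreserving_piFinSuccAbove (fun _ : Fin (n + 1) => ρ) 0).symm
  have h1 : Measurable fun a =>
      f ((MeasurableEquiv.piFinSuccAbove (fun _ : Fin (n + 1) => X) 0).symm a) := hf.comp h.measurable
  rw [← h.lintegral_comp hf, lintegral_prod _ h1.aemeasurable]
  simp [MeasurableEquiv.piFinSuccAbove, Fin.insertNthEquiv]

theorem measurePreserving_shift_comp (γ : ℝ≥0) (Q : Measure 𝕄) [IsProbabilityMeasure Q] (v : E d)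
    (k : ℕ) : MeasurePreserving (fun x : Fin k → E d × 𝕄 => shift v ∘ x)
      (Measure.pi fun _ => intensity d γ Q) (Measure.pi fun _ => intensity d γ Q) :=
  measurePreserving_pi (fun _ => intensity d γ Q) (fun _ => intensity d γ Q)
    fun _ => ⟨(shift v).measurable, map_shift_intensity γ Q v⟩

theorem measurable_cons_shift (k : ℕ) : Measurable fun q : E d × 𝕄 × (Fin k → E d × 𝕄) =>
    (Fin.cons (q.1, q.2.1) (shift q.1 ∘ q.2.2) : Fin (k + 1) → E d × 𝕄) := by
  refine measurable_pi_lambda _ fun i => ?_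
  refine Fin.cases ?_ (fun j => ?_) i
  · exact measurable_fst.prodMk measurable_snd.fst
  · have h : Measurable fun q : E d × 𝕄 × (Fin k → E d × 𝕄) => q.2.2 j :=
      (measurable_pi_apply j).comp measurable_snd.snd
    exact (h.fst.add measurable_fst).prodMk h.snd

theorem measurable_cons' {X : Type*} [MeasurableSpace X] (k : ℕ) :
    Measurable fun q : X × (Fin k → X) => (Fin.cons q.1 q.2 : Fin (k + 1) → X) := by
  refine measurable_pi_lambda _ fun i => ?_
  refine Fin.cases measurable_fst (fun j => ?_) i
  exact (measurable_pi_apply j).comp measurable_snd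

/-- Integration with respect to the relative positions of marked points. -/
theorem lintegral_pi_intensity (γ : ℝ≥0) (Q : Measure 𝕄) [IsProbabilityMeasure Q] {k : ℕ}
    {f : (Fin (k + 1) → E d × 𝕄) → ℝ≥0∞} (hf : Measurable f) :
    ∫⁻ y, f y ∂(Measure.pi fun _ => intensity d γ Q) =
      γ * ∫⁻ q, ∫⁻ v, f (Fin.cons (v, q.1) (shift v ∘ q.2)) ∂volume
        ∂(Q.prod (Measure.pi fun _ : Fin k => intensity d γ Q)) := by
  have hm := hf.comp (measurable_cons_shift (d := d) (𝕄 := 𝕄) k)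
  have hc : Measurable fun q : (E d × 𝕄) × (Fin k → E d × 𝕄) =>
      f (Fin.cons q.1 q.2) := hf.comp (measurable_cons' k)
  have h1 : Measurable fun p : E d × 𝕄 => ∫⁻ x : Fin k → E d × 𝕄, f (Fin.cons p x)
      ∂(Measure.pi fun _ => intensity d γ Q) := hc.lintegral_prod_right'
  have h2 : Measurable fun q : 𝕄 × (Fin k → E d × 𝕄) =>
      ∫⁻ v : E d, f (Fin.cons (v, q.1) (shift v ∘ q.2)) := hm.lintegral_prod_left'
  rw [lintegral_pi_succ _ hf, lintegral_prod _ h2.aemeasurable, lintegral_intensity γ Q h1]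
  congr 1
  refine lintegral_congr fun m => ?_
  -- The intensity is invariant under translation, so the other points may be taken relative to v.
  have h3 : ∀ v : E d, ∫⁻ x : Fin k → E d × 𝕄, f (Fin.cons (v, m) x)
      ∂(Measure.pi fun _ => intensity d γ Q) = ∫⁻ x : Fin k → E d × 𝕄,
        f (Fin.cons (v, m) (shift v ∘ x)) ∂(Measure.pi fun _ => intensity d γ Q) := by
    intro v
    have h4 : Measurable fun x : Fin k → E d × 𝕄 => f (Fin.cons (v, m) x) :=
      hc.comp (measurable_const.prodMk measurable_id)
    exact ((measurePreserving_shift_comp γ Q v k).lintegral_comp h4).symm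
  simp_rw [h3]
  refine lintegral_lintegral_swap ?_
  exact (hm.comp (measurable_fst.prodMk (measurable_const.prodMk measurable_snd))).aemeasurable

variable {g : 𝕄 → KernelSpace d} {φ : Set (E d) → ℝ} {W A : Set (E d)} {Ω : Type*}
  [MeasurableSpace Ω] {P : Measure Ω} [IsProbabilityMeasure P] {η : Ω → Measure (E d × 𝕄)}

theorem interSupp_cons_origin {k : ℕ} (m : 𝕄) (x : Fin k → E d × 𝕄) :
    interSupp g (Fin.cons ((0 : E d), m) x : Fin (k + 1) → E d × 𝕄) = commonSupp g m x := by
  rw [interSupp_succ, Fin.cons_zero, Fin.tail_cons, pointSupp, translate_zero]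
  rfl

theorem isCompactConvex_commonSupp {k : ℕ} (m : 𝕄) (x : Fin k → E d × 𝕄) :
    IsCompactConvex (commonSupp g m x) :=
  isCompactConvex_inter_interSupp (g m).2.2.1 x

theorem translate_translate_neg (v : E d) (A : Set (E d)) :
    translate v (translate (-v) A) = A := by
  ext y
  rw [mem_translate, mem_translate, sub_neg_eq_add, sub_add_cancel]

/-- Stationarity puts the first point at the origin, after which localisation replaces the
translated window by its part in the common support. For large windows only this part matters. -/
theorem meanDiff_cons_shift (hg : IsKernelFamily g) (u : ℝ) (hφ : IsGeometricFunctional φ)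
    {γ : ℝ≥0} {Q : Measure 𝕄} [IsProbabilityMeasure Q]
    (hη : IsPoissonProcess (intensity d γ Q) η P) {κ : ℝ≥0}
    (hκ : ∀ z, intensity d γ Q (hitSet g z) ≤ κ) (hA : IsCompactConvex A) {k : ℕ} (v : E d) (m : 𝕄)
    (x : Fin k → E d × 𝕄) :
    meanDiff P η φ g u A (k + 1) (Fin.cons (v, m) (shift v ∘ x)) =
      meanDiff P η φ g u (translate (-v) A ∩ commonSupp g m x) (k + 1)
        (Fin.cons ((0 : E d), m) x) := by
  have h1 : (Fin.cons (v, m) (shift v ∘ x) : Fin (k + 1) → E d × 𝕄) =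
      shift v ∘ (Fin.cons ((0 : E d), m) x : Fin (k + 1) → E d × 𝕄) := by
    funext i
    refine Fin.cases ?_ (fun j => ?_) i
    · rw [Fin.cons_zero, Function.comp_apply, Fin.cons_zero, shift_apply, zero_add]
    · rw [Fin.cons_succ, Function.comp_apply, Function.comp_apply, Fin.cons_succ]
  have hA' := hA.translate (-v)
  rw [h1]
  nth_rewrite 1 [← translate_translate_neg v A]
  rw [meanDiff_shift hg u hφ hη hκ hA' v (map_shift_intensity γ Q v),
    meanDiff_inter hg u hφ hη hκ hA', interSupp_cons_origin]

/-- The squared mean difference operator of the window `A`, as a function of the first location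
and of the relative positions of the other points. -/
def sqDiff (P : Measure Ω) (η : Ω → Measure (E d × 𝕄)) (φ : Set (E d) → ℝ)
    (g : 𝕄 → KernelSpace d) (u : ℝ) (A : Set (E d)) {k : ℕ} (q : 𝕄 × (Fin k → E d × 𝕄))
    (v : E d) : ℝ≥0∞ :=
  ENNReal.ofReal (meanDiff P η φ g u A (k + 1) (Fin.cons (v, q.1) (shift v ∘ q.2)) ^ 2)

/-- The squared mean of the difference operator at the origin. -/
def sqOrigin (P : Measure Ω) (η : Ω → Measure (E d × 𝕄)) (φ : Set (E d) → ℝ)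
    (g : 𝕄 → KernelSpace d) (u : ℝ) {k : ℕ} (q : 𝕄 × (Fin k → E d × 𝕄)) : ℝ≥0∞ :=
  ENNReal.ofReal ((∫ ω, originDiff φ g u q.1 q.2 (η ω) ∂P) ^ 2)

/-- The normalized integral of the squared mean difference operator. -/
def normDiff (P : Measure Ω) (η : Ω → Measure (E d × 𝕄)) (φ : Set (E d) → ℝ)
    (g : 𝕄 → KernelSpace d) (u : ℝ) (A : Set (E d)) {k : ℕ} (q : 𝕄 × (Fin k → E d × 𝕄)) : ℝ≥0∞ :=
  (volume A)⁻¹ * ∫⁻ v, sqDiff P η φ g u A q v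

theorem measurable_sqDiff (hg : IsKernelFamily g) (u : ℝ) (hφ : IsGeometricFunctional φ)
    {γ : ℝ≥0} {Q : Measure 𝕄} [IsProbabilityMeasure Q]
    (hη : IsPoissonProcess (intensity d γ Q) η P) {κ : ℝ≥0}
    (hκ : ∀ z, intensity d γ Q (hitSet g z) ≤ κ) (hA : IsCompactConvex A) (k : ℕ) :
    Measurable fun q : E d × 𝕄 × (Fin k → E d × 𝕄) => sqDiff P η φ g u A q.2 q.1 :=
  (((measurable_meanDiff hg u hφ hη hκ hA (k + 1)).comp
    (measurable_cons_shift k)).pow_const 2).ennreal_ofReal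

theorem measurable_normDiff (hg : IsKernelFamily g) (u : ℝ) (hφ : IsGeometricFunctional φ)
    {γ : ℝ≥0} {Q : Measure 𝕄} [IsProbabilityMeasure Q]
    (hη : IsPoissonProcess (intensity d γ Q) η P) {κ : ℝ≥0}
    (hκ : ∀ z, intensity d γ Q (hitSet g z) ≤ κ) (hA : IsCompactConvex A) (k : ℕ) :
    Measurable fun q : 𝕄 × (Fin k → E d × 𝕄) => normDiff P η φ g u A q :=
  (measurable_sqDiff hg u hφ hη hκ hA k).lintegral_prod_left'.const_mul _

theorem lintegral_sq_meanDiff (hg : IsKernelFamily g) (u : ℝ) (hφ : IsGeometricFunctional φ)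
    {γ : ℝ≥0} {Q : Measure 𝕄} [IsProbabilityMeasure Q]
    (hη : IsPoissonProcess (intensity d γ Q) η P) {κ : ℝ≥0}
    (hκ : ∀ z, intensity d γ Q (hitSet g z) ≤ κ) (hA : IsCompactConvex A) (hA0 : volume A ≠ 0) (k : ℕ) :
    ∫⁻ y, ENNReal.ofReal (meanDiff P η φ g u A (k + 1) y ^ 2)
      ∂(Measure.pi fun _ => intensity d γ Q) =
      volume A * (γ * ∫⁻ q, normDiff P η φ g u A q
        ∂(Q.prod (Measure.pi fun _ : Fin k => intensity d γ Q))) := by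
  rw [lintegral_pi_intensity γ Q
    ((measurable_meanDiff hg u hφ hη hκ hA (k + 1)).pow_const 2).ennreal_ofReal]
  have h : ∀ q : 𝕄 × (Fin k → E d × 𝕄), normDiff P η φ g u A q = (volume A)⁻¹ *
    ∫⁻ v, sqDiff P η φ g u A q v := fun q => rfl
  simp_rw [h]
  rw [lintegral_const_mul _ (measurable_sqDiff hg u hφ hη hκ hA k).lintegral_prod_left',
    mul_left_comm _ (volume A)⁻¹, ← mul_assoc (volume A),
    ENNReal.mul_inv_cancel hA0 hA.1.measure_lt_top.ne, one_mul]
  rfl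

/-- The base 16 is the square of the cost 4 of one difference. -/
theorem exists_sqDiff_le (hg : IsKernelFamily g) (u : ℝ) (hφ : IsGeometricFunctional φ)
    {γ : ℝ≥0} {Q : Measure 𝕄} [IsProbabilityMeasure Q]
    (hη : IsPoissonProcess (intensity d γ Q) η P) {κ : ℝ≥0}
    (hκ : ∀ z, intensity d γ Q (hitSet g z) ≤ κ) : ∃ c : ℝ≥0, ∀ (A : Set (E d)), IsCompactConvex A →
    ∀ (k : ℕ) (q : 𝕄 × (Fin k → E d × 𝕄)) (v : E d), sqDiff P η φ g u A q v ≤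
      16 ^ (k + 1) * c * cubes (translate (-v) A ∩ commonSupp g q.1 q.2) ^ 2 := by
  obtain ⟨c, hc0, hc⟩ := exists_abs_meanDiff_le hg u hφ hη hκ
  refine ⟨(c ^ 2).toNNReal, fun A hA k q v => ?_⟩
  have hK := (hA.translate (-v)).inter (isCompactConvex_commonSupp (g := g) q.1 q.2)
  rw [sqDiff, meanDiff_cons_shift hg u hφ hη hκ hA]
  have h := pow_le_pow_left₀ (abs_nonneg _)
    (hc _ hK (k + 1) (Fin.cons ((0 : E d), q.1) q.2)) 2
  rw [sq_abs] at h
  refine (ENNReal.ofReal_le_ofReal h).trans_eq ?_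
  have h4 : (4 : ℝ) ^ 2 = 16 := by norm_num
  rw [mul_pow, mul_pow, pow_right_comm, h4, ENNReal.ofReal_mul (by positivity),
    ENNReal.ofReal_mul (by positivity), ENNReal.ofReal_pow (by norm_num),
    ENNReal.ofReal_pow ENNReal.toReal_nonneg, ENNReal.ofReal_toReal (cubes_ne_top hK.1.isBounded),
    mul_assoc, mul_comm (cubes _ ^ 2)]
  congr 2
  norm_num

theorem translate_neg_inter_nonempty_iff {A U : Set (E d)} {v : E d} :
    (translate (-v) A ∩ U).Nonempty ↔ ∃ y ∈ A, y - v ∈ U := by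
  constructor
  · rintro ⟨y, hy, hyU⟩
    rw [mem_translate, sub_neg_eq_add] at hy
    exact ⟨y + v, hy, by rwa [add_sub_cancel_right]⟩
  · rintro ⟨y, hy, hyU⟩
    exact ⟨y - v, by rwa [mem_translate, sub_neg_eq_add, sub_add_cancel], hyU⟩

theorem isOpen_setOf_translate_hits (A : Set (E d)) {U : Set (E d)} (hU : IsOpen U) :
    IsOpen {v : E d | (translate (-v) A ∩ U).Nonempty} := by
  have h : {v : E d | (translate (-v) A ∩ U).Nonempty} = ⋃ y ∈ A, (fun v => y - v) ⁻¹' U := by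
    ext v
    rw [Set.mem_iUnion₂]
    exact translate_neg_inter_nonempty_iff.trans (by simp)
  rw [h]
  exact isOpen_biUnion fun y _ => hU.preimage (by fun_prop)

/-- One factor is bounded by the cubes of K. In the other, the translations that bring A to a given
cube have volume at most that of the parallel body of A. -/
theorem lintegral_sq_cubes_translate_inter_le (A K : Set (E d)) :
    ∫⁻ v, cubes (translate (-v) A ∩ K) ^ 2 ≤
      cubes K ^ 2 * volume (Metric.cthickening 1 A) := by
  set S : (Fin d → ℤ) → Set (E d) := fun z => {v | (translate (-v) A ∩ nhdCube z).Nonempty}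
  have hS : ∀ z, MeasurableSet (S z) := fun z =>
    (isOpen_setOf_translate_hits A (isOpen_nhdCube z)).measurableSet
  have hSv : ∀ z, volume (S z) ≤ volume (Metric.cthickening 1 A) := by
    intro z
    refine le_trans (le_of_eq ?_) (volume_setOf_hits_le A z)
    have h : S z = Neg.neg ⁻¹' {x : E d | (translate x A ∩ nhdCube z).Nonempty} := rfl
    rw [h, Measure.measure_preimage_neg]
  have hle : ∀ v, cubes (translate (-v) A ∩ K) ^ 2 ≤
      cubes K * ∑' z, hit K z * (S z).indicator 1 v := by
    intro v
    rw [sq]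
    refine mul_le_mul' (cubes_mono Set.inter_subset_right) (ENNReal.tsum_le_tsum fun z => ?_)
    by_cases hv : v ∈ S z
    · rw [Set.indicator_of_mem hv, Pi.one_apply, mul_one]
      exact hit_mono Set.inter_subset_right z
    · rw [Set.indicator_of_notMem hv, mul_zero, hit, if_neg]
      exact fun h => hv (h.mono (Set.inter_subset_inter_left _ Set.inter_subset_left))
  refine (lintegral_mono hle).trans ?_
  have hm : ∀ z, Measurable ((S z).indicator (1 : E d → ℝ≥0∞)) := fun z =>
    measurable_one.indicator (hS z)
  rw [lintegral_const_mul _ (Measurable.tsum fun z => (hm z).const_mul _),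
    lintegral_tsum fun z => ((hm z).const_mul _).aemeasurable, sq, mul_assoc]
  refine mul_le_mul' le_rfl ?_
  rw [cubes, ← ENNReal.tsum_mul_right]
  refine ENNReal.tsum_le_tsum fun z => ?_
  rw [lintegral_const_mul _ (hm z), lintegral_indicator_one (hS z)]
  exact mul_le_mul' le_rfl (hSv z)

end Growing

/-! ### The limits in growing windows -/

section Limits

set_option linter.unusedSectionVars false

variable {d : ℕ} {𝕄 : Type*} [MeasurableSpace 𝕄] {g : 𝕄 → KernelSpace d}
  {φ : Set (E d) → ℝ} {W A : Set (E d)} {Ω : Type*} [MeasurableSpace Ω] {P : Measure Ω}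
  [IsProbabilityMeasure P] {η : Ω → Measure (E d × 𝕄)}

/-- The parallel body of r • W and r • W itself both scale like r^d, so normalisation removes r. The
majorant is the same for all r ≥ 1. -/
theorem exists_normDiff_le (hg : IsKernelFamily g) (u : ℝ) (hφ : IsGeometricFunctional φ)
    {γ : ℝ≥0} {Q : Measure 𝕄} [IsProbabilityMeasure Q]
    (hη : IsPoissonProcess (intensity d γ Q) η P) {κ : ℝ≥0}
    (hκ : ∀ z, intensity d γ Q (hitSet g z) ≤ κ) (hW : IsCompactConvex W)
    (hW0 : volume W ≠ 0) : ∃ c : ℝ≥0, ∀ r : ℝ, 1 ≤ r → ∀ (k : ℕ)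
      (q : 𝕄 × (Fin k → E d × 𝕄)), normDiff P η φ g u (r • W) q ≤
        16 ^ (k + 1) * c * cubesBound g q := by
  obtain ⟨c, hc⟩ := exists_sqDiff_le hg u hφ hη hκ
  set V := volume (Metric.cthickening 1 W) with hV
  have hVt : V ≠ ⊤ := hW.1.isBounded.cthickening.measure_lt_top.ne
  have hWt : volume W ≠ ⊤ := hW.1.measure_lt_top.ne
  refine ⟨c * (V / volume W).toNNReal, fun r hr k q => ?_⟩
  have hr0 : 0 < r := by linarith
  set s := ENNReal.ofReal (r ^ d)
  have hs0 : s ≠ 0 := by simpa [s] using pow_pos hr0 d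
  have hst : s ≠ ⊤ := ENNReal.ofReal_ne_top
  have h1 : ∫⁻ v, sqDiff P η φ g u (r • W) q v ≤
      16 ^ (k + 1) * c * (cubesBound g q * (s * V)) := by
    refine (lintegral_mono fun v => hc _ (hW.smul r) k q v).trans ?_
    rw [lintegral_const_mul' _ _ (ENNReal.mul_ne_top (ENNReal.pow_ne_top (by norm_num))
      ENNReal.coe_ne_top)]
    refine mul_le_mul' le_rfl ((lintegral_sq_cubes_translate_inter_le _ _).trans ?_)
    exact mul_le_mul' (cubes_commonSupp_sq_le q) (volume_cthickening_smul_le hW.1 hr)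
  rw [normDiff, volume_smul hr0.le]
  refine (mul_le_mul' le_rfl h1).trans_eq ?_
  rw [ENNReal.coe_mul, ENNReal.coe_toNNReal (ENNReal.div_ne_top hVt hW0),
    ENNReal.mul_inv (Or.inl hs0) (Or.inl hst), div_eq_mul_inv]
  calc s⁻¹ * (volume W)⁻¹ * (16 ^ (k + 1) * c * (cubesBound g q * (s * V)))
      = (s⁻¹ * s) * (16 ^ (k + 1) * (c * (V * (volume W)⁻¹)) * cubesBound g q) := by ring
    _ = _ := by rw [ENNReal.inv_mul_cancel hs0 hst, one_mul]

theorem mem_translate_smul_iff {r : ℝ} (hr : r ≠ 0) {w y : E d} :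
    y ∈ translate (-(r • w)) (r • W) ↔ w + r⁻¹ • y ∈ W := by
  rw [mem_translate, sub_neg_eq_add, Set.mem_smul_set_iff_inv_smul_mem₀ hr, smul_add,
    inv_smul_smul₀ hr, add_comm]

theorem eventually_forall_add_inv_smul_mem {K S : Set (E d)} (hK : Bornology.IsBounded K)
    (hS : IsOpen S) {w : E d} (hw : w ∈ S) :
    ∀ᶠ r : ℝ in atTop, r ≠ 0 ∧ ∀ y ∈ K, w + r⁻¹ • y ∈ S := by
  obtain ⟨ε, hε, hball⟩ := Metric.isOpen_iff.mp hS w hw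
  obtain ⟨R, hR⟩ := hK.subset_closedBall 0
  filter_upwards [eventually_gt_atTop (0 : ℝ), eventually_gt_atTop (R / ε)] with r hr0 hr
  refine ⟨hr0.ne', fun y hy => hball ?_⟩
  have h1 : ‖y‖ ≤ R := by simpa using hR hy
  rw [div_lt_iff₀ hε] at hr
  rw [Metric.mem_ball, dist_self_add_left, norm_smul, Real.norm_of_nonneg (inv_nonneg.mpr hr0.le),
    inv_mul_lt_iff₀ hr0]
  linarith

theorem sqDiff_eq_sqOrigin (hg : IsKernelFamily g) (u : ℝ) (hφ : IsGeometricFunctional φ)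
    {γ : ℝ≥0} {Q : Measure 𝕄} [IsProbabilityMeasure Q]
    (hη : IsPoissonProcess (intensity d γ Q) η P) {κ : ℝ≥0}
    (hκ : ∀ z, intensity d γ Q (hitSet g z) ≤ κ) (hA : IsCompactConvex A) {k : ℕ}
    (q : 𝕄 × (Fin k → E d × 𝕄)) {v : E d} (h : commonSupp g q.1 q.2 ⊆ translate (-v) A) :
    sqDiff P η φ g u A q v = sqOrigin P η φ g u q := by
  rw [sqDiff, meanDiff_cons_shift hg u hφ hη hκ hA, Set.inter_eq_right.mpr h]
  rfl

theorem sqDiff_eq_zero (hg : IsKernelFamily g) (u : ℝ) (hφ : IsGeometricFunctional φ)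
    {γ : ℝ≥0} {Q : Measure 𝕄} [IsProbabilityMeasure Q]
    (hη : IsPoissonProcess (intensity d γ Q) η P) {κ : ℝ≥0}
    (hκ : ∀ z, intensity d γ Q (hitSet g z) ≤ κ) (hW : IsCompactConvex W) {r : ℝ} {k : ℕ}
    (q : 𝕄 × (Fin k → E d × 𝕄)) {v : E d}
    (h : translate (-v) (r • W) ∩ commonSupp g q.1 q.2 = ∅) :
    sqDiff P η φ g u (r • W) q v = 0 := by
  rw [sqDiff, meanDiff_cons_shift hg u hφ hη hκ (hW.smul r), h, meanDiff_empty u hφ,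
    zero_pow two_ne_zero, ENNReal.ofReal_zero]

/-- After rescaling, the contributing locations stay in one ball for all r ≥ 1, as the dominated
convergence in w requires. -/
theorem norm_le_of_translate_smul_inter_nonempty {K : Set (E d)} {R₀ R₁ : ℝ}
    (hR₀ : W ⊆ Metric.closedBall 0 R₀) (hR₁ : K ⊆ Metric.closedBall 0 R₁) {r : ℝ} (hr : 1 ≤ r)
    {w : E d} (h : (translate (-(r • w)) (r • W) ∩ K).Nonempty) : ‖w‖ ≤ R₀ + R₁ := by
  have hr0 : 0 < r := by linarith
  obtain ⟨y, hy, hyK⟩ := h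
  rw [mem_translate_smul_iff hr0.ne'] at hy
  have h1 : ‖y‖ ≤ R₁ := mem_closedBall_zero_iff.mp (hR₁ hyK)
  have h2 : ‖w + r⁻¹ • y‖ ≤ R₀ := mem_closedBall_zero_iff.mp (hR₀ hy)
  have h3 : ‖r⁻¹ • y‖ ≤ ‖y‖ := by
    rw [norm_smul, Real.norm_of_nonneg (inv_nonneg.mpr hr0.le)]
    exact mul_le_of_le_one_left (norm_nonneg _) (inv_le_one_of_one_le₀ hr)
  have h4 : ‖w‖ ≤ ‖w + r⁻¹ • y‖ + ‖r⁻¹ • y‖ := by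
    have := norm_sub_le (w + r⁻¹ • y) (r⁻¹ • y)
    rwa [add_sub_cancel_right] at this
  linarith

/-- Seen from r • w, the scaled window eventually contains the bounded common support if w is
interior to W, and eventually misses it if w is outside. The value is thus eventually constant. -/
theorem tendsto_sqDiff_smul (hg : IsKernelFamily g) (u : ℝ) (hφ : IsGeometricFunctional φ)
    {γ : ℝ≥0} {Q : Measure 𝕄} [IsProbabilityMeasure Q]
    (hη : IsPoissonProcess (intensity d γ Q) η P) {κ : ℝ≥0}
    (hκ : ∀ z, intensity d γ Q (hitSet g z) ≤ κ) (hW : IsCompactConvex W) {k : ℕ}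
    (q : 𝕄 × (Fin k → E d × 𝕄)) {w : E d} (hw : w ∉ frontier W) :
    Tendsto (fun r : ℝ => sqDiff P η φ g u (r • W) q (r • w)) atTop
      (𝓝 (W.indicator (fun _ => sqOrigin P η φ g u q) w)) := by
  have hK : IsCompactConvex (commonSupp g q.1 q.2) := isCompactConvex_commonSupp q.1 q.2
  by_cases hwW : w ∈ W
  · have hwi : w ∈ interior W := by
      by_contra h
      exact hw ⟨subset_closure hwW, h⟩
    rw [Set.indicator_of_mem hwW]
    refine tendsto_const_nhds.congr' ?_
    filter_upwards [eventually_forall_add_inv_smul_mem hK.1.isBounded isOpen_interior hwi]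
      with r hr
    refine (sqDiff_eq_sqOrigin hg u hφ hη hκ (hW.smul r) q fun y hy => ?_).symm
    rw [mem_translate_smul_iff hr.1]
    exact interior_subset (hr.2 y hy)
  · rw [Set.indicator_of_notMem hwW]
    refine tendsto_const_nhds.congr' ?_
    filter_upwards [eventually_forall_add_inv_smul_mem hK.1.isBounded
      hW.1.isClosed.isOpen_compl hwW] with r hr
    refine (sqDiff_eq_zero hg u hφ hη hκ hW q ?_).symm
    refine Set.eq_empty_of_forall_notMem fun y hy => ?_
    rw [Set.mem_inter_iff, mem_translate_smul_iff hr.1] at hy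
    exact hr.2 y hy.2 hy.1

theorem measurable_sqDiff_left (hg : IsKernelFamily g) (u : ℝ) (hφ : IsGeometricFunctional φ)
    {γ : ℝ≥0} {Q : Measure 𝕄} [IsProbabilityMeasure Q]
    (hη : IsPoissonProcess (intensity d γ Q) η P) {κ : ℝ≥0}
    (hκ : ∀ z, intensity d γ Q (hitSet g z) ≤ κ) (hA : IsCompactConvex A) {k : ℕ}
    (q : 𝕄 × (Fin k → E d × 𝕄)) : Measurable (sqDiff P η φ g u A q) := by
  have h2 : Measurable fun v : E d => (v, q) := measurable_prodMk_right
  have h1 := (((measurable_meanDiff hg u hφ hη hκ hA (k + 1)).comp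
    ((measurable_cons_shift k).comp h2)).pow_const 2).ennreal_ofReal
  exact h1

theorem tendsto_lintegral_sqDiff_smul (hg : IsKernelFamily g) (u : ℝ) (hφ : IsGeometricFunctional φ)
    {γ : ℝ≥0} {Q : Measure 𝕄} [IsProbabilityMeasure Q]
    (hη : IsPoissonProcess (intensity d γ Q) η P) {κ : ℝ≥0}
    (hκ : ∀ z, intensity d γ Q (hitSet g z) ≤ κ) (hW : IsCompactConvex W) {k : ℕ}
    (q : 𝕄 × (Fin k → E d × 𝕄)) :
    Tendsto (fun r : ℝ => ∫⁻ w, sqDiff P η φ g u (r • W) q (r • w)) atTop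
      (𝓝 (∫⁻ w, W.indicator (fun _ => sqOrigin P η φ g u q) w)) := by
  obtain ⟨c, hc⟩ := exists_sqDiff_le hg u hφ hη hκ
  have hK : IsCompactConvex (commonSupp g q.1 q.2) := isCompactConvex_commonSupp q.1 q.2
  obtain ⟨R₀, hR₀⟩ := hW.1.isBounded.subset_closedBall 0
  obtain ⟨R₁, hR₁⟩ := hK.1.isBounded.subset_closedBall 0
  have hmeas : ∀ r : ℝ, Measurable (sqDiff P η φ g u (r • W) q) := fun r =>
    measurable_sqDiff_left hg u hφ hη hκ (hW.smul r) q
  refine tendsto_lintegral_filter_of_dominated_convergence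
    ((Metric.closedBall (0 : E d) (R₀ + R₁)).indicator fun _ =>
      16 ^ (k + 1) * c * cubes (commonSupp g q.1 q.2) ^ 2)
    (Eventually.of_forall fun r => (hmeas r).comp (measurable_const_smul r)) ?_ ?_ ?_
  · filter_upwards [eventually_ge_atTop (1 : ℝ)] with r hr
    refine ae_of_all _ fun w => ?_
    rcases Set.eq_empty_or_nonempty
      (translate (-(r • w)) (r • W) ∩ commonSupp g q.1 q.2) with h | h
    · rw [sqDiff_eq_zero hg u hφ hη hκ hW q h]
      exact zero_le
    · have hw := mem_closedBall_zero_iff.mpr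
        (norm_le_of_translate_smul_inter_nonempty hR₀ hR₁ hr h)
      rw [Set.indicator_of_mem hw]
      refine (hc _ (hW.smul r) k q _).trans ?_
      exact mul_le_mul' le_rfl (pow_le_pow_left' (cubes_mono Set.inter_subset_right) 2)
  · rw [lintegral_indicator_const Metric.isClosed_closedBall.measurableSet]
    refine ENNReal.mul_ne_top (ENNReal.mul_ne_top (ENNReal.mul_ne_top ?_ ENNReal.coe_ne_top)
      (ENNReal.pow_ne_top (cubes_ne_top hK.1.isBounded)))
      (isCompact_closedBall _ _).measure_lt_top.ne
    exact ENNReal.pow_ne_top (by norm_num)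
  · filter_upwards [measure_eq_zero_iff_ae_notMem.mp (hW.2.addHaar_frontier volume)] with w hw
    exact tendsto_sqDiff_smul hg u hφ hη hκ hW q hw

theorem tendsto_normDiff (hg : IsKernelFamily g) (u : ℝ) (hφ : IsGeometricFunctional φ)
    {γ : ℝ≥0} {Q : Measure 𝕄} [IsProbabilityMeasure Q]
    (hη : IsPoissonProcess (intensity d γ Q) η P) {κ : ℝ≥0}
    (hκ : ∀ z, intensity d γ Q (hitSet g z) ≤ κ) (hW : IsCompactConvex W)
    (hW0 : volume W ≠ 0) {k : ℕ} (q : 𝕄 × (Fin k → E d × 𝕄)) :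
    Tendsto (fun r : ℝ => normDiff P η φ g u (r • W) q) atTop (𝓝 (sqOrigin P η φ g u q)) := by
  have hWt : volume W ≠ ⊤ := hW.1.measure_lt_top.ne
  have hlim := tendsto_lintegral_sqDiff_smul hg u hφ hη hκ hW q
  rw [lintegral_indicator_const hW.1.isClosed.measurableSet] at hlim
  have hlim2 := ENNReal.Tendsto.const_mul hlim (a := (volume W)⁻¹)
    (Or.inr (ENNReal.inv_ne_top.mpr hW0))
  rw [mul_left_comm, ENNReal.inv_mul_cancel hW0 hWt, mul_one] at hlim2
  refine hlim2.congr' ?_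
  filter_upwards [eventually_gt_atTop (0 : ℝ)] with r hr
  have hmeas : Measurable (sqDiff P η φ g u (r • W) q) :=
    measurable_sqDiff_left hg u hφ hη hκ (hW.smul r) q
  have hs0 : ENNReal.ofReal (r ^ d) ≠ 0 := by simpa using pow_pos hr d
  rw [normDiff, volume_smul hr.le, lintegral_comp_smul hmeas hr,
    ENNReal.mul_inv (Or.inl hs0) (Or.inl ENNReal.ofReal_ne_top), mul_mul_mul_comm,
    ENNReal.inv_mul_cancel hs0 ENNReal.ofReal_ne_top, one_mul]

/-- The window of the origin term varies with q, so measurability is obtained from limits of terms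
with fixed windows, along integer r. -/
theorem measurable_sqOrigin (hg : IsKernelFamily g) (u : ℝ) (hφ : IsGeometricFunctional φ)
    {γ : ℝ≥0} {Q : Measure 𝕄} [IsProbabilityMeasure Q]
    (hη : IsPoissonProcess (intensity d γ Q) η P) {κ : ℝ≥0}
    (hκ : ∀ z, intensity d γ Q (hitSet g z) ≤ κ) (hW : IsCompactConvex W)
    (hW0 : volume W ≠ 0) (k : ℕ) :
    Measurable fun q : 𝕄 × (Fin k → E d × 𝕄) => sqOrigin P η φ g u q := by
  refine measurable_of_tendsto_metrizable
    (f := fun n : ℕ => fun q => normDiff P η φ g u ((n : ℝ) • W) q)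
    (fun n => measurable_normDiff hg u hφ hη hκ (hW.smul n) k) (tendsto_pi_nhds.mpr fun q => ?_)
  exact (tendsto_normDiff hg u hφ hη hκ hW hW0 q).comp tendsto_natCast_atTop_atTop

theorem integral_sq_meanDiff_div (hg : IsKernelFamily g) (u : ℝ) (hφ : IsGeometricFunctional φ)
    {γ : ℝ≥0} {Q : Measure 𝕄} [IsProbabilityMeasure Q]
    (hη : IsPoissonProcess (intensity d γ Q) η P) {κ : ℝ≥0}
    (hκ : ∀ z, intensity d γ Q (hitSet g z) ≤ κ) (hA : IsCompactConvex A) (hA0 : volume A ≠ 0)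
    (k : ℕ) :
    (∫ y, meanDiff P η φ g u A (k + 1) y ^ 2 ∂(Measure.pi fun _ => intensity d γ Q)) /
      volume.real A = γ * (∫⁻ q, normDiff P η φ g u A q
        ∂(Q.prod (Measure.pi fun _ : Fin k => intensity d γ Q))).toReal := by
  rw [integral_eq_lintegral_of_nonneg_ae (ae_of_all _ fun y => sq_nonneg _)
    ((measurable_meanDiff hg u hφ hη hκ hA (k + 1)).pow_const 2).aestronglyMeasurable,
    lintegral_sq_meanDiff hg u hφ hη hκ hA hA0, ENNReal.toReal_mul, ENNReal.toReal_mul,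
    measureReal_def, mul_div_cancel_left₀ _ (ENNReal.toReal_ne_zero.mpr
      ⟨hA0, hA.1.measure_lt_top.ne⟩), ENNReal.coe_toReal]

/-- The integrable majorant of `normDiff` serves twice: for the limit at fixed k, and for a bound
geometric in k that the factorials will absorb. -/
theorem exists_lintegral_normDiff_le (hd : 1 ≤ d) (hg : IsKernelFamily g) (u : ℝ)
    (hφ : IsGeometricFunctional φ) {γ : ℝ≥0} {Q : Measure 𝕄} [IsProbabilityMeasure Q]
    (hmoment : ∀ i : ℕ, 1 ≤ i → i ≤ d →
      Integrable (fun m => intrinsicVolume i (g m).supp ^ 2) Q)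
    (hη : IsPoissonProcess (intensity d γ Q) η P) {κ : ℝ≥0}
    (hκ : ∀ z, intensity d γ Q (hitSet g z) ≤ κ) (hW : IsCompactConvex W)
    (hW0 : volume W ≠ 0) : ∃ c : ℝ≥0, ∀ k : ℕ,
      (∀ r : ℝ, 1 ≤ r → ∫⁻ q, normDiff P η φ g u (r • W) q
        ∂(Q.prod (Measure.pi fun _ : Fin k => intensity d γ Q)) ≤ (c * (16 * κ) ^ k : ℝ≥0)) ∧
      Tendsto (fun r : ℝ => ∫⁻ q, normDiff P η φ g u (r • W) q
        ∂(Q.prod (Measure.pi fun _ : Fin k => intensity d γ Q))) atTop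
        (𝓝 (∫⁻ q, sqOrigin P η φ g u q
          ∂(Q.prod (Measure.pi fun _ : Fin k => intensity d γ Q)))) := by
  obtain ⟨c, hc⟩ := exists_normDiff_le hg u hφ hη hκ hW hW0
  have hM := (lintegral_sq_cubes_lt_top hd hg Q hmoment).ne
  set M := ∫⁻ m, cubes (g m).supp ^ 2 ∂Q with hMdef
  have hle : ∀ k : ℕ, ∫⁻ q, 16 ^ (k + 1) * c * cubesBound g q
      ∂(Q.prod (Measure.pi fun _ : Fin k => intensity d γ Q)) ≤
        (16 * c * M.toNNReal * (16 * κ) ^ k : ℝ≥0) := by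
    intro k
    rw [lintegral_const_mul _ (measurable_cubesBound hg k)]
    refine (mul_le_mul' le_rfl (lintegral_cubesBound_le hg hκ Q k)).trans_eq ?_
    push_cast
    rw [ENNReal.coe_toNNReal hM, ← hMdef]
    ring
  refine ⟨16 * c * M.toNNReal, fun k => ⟨fun r hr =>
    (lintegral_mono fun q => hc r hr k q).trans (hle k), ?_⟩⟩
  refine tendsto_lintegral_filter_of_dominated_convergence
    (fun q => 16 ^ (k + 1) * c * cubesBound g q)
    (Eventually.of_forall fun r => measurable_normDiff hg u hφ hη hκ (hW.smul r) k) ?_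
    ((hle k).trans_lt ENNReal.coe_lt_top).ne
    (ae_of_all _ fun q => tendsto_normDiff hg u hφ hη hκ hW hW0 q)
  filter_upwards [eventually_ge_atTop (1 : ℝ)] with r hr
  exact ae_of_all _ fun q => hc r hr k q

end Limits

end

end ShotNoise

/-! ### The asymptotic variance. -/

theorem mainTheorem2 {d : ℕ} (hd : 1 ≤ d)
    {𝕄 : Type*} [MeasurableSpace 𝕄] (Q : Measure 𝕄) [IsProbabilityMeasure Q]
    (γ : ℝ≥0) (hγ : 0 < γ)
    {Ω : Type*} [MeasurableSpace Ω] (P : Measure Ω) [IsProbabilityMeasure P]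
    (η : Ω → Measure (ShotNoise.E d × 𝕄))
    (hη : ShotNoise.IsPoissonProcess (ShotNoise.intensity d γ Q) η P)
    (g : 𝕄 → ShotNoise.KernelSpace d) (hg : ShotNoise.IsKernelFamily g)
    (hmoment : ∀ i : ℕ, 1 ≤ i → i ≤ d →
      Integrable (fun m => ShotNoise.intrinsicVolume i (g m).supp ^ 2) Q)
    (φ : Set (ShotNoise.E d) → ℝ) (hφ : ShotNoise.IsGeometricFunctional φ)
    (u : ℝ) (hu : 0 < u)
    (W : Set (ShotNoise.E d)) (hW : ShotNoise.IsCompactConvex W) (hWpos : 0 < volume W) :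
    -- the random variables are square-integrable, so that the variance is meaningful
    (∀ r : ℝ, 1 ≤ r →
      MemLp (fun ω => φ (ShotNoise.excursionSet g u (η ω) ∩ r • W)) 2 P) ∧
    -- the expectations of the difference operators exist
    (∀ (k : ℕ) (m : 𝕄) (x : Fin k → ShotNoise.E d × 𝕄),
      Integrable (fun ω => ShotNoise.originDiff φ g u m x (η ω)) P) ∧
    -- their squares are integrable
    (∀ k : ℕ, Integrable
      (fun p : 𝕄 × (Fin k → ShotNoise.E d × 𝕄) =>
        (∫ ω, ShotNoise.originDiff φ g u p.1 p.2 (η ω) ∂P) ^ 2)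
      (Q.prod (Measure.pi fun _ => ShotNoise.intensity d γ Q))) ∧
    -- the series (indexed by `n = k + 1`) converges and its sum is the asymptotic variance
    ∃ σ₀ : ℝ,
      HasSum
        (fun k : ℕ => (γ : ℝ) / (Nat.factorial (k + 1) : ℝ) *
          ∫ m, ∫ x : Fin k → ShotNoise.E d × 𝕄,
            (∫ ω, ShotNoise.originDiff φ g u m x (η ω) ∂P) ^ 2
            ∂(Measure.pi fun _ => ShotNoise.intensity d γ Q) ∂Q) σ₀ ∧
      Tendsto
        (fun r : ℝ =>
          variance (fun ω => φ (ShotNoise.excursionSet g u (η ω) ∩ r • W)) P /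
            volume.real (r • W))
        atTop (𝓝 σ₀) := by
  obtain ⟨κ, hκ⟩ := ShotNoise.exists_intensity_hitSet_le hd hg Q γ hmoment
  have hW0 := hWpos.ne'
  obtain ⟨c, hc⟩ := ShotNoise.exists_lintegral_normDiff_le hd hg u hφ hmoment hη hκ hW hW0
  set ρ : (k : ℕ) → Measure (𝕄 × (Fin k → ShotNoise.E d × 𝕄)) := fun k =>
    Q.prod (Measure.pi fun _ => ShotNoise.intensity d γ Q) with hρ
  set I : ℕ → ℝ≥0∞ := fun k => ∫⁻ q, ShotNoise.sqOrigin P η φ g u q ∂ρ k with hI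
  have hIle : ∀ k, I k ≤ (c * (16 * κ) ^ k : ℝ≥0) := fun k =>
    le_of_tendsto (hc k).2 ((eventually_ge_atTop (1 : ℝ)).mono (hc k).1)
  have hIt : ∀ k, I k ≠ ⊤ := fun k => ((hIle k).trans_lt ENNReal.coe_lt_top).ne
  have hmeas := ShotNoise.measurable_sqOrigin hg u hφ hη hκ hW hW0
  have heq : ∀ k (q : 𝕄 × (Fin k → ShotNoise.E d × 𝕄)),
      (∫ ω, ShotNoise.originDiff φ g u q.1 q.2 (η ω) ∂P) ^ 2 =
        (ShotNoise.sqOrigin P η φ g u q).toReal := fun k q =>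
    (ENNReal.toReal_ofReal (sq_nonneg _)).symm
  have hint : ∀ k : ℕ, Integrable (fun p : 𝕄 × (Fin k → ShotNoise.E d × 𝕄) =>
      (∫ ω, ShotNoise.originDiff φ g u p.1 p.2 (η ω) ∂P) ^ 2) (ρ k) := by
    intro k
    simp_rw [heq k]
    exact integrable_toReal_of_lintegral_ne_top (hmeas k).aemeasurable (hIt k)
  have hterm : ∀ k : ℕ, ∫ m, ∫ x : Fin k → ShotNoise.E d × 𝕄,
      (∫ ω, ShotNoise.originDiff φ g u m x (η ω) ∂P) ^ 2
        ∂(Measure.pi fun _ => ShotNoise.intensity d γ Q) ∂Q = (I k).toReal := by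
    intro k
    rw [← integral_prod _ (hint k)]
    simp_rw [heq k]
    exact integral_toReal (hmeas k).aemeasurable
      (ae_of_all _ fun q => ENNReal.ofReal_lt_top)
  set B : ℕ → ℝ := fun k => (γ : ℝ) / ((k + 1).factorial : ℝ) * (c * (16 * κ) ^ k : ℝ≥0) with hB
  have hBsum : Summable B := by
    -- Weakening 1/(k+1)! to 1/k! leaves an exponential series as majorant.
    refine Summable.of_nonneg_of_le (fun k => by positivity) (fun k => ?_)
      ((Real.summable_pow_div_factorial ((16 * κ : ℝ≥0) : ℝ)).mul_left ((γ : ℝ) * c))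
    have h1 : (k.factorial : ℝ) ≤ (k + 1).factorial := by
      exact_mod_cast Nat.factorial_le k.le_succ
    have h2 : (γ : ℝ) / ((k + 1).factorial : ℝ) ≤ γ / (k.factorial : ℝ) := by gcongr
    refine (mul_le_mul_of_nonneg_right h2 (by positivity)).trans_eq ?_
    push_cast
    ring
  have hnn : ∀ k (t : ℝ≥0∞), t ≤ (c * (16 * κ) ^ k : ℝ≥0) →
      ‖(γ : ℝ) / ((k + 1).factorial : ℝ) * t.toReal‖ ≤ B k := by
    intro k t ht
    rw [Real.norm_of_nonneg (by positivity)]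
    exact mul_le_mul_of_nonneg_left (ENNReal.toReal_le_coe_of_le_coe ht) (by positivity)
  refine ⟨fun r _ => ShotNoise.memLp_windowFun hg u hφ hη hκ (hW.smul r), fun k m x => ?_, hint,
    ∑' k : ℕ, (γ : ℝ) / ((k + 1).factorial : ℝ) * (I k).toReal, ?_, ?_⟩
  · have hK := ShotNoise.isCompactConvex_commonSupp (g := g) m x
    have hΛ := ShotNoise.measure_winSet_ne_top hK.1.isBounded hκ
    have hBm := ShotNoise.measurableSet_winSet hg (ShotNoise.commonSupp g m x)
    have : IsFiniteMeasure ((ShotNoise.intensity d γ Q).restrict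
        (ShotNoise.winSet g (ShotNoise.commonSupp g m x))) := ⟨by simpa using hΛ.lt_top⟩
    -- Unfolded, `originDiff` is the difference operator of `windowFun` in the fixed window
    -- `commonSupp g m x`.
    exact (hη.integrable_diffOp_iff hBm hΛ (ShotNoise.windowFun_restrict φ u hBm subset_rfl)
      (ShotNoise.measurable_windowFun hg u hφ hK) _).mpr
      (ShotNoise.integrable_confDiff_windowFun hg u hφ hK _ _ _)
  · simp_rw [hterm]
    exact (Summable.of_norm_bounded hBsum fun k => hnn k _ (hIle k)).hasSum
  · have hlim := tendsto_tsum_of_dominated_convergence (𝓕 := atTop) (f := fun (r : ℝ) (k : ℕ) =>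
      (γ : ℝ) / ((k + 1).factorial : ℝ) *
        (∫⁻ q, ShotNoise.normDiff P η φ g u (r • W) q ∂ρ k).toReal) hBsum
      (fun k => ((ENNReal.tendsto_toReal (hIt k)).comp (hc k).2).const_mul _)
      ((eventually_ge_atTop (1 : ℝ)).mono fun r hr k => hnn k _ ((hc k).1 r hr))
    refine hlim.congr' ?_
    filter_upwards [eventually_ge_atTop (1 : ℝ)] with r hr
    have hrW0 : volume (r • W) ≠ 0 := by
      rw [ShotNoise.volume_smul (by linarith)]
      exact mul_ne_zero (by simpa using pow_pos (by linarith : 0 < r) d) hW0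
    have hvar := ShotNoise.hasSum_variance_windowFun hg u hφ hη hκ (hW.smul r)
    refine ((hvar.div_const (volume.real (r • W))).tsum_eq.symm.trans ?_).symm
    refine tsum_congr fun k => ?_
    rw [mul_div_assoc, ShotNoise.integral_sq_meanDiff_div hg u hφ hη hκ (hW.smul r) hrW0]
    ring
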